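/- Let $d\ge 1$ and $0<\beta<\alpha\le 1$. Let $H_0=-\Delta$ with domain $H^2(\mathbb R^d)$ in $L^2(\mathbb R^d)$, and write $\hat v(\xi)=(2\pi)^{-d/2}\int_{\mathbb R^d} e^{-ix\cdot\xi}v(x)\,dx$ for the unitary Fourier transform. Let $u_0\in L^2(\mathbb R^d)$, $u_0\neq 0$, be such that $\hat u_0$ is a $C^1$ function with compact support. Consider the time-fractional Schrödinger problem $-i^\beta\partial_t^\alpha u+H_0u=0$ on $\mathbb R^d\times(0,\infty)$, $u(\cdot,0)=u_0$, where $i^\beta=e^{i\pi\beta/2}$ and $\partial_t^\alpha$ is the Caputo derivative, $\partial_t^\alpha u(t)=\Gamma(1-\alpha)^{-1}\int_0^t (t-s)^{-\alpha}u'(s)\,ds$ for $\alpha<1$ and $\partial_t^1u=u'$. A solution is a function $u\in L^1_{\rm loc}((0,\infty);H^2(\mathbb R^d))$ which belongs to $W^{1,1}(0,T;L^2(\mathbb R^d))$ for every $T>0$ (and is identified with its continuous representative), satisfies the equation almost everywhere, and satisfies $\lim_{t\downarrow0}\|u(\cdot,t)-u_0\|_{L^2}=0$. Then there is a unique solution $u$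 on $[0,\infty)$; for all $t\ge 0$ one has $(1+|x|^2)^{1/2}u(\cdot,t)\in L^2(\mathbb R^d)$, and the mean square displacement $$D_2(u_0,t)=\int_{\mathbb R^d}|x|^2|u(x,t)|^2\,dx=\|\nabla\hat u(\cdot,t)\|_{L^2}^2$$ grows exponentially: there is $a>0$ with $D_2(u_0,t)\ge e^{at}$ for all large $t$. More precisely, there are finite constants $c,C>0$, depending only on $d,\alpha,\beta,u_0$, such that for all real $\Lambda_-\ge 0$ and $\Lambda_+$ with $\operatorname{supp}\hat u_0\subset\{\xi\in\mathbb R^d:\Lambda_-\le|\xi|\le\Lambda_+\}$, as $t\to\infty$, $$e^{2\cos(\frac{\pi\beta}{2\alpha})\Lambda_-^{2/\alpha}t}\bigl(c+O(t^{-1})\bigr)\le D_2(u_0,t)\le e^{2\cos(\frac{\pi\beta}{2\alpha})\Lambda_+^{2/\alpha}t}\bigl(C+O(t^{-1})\bigr).$$ Moreover, with $N:=\bigl\||\xi|^{\frac{2-\alpha}{\alpha}}\hat u_0\bigr\|_{L^2}^2$, for each of the two prefactors $p(t)=\frac{4}{\alpha^2}\,t$ and $p(t)=\frac{4}{\alpha^4}\,t^2$,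 as $t\to\infty$, $$p(t)\,e^{2\cos(\frac{\pi\beta}{2\alpha})\Lambda_-^{2/\alpha}t}\bigl(N+O(t^{-1})\bigr)\le D_2(u_0,t)\le p(t)\,e^{2\cos(\frac{\pi\beta}{2\alpha})\Lambda_+^{2/\alpha}t}\bigl(N+O(t^{-1})\bigr).$$ -/

import Mathlib

open MeasureTheory Filter Topology Asymptotics
open scoped SchwartzMap Laplacian

noncomputable section

/-- The Euclidean space `ℝ^d`. -/
abbrev RSpace (d : ℕ) : Type := EuclideanSpace ℝ (Fin d)

/-- The complex Hilbert space `L²(ℝ^d)`. -/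
abbrev L2Space (d : ℕ) : Type := Lp ℂ 2 (volume : Measure (RSpace d))

/-- The adjoint Fourier transform with the unitary normalization in angular frequency,
`(F* g)(x) = (2π)^{-d/2} ∫ e^{i x·ξ} g(ξ) dξ`, for integrable `g`. -/
def adjointFourier {d : ℕ} (g : RSpace d → ℂ) (x : RSpace d) : ℂ :=
  (((2 * Real.pi) ^ (-(d : ℝ) / 2) : ℝ) : ℂ) *
    ∫ ξ : RSpace d, Complex.exp (Complex.I * ((inner ℝ x ξ : ℝ) : ℂ)) * g ξ

/-- `f` lies in the domain `H²(ℝ^d)` of `H₀ = -Δ`, and `H₀ f = h`. -/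
def IsFreeHamiltonian {d : ℕ} (f h : L2Space d) : Prop :=
  TemperedDistribution.MemSobolev 2 2 (f : 𝓢'(RSpace d, ℂ)) ∧
    -(Δ (f : 𝓢'(RSpace d, ℂ))) = (h : 𝓢'(RSpace d, ℂ))

/-- The Caputo derivative of order `α ∈ (0, 1]` of a function with weak derivative `v`: it is
`Γ(1-α)⁻¹ ∫₀ᵗ (t-s)^{-α} v(s) ds` for `α < 1`, and `v(t)` for `α = 1`. -/
def caputo {d : ℕ} (α : ℝ) (v : ℝ → L2Space d) (t : ℝ) : L2Space d :=
  if α = 1 then v t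
  else (Real.Gamma (1 - α))⁻¹ • ∫ s in (0 : ℝ)..t, ((t - s) ^ (-α) : ℝ) • v s

/-- `v` is integrable on every `(0, T)` and is the weak derivative of `u` there, where `u` stands for
the continuous representative on `[0, ∞)`; that is, `u ∈ W^{1,1}(0, T; L²(ℝ^d))` for every `T`
and `u' = v`. -/
def IsW11WithDeriv {d : ℕ} (u v : ℝ → L2Space d) : Prop :=
  (∀ T : ℝ, 0 < T → IntegrableOn v (Set.Ioc 0 T) volume) ∧
    ∀ t : ℝ, 0 ≤ t → u t = u 0 + ∫ s in (0 : ℝ)..t, v s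

/-- `u` solves `-i^β ∂_t^α u + H₀ u = 0` on `ℝ^d × (0, ∞)` with initial state `u₀`. Here `v` is the
time derivative of `u`, and `h = H₀ u`, so that local integrability of `h` (and continuity of `u`)
says that `u` is locally integrable with values in the domain of `H₀`. -/
def IsTFSESolution {d : ℕ} (α β : ℝ) (u₀ : L2Space d) (u : ℝ → L2Space d) : Prop :=
  ∃ v h : ℝ → L2Space d,
    IsW11WithDeriv u v ∧
    LocallyIntegrableOn h (Set.Ioi 0) volume ∧
    (∀ᵐ t : ℝ ∂(volume.restrict (Set.Ioi 0)), IsFreeHamiltonian (u t) (h t)) ∧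
    (∀ᵐ t : ℝ ∂(volume.restrict (Set.Ioi 0)),
      -((Complex.I ^ (β : ℂ)) • caputo α v t) + h t = 0) ∧
    Tendsto (fun t => ‖u t - u₀‖) (𝓝[>] (0 : ℝ)) (𝓝 0)

/-- Membership in the weighted space of all `φ ∈ L²` with `(1 + |x|²)^{1/2} φ ∈ L²`. -/
def MemWeightedL2 {d : ℕ} (φ : L2Space d) : Prop :=
  Integrable (fun x : RSpace d => (1 + ‖x‖ ^ 2) * ‖φ x‖ ^ 2) volume

/-- The mean square displacement `∫ |x|² |φ(x)|² dx`. -/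
def meanSquareDisplacement {d : ℕ} (φ : L2Space d) : ℝ :=
  ∫ x : RSpace d, ‖x‖ ^ 2 * ‖φ x‖ ^ 2

/-- The squared norm `‖ |ξ|^{(2-α)/α} g ‖²` in `L²(ℝ^d)`. -/
def weightedNormSq {d : ℕ} (α : ℝ) (g : RSpace d → ℂ) : ℝ :=
  ∫ ξ : RSpace d, (‖ξ‖ ^ ((2 - α) / α) * ‖g ξ‖) ^ 2

/-- The exponential `exp(2 cos(πβ/(2α)) Λ^{2/α} t)`. -/
def growthExp (α β L t : ℝ) : ℝ :=
  Real.exp (2 * Real.cos (Real.pi * β / (2 * α)) * L ^ (2 / α) * t)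

end

/-! On the Fourier side the equation is a family of scalar fractional equations, solved by û(ξ,t) =
E_α(ω t^α |ξ|²) û₀(ξ) with ω = i^{-β}. Let s₀ = e^{-iπβ/(2α)}. Then |s₀| = 1, s₀^α = ω, and κ = Re
s₀ = cos(πβ/(2α)) is positive because β < α. In the rescaled time τ = |ξ|^{2/α} t, E_α(ωτ^α) is
O(e^{κτ}), and its logarithmic derivative W(τ) = τ d/dτ E_α(ωτ^α) equals (s₀/α) τ e^{s₀τ} +
O(e^{κτ}) (`exists_mittagLefflerRay_asymptotics`). The latter is read off from the Laplace transform
of W, whose only singularity in the right half-plane is a double pole at s₀.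

By Plancherel the mean square displacement is ‖∇û‖², and ∇û is the sum of (2/α) ξ|ξ|⁻² W û₀ and E_α
∇û₀.

Upper bound: W carries a factor t, but û₀ is Lipschitz and vanishes on the sphere of the largest
radius R in its support, so |û₀| ≤ L(R - |ξ|), while the exponent falls short of its maximum by at
least a multiple of (R - |ξ|)t. Since x e^{-δx} is bounded, the factor t is absorbed, and the
displacement is at most K e^{2κR^{2/α}t} without polynomial prefactor
(`exists_norm_fderiv_evolvedSymbol_le`).

Lower bound: û₀ is nonzero on an open set, hence at two points of different norm. Near the outer
point W dominates, which gives growth at a rate ρ strictly above the norm of the inner point, and so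
above Λ₋ (`exists_le_norm_fderiv_evolvedSymbol`). The displacement therefore beats every polynomial
times the exponential with Λ₋.

All three two-sided estimates follow. The lower ones hold with zero remainder for any constant and
any power of t. In the upper ones with prefactor a remainder proportional to 1/t supplies the
constant K, so that N enters only through N ≥ 0.

For existence, compact support allows -Δ to be replaced by a bounded truncated multiplier, and the
solution is an operator Mittag-Leffler series (`isTFSESolution_fracSeries`). For uniqueness,
fractional integration turns the equation into a Volterra equation, which after projection to a
frequency ball has a bounded generator (`fractional_volterra_unique`). -/

/-! ### Growth of Gamma and the fractional integration kernels. -/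

/-- The kernel `t^(a-1) / Γ(a)` of fractional integration of order `a`. -/
noncomputable def fracKernel (a t : ℝ) : ℝ := t ^ (a - 1) / Real.Gamma a

/-- Restrict the Gamma integral to x > M and bound x^a below by M^a there. With M free, this makes Γ
outgrow every exponential, which is all that the series need. -/
theorem rpow_mul_exp_neg_le_Gamma_add_one {M a : ℝ} (hM : 0 < M) (ha : 0 ≤ a) :
    M ^ a * Real.exp (-M) ≤ Real.Gamma (a + 1) := by
  have hint := Real.GammaIntegral_convergent (s := a + 1) (by linarith)
  rw [Real.Gamma_eq_integral (by linarith), ← integral_exp_neg_Ioi, ← integral_const_mul]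
  have h1 : ∫ x in Set.Ioi M, M ^ a * Real.exp (-x) ≤
      ∫ x in Set.Ioi M, Real.exp (-x) * x ^ (a + 1 - 1) := by
    refine setIntegral_mono_on ((integrableOn_exp_neg_Ioi M).const_mul _)
      (hint.mono_set (Set.Ioi_subset_Ioi hM.le)) measurableSet_Ioi fun x hx => ?_
    rw [add_sub_cancel_right, mul_comm]
    exact mul_le_mul_of_nonneg_left (Real.rpow_le_rpow hM.le (le_of_lt hx) ha) (Real.exp_pos _).le
  refine h1.trans (setIntegral_mono_set hint ?_ (Set.Ioi_subset_Ioi hM.le).eventuallyLE)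
  filter_upwards [ae_restrict_mem measurableSet_Ioi] with x hx
  exact mul_nonneg (Real.exp_pos _).le (Real.rpow_nonneg (le_of_lt hx) _)

theorem summable_pow_div_Gamma {α b : ℝ} (hα : 0 < α) (hb : 0 < b) (r : ℝ) :
    Summable fun k : ℕ => r ^ k / Real.Gamma (α * k + b) := by
  -- With this choice M^(αk) beats |r|^k by a factor of at least 2^k, so the terms are dominated by
  -- a linear factor times 2^(-k).
  set M : ℝ := (2 * (|r| + 1)) ^ α⁻¹ with hMdef
  have hM : 0 < M := by positivity
  have hMα : M ^ α = 2 * (|r| + 1) := by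
    rw [hMdef, ← Real.rpow_mul (by positivity), inv_mul_cancel₀ hα.ne', Real.rpow_one]
  have hs : Summable fun k : ℕ => Real.exp M * M ^ (-b) *
      (α * ((k : ℝ) ^ 1 * (1 / 2) ^ k) + b * (1 / 2) ^ k) := by
    have h1 : Summable fun k : ℕ => (k : ℝ) ^ 1 * (1 / 2 : ℝ) ^ k :=
      summable_pow_mul_geometric_of_norm_lt_one 1 (by norm_num)
    exact ((h1.mul_left α).add (summable_geometric_two.mul_left b)).mul_left _
  refine hs.of_norm_bounded fun k => ?_
  have hx : 0 < α * k + b := by positivity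
  have hG := rpow_mul_exp_neg_le_Gamma_add_one hM hx.le
  rw [Real.Gamma_add_one hx.ne'] at hG
  have hGp := Real.Gamma_pos_of_pos hx
  rw [norm_div, norm_pow, Real.norm_eq_abs, Real.norm_of_nonneg hGp.le, div_le_iff₀ hGp]
  have hMx : M ^ (α * k + b) = (2 * (|r| + 1)) ^ k * M ^ b := by
    rw [Real.rpow_add hM, Real.rpow_mul hM.le, hMα, Real.rpow_natCast]
  have h2 : Real.exp M * M ^ (-b) * (1 / 2) ^ k * (M ^ (α * k + b) * Real.exp (-M)) =
      (|r| + 1) ^ k := by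
    rw [hMx, Real.rpow_neg hM.le, Real.exp_neg, mul_pow, one_div, inv_pow]
    field_simp
  calc |r| ^ k ≤ (|r| + 1) ^ k := by gcongr; linarith
    _ = Real.exp M * M ^ (-b) * (1 / 2) ^ k * (M ^ (α * k + b) * Real.exp (-M)) := h2.symm
    _ ≤ Real.exp M * M ^ (-b) * (1 / 2) ^ k * ((α * k + b) * Real.Gamma (α * k + b)) := by
        gcongr
    _ = _ := by ring

theorem fracKernel_nonneg {a t : ℝ} (ha : 0 < a) (ht : 0 ≤ t) : 0 ≤ fracKernel a t :=
  div_nonneg (Real.rpow_nonneg ht _) (Real.Gamma_pos_of_pos ha).le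

/-- The semigroup law of fractional integration, which is the Beta integral rescaled to length t. -/
theorem integral_fracKernel_mul_fracKernel {a b t : ℝ} (ha : 0 < a) (hb : 0 < b) (ht : 0 < t) :
    ∫ s in (0 : ℝ)..t, fracKernel a (t - s) * fracKernel b s = fracKernel (a + b) t := by
  have hΓa := (Real.Gamma_pos_of_pos ha).ne'
  have hΓb := (Real.Gamma_pos_of_pos hb).ne'
  have hΓ := (Real.Gamma_pos_of_pos (add_pos ha hb)).ne'
  have key := Complex.betaIntegral_scaled (b : ℂ) (a : ℂ) ht
  have hbeta := Complex.Gamma_mul_Gamma_eq_betaIntegral (s := (b : ℂ)) (t := (a : ℂ))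
    (by simpa using hb) (by simpa using ha)
  have hreal : ∫ s in (0 : ℝ)..t, ((s ^ (b - 1) * (t - s) ^ (a - 1) : ℝ) : ℂ) =
      ∫ x in (0 : ℝ)..t, (x : ℂ) ^ ((b : ℂ) - 1) * ((t : ℂ) - x) ^ ((a : ℂ) - 1) := by
    refine intervalIntegral.integral_congr fun s hs => ?_
    rw [Set.uIcc_of_le ht.le] at hs
    simp only [Complex.ofReal_mul, Complex.ofReal_cpow hs.1,
      Complex.ofReal_cpow (sub_nonneg.2 hs.2), Complex.ofReal_sub, Complex.ofReal_one]
  rw [intervalIntegral.integral_ofReal] at hreal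
  have hval : (∫ s in (0 : ℝ)..t, s ^ (b - 1) * (t - s) ^ (a - 1)) * Real.Gamma (b + a) =
      t ^ (b + a - 1) * (Real.Gamma b * Real.Gamma a) := by
    have : (((∫ s in (0 : ℝ)..t, s ^ (b - 1) * (t - s) ^ (a - 1)) * Real.Gamma (b + a) : ℝ) : ℂ) =
        ((t ^ (b + a - 1) * (Real.Gamma b * Real.Gamma a) : ℝ) : ℂ) := by
      push_cast
      rw [Complex.ofReal_cpow ht.le, ← Complex.Gamma_ofReal, ← Complex.Gamma_ofReal,
        ← Complex.Gamma_ofReal]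
      push_cast
      rw [hbeta, ← intervalIntegral.integral_ofReal, intervalIntegral.integral_ofReal, hreal, key]
      ring
    exact_mod_cast this
  have hcongr : ∀ s, fracKernel a (t - s) * fracKernel b s =
      (s ^ (b - 1) * (t - s) ^ (a - 1)) * (Real.Gamma a * Real.Gamma b)⁻¹ := by
    intro s
    unfold fracKernel
    field_simp
  simp_rw [hcongr]
  rw [intervalIntegral.integral_mul_const]
  unfold fracKernel
  rw [add_comm b a] at hval
  field_simp
  linarith [hval]

/-- A non-integrable function has integral 0 by convention, whereas the Beta integral is positive.
-/
theorem intervalIntegrable_fracKernel_mul {a b t : ℝ} (ha : 0 < a) (hb : 0 < b) (ht : 0 < t) :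
    IntervalIntegrable (fun s => fracKernel a (t - s) * fracKernel b s) volume 0 t := by
  by_contra h
  have h0 := intervalIntegral.integral_undef h
  rw [integral_fracKernel_mul_fracKernel ha hb ht] at h0
  have : 0 < fracKernel (a + b) t :=
    div_pos (Real.rpow_pos_of_pos ht _) (Real.Gamma_pos_of_pos (add_pos ha hb))
  exact this.ne' h0

theorem integrable_tsum_of_summable_integral_norm {γ E : Type*} [MeasurableSpace γ]
    {μ : Measure γ} [NormedAddCommGroup E] [NormedSpace ℝ E] {F : ℕ → γ → E}
    (hF : ∀ i, Integrable (F i) μ) (hsum : Summable fun i => ∫ a, ‖F i a‖ ∂μ)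
    (hs : ∀ᵐ a ∂μ, Summable fun i => F i a) :
    Integrable (fun a => ∑' i, F i a) μ := by
  have hmeas : AEStronglyMeasurable (fun a => ∑' i, F i a) μ := by
    refine aestronglyMeasurable_of_tendsto_ae atTop
      (f := fun n a => ∑ i ∈ Finset.range n, F i a) (fun n => ?_) ?_
    · exact Finset.aestronglyMeasurable_fun_sum _ fun i _ => (hF i).1
    · filter_upwards [hs] with a ha using ha.hasSum.tendsto_sum_nat
  refine ⟨hmeas, ?_⟩
  have h1 : ∀ i, ∫⁻ a, ‖F i a‖ₑ ∂μ = ENNReal.ofReal (∫ a, ‖F i a‖ ∂μ) := fun i =>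
    (ofReal_integral_norm_eq_lintegral_enorm (hF i)).symm
  have h2 : ∫⁻ a, ‖∑' i, F i a‖ₑ ∂μ ≤ ∫⁻ a, ∑' i, ‖F i a‖ₑ ∂μ :=
    lintegral_mono fun a => enorm_tsum_le_tsum_enorm
  refine h2.trans_lt ?_
  rw [lintegral_tsum fun i => (hF i).1.enorm]
  simp_rw [h1]
  exact hsum.tsum_ofReal_lt_top

/-! ### Operator Mittag-Leffler series for a bounded generator. -/

section
variable {X : Type*} [NormedAddCommGroup X] [NormedSpace ℂ X]

theorem pow_succ_apply (B : X →L[ℂ] X) (x : X) (k : ℕ) : (B ^ (k + 1)) x = (B ^ k) (B x) := by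
  rw [pow_succ]; rfl

theorem pow_succ_apply' (B : X →L[ℂ] X) (x : X) (k : ℕ) : (B ^ (k + 1)) x = B ((B ^ k) x) := by
  rw [pow_succ']; rfl

theorem norm_pow_apply_le (B : X →L[ℂ] X) (x : X) (k : ℕ) : ‖(B ^ k) x‖ ≤ ‖B‖ ^ k * ‖x‖ := by
  induction k with
  | zero => simp
  | succ k ih =>
    calc ‖(B ^ (k + 1)) x‖ = ‖B ((B ^ k) x)‖ := by rw [pow_succ_apply']
      _ ≤ ‖B‖ * (‖B‖ ^ k * ‖x‖) := B.le_opNorm_of_le ih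
      _ = _ := by ring

variable [NormedSpace ℝ X]

/-- The series `∑ t^(αk+b-1)/Γ(αk+b) Bᵏ x`, an operator Mittag-Leffler function. -/
noncomputable def fracSeries (α b : ℝ) (B : X →L[ℂ] X) (x : X) (t : ℝ) : X :=
  ∑' k : ℕ, fracKernel (α * k + b) t • (B ^ k) x

theorem fracKernel_one (t : ℝ) : fracKernel 1 t = 1 := by simp [fracKernel]

theorem fracKernel_zero_right {a : ℝ} (ha : a ≠ 1) : fracKernel a 0 = 0 := by
  simp [fracKernel, Real.zero_rpow (sub_ne_zero.2 ha)]

/-- Only the term k = 0 survives, because its kernel is 0^0 = 1. -/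
theorem fracSeries_one_zero {α : ℝ} (hα : 0 < α) (B : X →L[ℂ] X) (x : X) :
    fracSeries α 1 B x 0 = x := by
  unfold fracSeries
  rw [tsum_eq_single 0]
  · simp [fracKernel_one]
  · intro k hk
    have : 0 < α * k := by positivity
    rw [fracKernel_zero_right (by linarith), zero_smul]

theorem summable_fracKernel_mul_pow {α b : ℝ} (hα : 0 < α) (hb : 0 < b) (r : ℝ) {t : ℝ}
    (ht : 0 < t) : Summable fun k : ℕ => fracKernel (α * k + b) t * r ^ k := by
  have h := (summable_pow_div_Gamma hα hb (t ^ α * r)).mul_left (t ^ (b - 1))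
  refine h.congr fun k => ?_
  unfold fracKernel
  rw [add_sub_assoc, Real.rpow_add ht, Real.rpow_mul ht.le, Real.rpow_natCast, mul_pow]
  ring

theorem summable_fracSeries [CompleteSpace X] {α b : ℝ} (hα : 0 < α) (hb : 0 < b)
    (B : X →L[ℂ] X) (x : X) {t : ℝ} (ht : 0 < t) :
    Summable fun k : ℕ => fracKernel (α * k + b) t • (B ^ k) x := by
  refine ((summable_fracKernel_mul_pow hα hb ‖B‖ ht).mul_right ‖x‖).of_norm_bounded fun k => ?_
  rw [norm_smul, Real.norm_of_nonneg (fracKernel_nonneg (by positivity) ht.le), mul_assoc]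
  exact mul_le_mul_of_nonneg_left (norm_pow_apply_le B x k)
    (fracKernel_nonneg (by positivity) ht.le)

theorem fracSeries_one_eq_add [CompleteSpace X] {α : ℝ} (hα : 0 < α) (B : X →L[ℂ] X) (x : X)
    {t : ℝ} (ht : 0 < t) :
    fracSeries α 1 B x t = x + fracSeries α (α + 1) B (B x) t := by
  unfold fracSeries
  rw [(summable_fracSeries hα one_pos B x ht).tsum_eq_zero_add]
  congr 1
  · simp [fracKernel_one]
  · refine tsum_congr fun k => ?_
    rw [pow_succ_apply]
    congr 2
    push_cast
    ring

/-- Termwise application of the semigroup law of the kernels; the norms of the terms integrate to a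
convergent series of the same kind. The cases a = 1 and a = 1 - α give the primitive and the Caputo
derivative. -/
theorem fracSeries_convolution [CompleteSpace X] {α a b : ℝ} (hα : 0 < α) (ha : 0 < a)
    (hb : 0 < b) (B : X →L[ℂ] X) (x : X) {t : ℝ} (ht : 0 < t) :
    IntegrableOn (fun s => fracKernel a (t - s) • fracSeries α b B x s) (Set.Ioc 0 t) volume ∧
    ∫ s in (0 : ℝ)..t, fracKernel a (t - s) • fracSeries α b B x s =
      fracSeries α (a + b) B x t := by
  have hpos : ∀ k : ℕ, 0 < α * k + b := fun k => by positivity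
  set F : ℕ → ℝ → X := fun k s =>
    (fracKernel a (t - s) * fracKernel (α * k + b) s) • (B ^ k) x with hF
  have hkint : ∀ k : ℕ, IntegrableOn
      (fun s => fracKernel a (t - s) * fracKernel (α * k + b) s) (Set.Ioc 0 t) volume := fun k =>
    (intervalIntegrable_iff_integrableOn_Ioc_of_le ht.le).1
      (intervalIntegrable_fracKernel_mul ha (hpos k) ht)
  have hkval : ∀ k : ℕ, ∫ s in Set.Ioc 0 t,
      fracKernel a (t - s) * fracKernel (α * k + b) s = fracKernel (α * k + (a + b)) t :=
    fun k => by
      rw [← intervalIntegral.integral_of_le ht.le, integral_fracKernel_mul_fracKernel ha (hpos k) ht]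
      congr 1
      ring
  have hFint : ∀ k, Integrable (F k) (volume.restrict (Set.Ioc 0 t)) := fun k =>
    (hkint k).smul_const _
  have hFnorm : ∀ k, ∫ s in Set.Ioc 0 t, ‖F k s‖ =
      fracKernel (α * k + (a + b)) t * ‖(B ^ k) x‖ := fun k => by
    rw [← hkval k, ← integral_mul_const]
    refine setIntegral_congr_fun measurableSet_Ioc fun s hs => ?_
    simp only [hF, norm_smul]
    rw [Real.norm_of_nonneg (mul_nonneg (fracKernel_nonneg ha (sub_nonneg.2 hs.2))
      (fracKernel_nonneg (hpos k) hs.1.le))]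
  have hsum : Summable fun k => ∫ s in Set.Ioc 0 t, ‖F k s‖ := by
    simp_rw [hFnorm]
    refine ((summable_fracKernel_mul_pow hα (add_pos ha hb) ‖B‖ ht).mul_right ‖x‖).of_nonneg_of_le
      (fun k => mul_nonneg (fracKernel_nonneg (by positivity) ht.le) (norm_nonneg _)) fun k => ?_
    rw [mul_assoc]
    exact mul_le_mul_of_nonneg_left (norm_pow_apply_le B x k)
      (fracKernel_nonneg (by positivity) ht.le)
  have hpt : ∀ s ∈ Set.Ioc 0 t, HasSum (fun k => F k s)
      (fracKernel a (t - s) • fracSeries α b B x s) := fun s hs => by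
    have := (summable_fracSeries hα hb B x hs.1).hasSum.const_smul (fracKernel a (t - s))
    simpa only [hF, mul_smul, fracSeries] using this
  have hcongr : Set.EqOn (fun s => ∑' k, F k s)
      (fun s => fracKernel a (t - s) • fracSeries α b B x s) (Set.Ioc 0 t) :=
    fun s hs => (hpt s hs).tsum_eq
  constructor
  · refine IntegrableOn.congr_fun ?_ hcongr measurableSet_Ioc
    refine integrable_tsum_of_summable_integral_norm hFint hsum ?_
    filter_upwards [ae_restrict_mem measurableSet_Ioc] with s hs using (hpt s hs).summable
  · rw [intervalIntegral.integral_of_le ht.le, ← setIntegral_congr_fun measurableSet_Ioc hcongr,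
      ← integral_tsum_of_summable_integral_norm hFint hsum]
    refine tsum_congr fun k => ?_
    rw [integral_smul_const, hkval]

theorem integrableOn_fracSeries [CompleteSpace X] {α b : ℝ} (hα : 0 < α)
    (hb : 0 < b) (B : X →L[ℂ] X) (x : X) {t : ℝ} (ht : 0 < t) :
    IntegrableOn (fracSeries α b B x) (Set.Ioc 0 t) volume := by
  simpa [fracKernel_one] using (fracSeries_convolution hα one_pos hb B x ht).1

theorem integral_fracSeries [CompleteSpace X] {α b : ℝ} (hα : 0 < α)
    (hb : 0 < b) (B : X →L[ℂ] X) (x : X) {t : ℝ} (ht : 0 < t) :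
    ∫ s in (0 : ℝ)..t, fracSeries α b B x s = fracSeries α (b + 1) B x t := by
  have := (fracSeries_convolution hα one_pos hb B x ht).2
  simpa [fracKernel_one, add_comm] using this

variable [IsScalarTower ℝ ℂ X]

theorem map_real_smul_apply {Y : Type*} [NormedAddCommGroup Y] [NormedSpace ℂ Y]
    [NormedSpace ℝ Y] [IsScalarTower ℝ ℂ Y]
    (B : X →L[ℂ] Y) (r : ℝ) (x : X) : B (r • x) = r • B x :=
  (B.restrictScalars ℝ).map_smul r x

theorem map_fracSeries [CompleteSpace X] {α b : ℝ} (hα : 0 < α) (hb : 0 < b)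
    (B : X →L[ℂ] X) (x : X) {t : ℝ} (ht : 0 < t) :
    B (fracSeries α b B x t) = fracSeries α b B (B x) t := by
  unfold fracSeries
  rw [B.map_tsum (summable_fracSeries hα hb B x ht)]
  refine tsum_congr fun k => ?_
  rw [map_real_smul_apply, ← pow_succ_apply', pow_succ_apply]
end

/-! ### Inverting the Caputo derivative, and uniqueness for Volterra equations. -/

theorem measurable_fracKernel (a : ℝ) : Measurable (fracKernel a) := by
  unfold fracKernel
  fun_prop

theorem integral_indicator_fracKernel {a t s : ℝ} (ha : 0 < a) (ha1 : a < 1)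
    (hs : 0 ≤ s) (hst : s < t) :
    IntegrableOn (fun τ => (Set.Ioi s).indicator
      (fun τ => fracKernel a (t - τ) * fracKernel (1 - a) (τ - s)) τ) (Set.Ioc 0 t) volume ∧
    ∫ τ in Set.Ioc 0 t, (Set.Ioi s).indicator
      (fun τ => fracKernel a (t - τ) * fracKernel (1 - a) (τ - s)) τ = 1 := by
  have hb : 0 < 1 - a := by linarith
  have hinter : Set.Ioc 0 t ∩ Set.Ioi s = Set.Ioc s t := by
    ext τ
    simp only [Set.mem_inter_iff, Set.mem_Ioc, Set.mem_Ioi]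
    constructor
    · rintro ⟨⟨_, h⟩, h'⟩; exact ⟨h', h⟩
    · rintro ⟨h, h'⟩; exact ⟨⟨hs.trans_lt h, h'⟩, h⟩
  have hI := intervalIntegrable_fracKernel_mul ha hb (sub_pos.2 hst)
  have hV := integral_fracKernel_mul_fracKernel ha hb (sub_pos.2 hst)
  rw [add_sub_cancel, fracKernel_one] at hV
  have hcongr : (fun τ => fracKernel a (t - s - (τ - s)) * fracKernel (1 - a) (τ - s)) =
      fun τ => fracKernel a (t - τ) * fracKernel (1 - a) (τ - s) := by
    funext τ
    congr 2
    ring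
  constructor
  · have h2 := hI.comp_sub_right s
    rw [zero_add, sub_add_cancel, hcongr,
      intervalIntegrable_iff_integrableOn_Ioc_of_le hst.le] at h2
    rw [IntegrableOn, integrable_indicator_iff measurableSet_Ioi, IntegrableOn,
      Measure.restrict_restrict measurableSet_Ioi, Set.inter_comm, hinter]
    exact h2
  · rw [setIntegral_indicator measurableSet_Ioi, hinter, ← intervalIntegral.integral_of_le hst.le,
      ← hcongr, intervalIntegral.integral_comp_sub_right
        (fun σ => fracKernel a (t - s - σ) * fracKernel (1 - a) σ), sub_self, hV]

/-- Fubini on the triangle s < τ < t reduces the claim to the convolution of the kernels of orders a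
and 1 - a, which is identically 1. Hence fractional integration undoes the Caputo derivative up to
the initial value. -/
theorem integral_fracKernel_convolution {X : Type*} [NormedAddCommGroup X] [NormedSpace ℝ X]
    [CompleteSpace X] {a t : ℝ} (ha : 0 < a) (ha1 : a < 1) (ht : 0 < t) {ζ : ℝ → X}
    (hζ : IntegrableOn ζ (Set.Ioc 0 t) volume) :
    IntegrableOn (fun τ => fracKernel a (t - τ) •
      ∫ s in (0 : ℝ)..τ, fracKernel (1 - a) (τ - s) • ζ s) (Set.Ioc 0 t) volume ∧
    ∫ τ in (0 : ℝ)..t, fracKernel a (t - τ) •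
      ∫ s in (0 : ℝ)..τ, fracKernel (1 - a) (τ - s) • ζ s = ∫ s in (0 : ℝ)..t, ζ s := by
  have hb : 0 < 1 - a := by linarith
  set μ : Measure ℝ := volume.restrict (Set.Ioc 0 t) with hμ
  -- The kernel is extended by zero outside s < τ, so that Fubini can be used on a square.
  set K : ℝ → ℝ → ℝ := fun τ s => (Set.Ioi s).indicator
      (fun τ => fracKernel a (t - τ) * fracKernel (1 - a) (τ - s)) τ with hK
  have hKmeas : Measurable (Function.uncurry K) := by
    have : Function.uncurry K = {p : ℝ × ℝ | p.2 < p.1}.indicator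
        (fun p => fracKernel a (t - p.1) * fracKernel (1 - a) (p.1 - p.2)) := by
      funext p
      simp only [Function.uncurry, hK, Set.indicator, Set.mem_Ioi, Set.mem_ofPred_eq]
    rw [this]
    refine Measurable.indicator ?_ (measurableSet_lt measurable_snd measurable_fst)
    exact ((measurable_fracKernel a).comp (by fun_prop)).mul
      ((measurable_fracKernel (1 - a)).comp (by fun_prop))
  have hKnonneg : ∀ τ ∈ Set.Ioc 0 t, ∀ s, 0 ≤ K τ s := fun τ hτ s => by
    refine Set.indicator_apply_nonneg fun hs => ?_
    exact mul_nonneg (fracKernel_nonneg ha (sub_nonneg.2 hτ.2))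
      (fracKernel_nonneg hb (sub_nonneg.2 (le_of_lt hs)))
  have hne : ∀ᵐ s ∂μ, s ∈ Set.Ioo 0 t := by
    rw [hμ, ← restrict_Ioo_eq_restrict_Ioc]
    exact ae_restrict_mem measurableSet_Ioo
  have hint : Integrable (Function.uncurry fun τ s => K τ s • ζ s) (μ.prod μ) := by
    have hm : AEStronglyMeasurable (Function.uncurry fun τ s => K τ s • ζ s) (μ.prod μ) :=
      hKmeas.aestronglyMeasurable.smul hζ.1.comp_snd
    rw [integrable_prod_iff' hm]
    constructor
    · filter_upwards [hne] with s hs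
      exact (integral_indicator_fracKernel ha ha1 hs.1.le hs.2).1.smul_const (ζ s)
    · refine hζ.norm.congr ?_
      filter_upwards [hne] with s hs
      have h1 : ∫ τ, ‖K τ s • ζ s‖ ∂μ = ∫ τ, K τ s * ‖ζ s‖ ∂μ := by
        refine setIntegral_congr_fun measurableSet_Ioc fun τ hτ => ?_
        simp only [norm_smul, Real.norm_of_nonneg (hKnonneg τ hτ s)]
      simp only [Function.uncurry]
      rw [h1, integral_mul_const, (integral_indicator_fracKernel ha ha1 hs.1.le hs.2).2, one_mul]
  have hinner : Set.EqOn (fun τ => ∫ s, K τ s • ζ s ∂μ) (fun τ => fracKernel a (t - τ) •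
      ∫ s in (0 : ℝ)..τ, fracKernel (1 - a) (τ - s) • ζ s) (Set.Ioc 0 t) := fun τ hτ => by
    have h1 : (fun s => K τ s • ζ s) = (Set.Iio τ).indicator
        (fun s => fracKernel a (t - τ) • fracKernel (1 - a) (τ - s) • ζ s) := by
      funext s
      simp only [hK, Set.indicator, Set.mem_Ioi, Set.mem_Iio]
      split_ifs
      · rw [mul_smul]
      · rw [zero_smul]
    have h2 : Set.Ioc 0 t ∩ Set.Iio τ = Set.Ioo 0 τ := by
      ext s
      simp only [Set.mem_inter_iff, Set.mem_Ioc, Set.mem_Iio, Set.mem_Ioo]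
      constructor
      · rintro ⟨⟨h, _⟩, h'⟩; exact ⟨h, h'⟩
      · rintro ⟨h, h'⟩; exact ⟨⟨h, h'.le.trans hτ.2⟩, h'⟩
    beta_reduce
    rw [h1, hμ, setIntegral_indicator measurableSet_Iio, h2, ← integral_Ioc_eq_integral_Ioo,
      integral_smul, intervalIntegral.integral_of_le hτ.1.le]
  refine ⟨IntegrableOn.congr_fun hint.integral_prod_left hinner measurableSet_Ioc, ?_⟩
  have hswap := integral_integral_swap hint
  rw [intervalIntegral.integral_of_le ht.le, intervalIntegral.integral_of_le ht.le]
  calc ∫ τ in Set.Ioc 0 t, fracKernel a (t - τ) •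
        ∫ s in (0 : ℝ)..τ, fracKernel (1 - a) (τ - s) • ζ s
      = ∫ τ, (∫ s, K τ s • ζ s ∂μ) ∂μ := (setIntegral_congr_fun measurableSet_Ioc hinner).symm
    _ = ∫ s, (∫ τ, K τ s • ζ s ∂μ) ∂μ := hswap
    _ = ∫ s in Set.Ioc 0 t, ζ s := by
        refine integral_congr_ae ?_
        filter_upwards [hne] with s hs
        rw [integral_smul_const, (integral_indicator_fracKernel ha ha1 hs.1.le hs.2).2, one_smul]

/-- Iterating the equation n times bounds z by M‖B‖ⁿ t^(αn)/Γ(αn+1), the general term of a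
convergent series. -/
theorem fractional_volterra_unique {X : Type*} [NormedAddCommGroup X] [NormedSpace ℂ X]
    [NormedSpace ℝ X] [IsScalarTower ℝ ℂ X]
    {α : ℝ} (hα : 0 < α) (B : X →L[ℂ] X) {z : ℝ → X} {T M : ℝ}
    (hM : ∀ t ∈ Set.Ioc 0 T, ‖z t‖ ≤ M)
    (hz : ∀ t ∈ Set.Ioc 0 T, z t = ∫ τ in (0 : ℝ)..t, fracKernel α (t - τ) • B (z τ)) :
    ∀ t ∈ Set.Ioc 0 T, z t = 0 := by
  have key : ∀ n : ℕ, ∀ t ∈ Set.Ioc 0 T, ‖z t‖ ≤ ‖B‖ ^ n * M * fracKernel (α * n + 1) t := by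
    intro n
    induction n with
    | zero => intro t ht; simpa [fracKernel_one] using hM t ht
    | succ n ih =>
      intro t ht
      have hb : 0 < α * n + 1 := by positivity
      rw [hz t ht]
      have hint := (intervalIntegrable_fracKernel_mul hα hb ht.1).const_mul (‖B‖ ^ (n + 1) * M)
      refine (intervalIntegral.norm_integral_le_of_norm_le ht.1.le ?_ hint).trans_eq ?_
      · refine ae_of_all _ fun τ hτ => ?_
        have hτT : τ ∈ Set.Ioc 0 T := ⟨hτ.1, hτ.2.trans ht.2⟩
        have hk := fracKernel_nonneg hα (sub_nonneg.2 hτ.2)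
        rw [norm_smul, Real.norm_of_nonneg hk]
        calc fracKernel α (t - τ) * ‖B (z τ)‖
            ≤ fracKernel α (t - τ) * (‖B‖ * (‖B‖ ^ n * M * fracKernel (α * n + 1) τ)) :=
              mul_le_mul_of_nonneg_left (B.le_opNorm_of_le (ih τ hτT)) hk
          _ = _ := by ring
      · rw [intervalIntegral.integral_const_mul,
          integral_fracKernel_mul_fracKernel hα hb ht.1]
        congr 2
        push_cast
        ring
  intro t ht
  have hlim := ((summable_fracKernel_mul_pow hα one_pos ‖B‖ ht.1).mul_right M).tendsto_atTop_zero
  have : ‖z t‖ ≤ 0 := ge_of_tendsto' hlim fun n => by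
    refine (key n t ht).trans_eq ?_
    ring
  exact norm_le_zero_iff.1 this

/-! ### Laplace transforms of powers at complex frequency. -/

section Laplace

theorem integrableOn_rpow_mul_exp_neg_mul {b r : ℝ} (hb : 0 ≤ b) (hr : 0 < r) :
    IntegrableOn (fun t : ℝ => t ^ b * Real.exp (-(r * t))) (Set.Ioi 0) := by
  have := integrableOn_rpow_mul_exp_neg_mul_rpow (p := 1) (s := b) (b := r) (by linarith) one_pos hr
  simpa using this

theorem norm_rpow_mul_exp (b : ℝ) (s : ℂ) {t : ℝ} (ht : 0 < t) :
    ‖((t ^ b : ℝ) : ℂ) * Complex.exp (-(s * t))‖ = t ^ b * Real.exp (-(s.re * t)) := by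
  rw [norm_mul, Complex.norm_real, Complex.norm_exp, Real.norm_of_nonneg (Real.rpow_nonneg ht.le _)]
  simp

theorem aestronglyMeasurable_rpow_mul_exp (b : ℝ) (s : ℂ) (μ : Measure ℝ) :
    AEStronglyMeasurable (fun t : ℝ => ((t ^ b : ℝ) : ℂ) * Complex.exp (-(s * t))) μ := by
  refine (Measurable.mul ?_ ?_).aestronglyMeasurable
  · exact Complex.measurable_ofReal.comp (by fun_prop)
  · exact Continuous.measurable (by fun_prop)

theorem integrableOn_rpow_mul_cexp {b : ℝ} {s : ℂ} (hb : 0 ≤ b) (hs : 0 < s.re) :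
    IntegrableOn (fun t : ℝ => ((t ^ b : ℝ) : ℂ) * Complex.exp (-(s * t))) (Set.Ioi 0) := by
  refine (integrableOn_rpow_mul_exp_neg_mul hb hs).mono' (aestronglyMeasurable_rpow_mul_exp b s _) ?_
  filter_upwards [ae_restrict_mem measurableSet_Ioi] with t ht
  rw [norm_rpow_mul_exp b s ht]

theorem differentiableOn_integral_rpow_mul_cexp {b : ℝ} (hb : 0 ≤ b) :
    DifferentiableOn ℂ (fun s : ℂ =>
      ∫ t in Set.Ioi (0 : ℝ), ((t ^ b : ℝ) : ℂ) * Complex.exp (-(s * t))) {s | 0 < s.re} := by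
  intro s hs
  have hs : 0 < s.re := hs
  refine DifferentiableAt.differentiableWithinAt ?_
  -- On this neighbourhood the derivatives share the integrable bound with exponential rate Re s /
  -- 2.
  have hU : {w : ℂ | s.re / 2 < w.re} ∈ 𝓝 s :=
    (isOpen_lt continuous_const Complex.continuous_re).mem_nhds (by
      show s.re / 2 < s.re
      linarith)
  refine (hasDerivAt_integral_of_dominated_loc_of_deriv_le hU
    (F' := fun w t => ((t ^ b : ℝ) : ℂ) * (Complex.exp (-(w * t)) * (-t)))
    (bound := fun t : ℝ => t ^ (b + 1) * Real.exp (-(s.re / 2 * t)))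
    (Eventually.of_forall fun w => aestronglyMeasurable_rpow_mul_exp b w _)
    (integrableOn_rpow_mul_cexp hb hs) ?_ ?_
    (integrableOn_rpow_mul_exp_neg_mul (by linarith) (by linarith)) ?_).2.differentiableAt
  · have h := (aestronglyMeasurable_rpow_mul_exp b s (volume.restrict (Set.Ioi 0))).mul
      (Continuous.aestronglyMeasurable (f := fun t : ℝ => (-t : ℂ)) (by fun_prop))
    refine h.congr (ae_of_all _ fun t => ?_)
    simp only [Pi.mul_apply, mul_assoc]
  · filter_upwards [ae_restrict_mem measurableSet_Ioi] with t ht w hw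
    have ht : 0 < t := ht
    have hw : s.re / 2 < w.re := hw
    rw [← mul_assoc, norm_mul, norm_rpow_mul_exp b w ht, norm_neg, Complex.norm_real,
      Real.norm_of_nonneg ht.le, Real.rpow_add_one ht.ne', mul_right_comm]
    gcongr
  · refine ae_of_all _ fun t w _ => ?_
    have h1 : HasDerivAt (fun w : ℂ => -(w * t)) (-t : ℂ) w := by
      exact (((hasDerivAt_id w).mul_const (t : ℂ)).neg).congr_deriv (by simp)
    exact (h1.cexp).const_mul _

/-- Both sides are holomorphic on the right half-plane and agree on the positive reals, which
accumulate at 1; the identity theorem does the rest. -/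
theorem integral_rpow_mul_cexp {b : ℝ} {s : ℂ} (hb : 0 ≤ b) (hs : 0 < s.re) :
    ∫ t in Set.Ioi (0 : ℝ), ((t ^ b : ℝ) : ℂ) * Complex.exp (-(s * t)) =
      (Real.Gamma (b + 1) : ℂ) * s ^ (-((b : ℂ) + 1)) := by
  have hopen : IsOpen {s : ℂ | 0 < s.re} := isOpen_lt continuous_const Complex.continuous_re
  have hf := (differentiableOn_integral_rpow_mul_cexp hb).analyticOnNhd hopen
  have hg : AnalyticOnNhd ℂ (fun s : ℂ => (Real.Gamma (b + 1) : ℂ) * s ^ (-((b : ℂ) + 1)))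
      {s : ℂ | 0 < s.re} := by
    refine DifferentiableOn.analyticOnNhd (fun w hw => ?_) hopen
    have hw : 0 < w.re := hw
    exact ((differentiableAt_id.cpow_const (Or.inl hw)).const_mul _).differentiableWithinAt
  refine hf.eqOn_of_preconnected_of_frequently_eq hg
    (convex_halfSpace_re_gt 0).isPreconnected (z₀ := 1) (by simp) ?_ hs
  have hreal : ∀ r : ℝ, 0 < r →
      ∫ t in Set.Ioi (0 : ℝ), ((t ^ b : ℝ) : ℂ) * Complex.exp (-((r : ℂ) * t)) =
      (Real.Gamma (b + 1) : ℂ) * (r : ℂ) ^ (-((b : ℂ) + 1)) := by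
    intro r hr
    have h := Real.integral_rpow_mul_exp_neg_mul_Ioi (a := b + 1) (by linarith) hr
    have h2 : ((∫ t in Set.Ioi (0 : ℝ), t ^ (b + 1 - 1) * Real.exp (-(r * t)) : ℝ) : ℂ) =
        ∫ t in Set.Ioi (0 : ℝ), ((t ^ b : ℝ) : ℂ) * Complex.exp (-((r : ℂ) * t)) := by
      rw [← integral_complex_ofReal]
      congr 1
      funext t
      push_cast
      rw [add_sub_cancel_right]
    rw [← h2, h, one_div, Real.inv_rpow hr.le, ← Real.rpow_neg hr.le]
    push_cast
    rw [Complex.ofReal_cpow hr.le]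
    push_cast
    ring
  have hmap : Tendsto (fun r : ℝ => (r : ℂ)) (𝓝[≠] 1) (𝓝[≠] (1 : ℂ)) := by
    refine tendsto_nhdsWithin_of_tendsto_nhds_of_eventually_within _ ?_ ?_
    · have : Tendsto (fun r : ℝ => (r : ℂ)) (𝓝 1) (𝓝 ((1 : ℝ) : ℂ)) :=
        Complex.continuous_ofReal.tendsto 1
      exact (by simpa using this : Tendsto (fun r : ℝ => (r : ℂ)) (𝓝 1) (𝓝 1)).mono_left
        nhdsWithin_le_nhds
    · filter_upwards [self_mem_nhdsWithin] with r hr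
      intro h
      exact hr (by simpa using h)
  refine hmap.frequently (Eventually.frequently ?_)
  filter_upwards [nhdsWithin_le_nhds (lt_mem_nhds one_pos)] with r hr using hreal r hr

end Laplace

/-! ### The scalar Mittag-Leffler function along a ray and its Laplace transform. -/

section MittagLeffler

/-- The Mittag-Leffler function `E_α(z) = ∑ zᵏ / Γ(αk+1)`. -/
noncomputable def mittagLeffler (α : ℝ) (z : ℂ) : ℂ :=
  ∑' k : ℕ, ((Real.Gamma (α * k + 1))⁻¹ : ℝ) * z ^ k

/-- The series of `z E_α'(z)`. -/
noncomputable def mittagLefflerDeriv (α : ℝ) (z : ℂ) : ℂ :=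
  ∑' k : ℕ, ((k * (Real.Gamma (α * k + 1))⁻¹ : ℝ) : ℂ) * z ^ k

variable {α : ℝ}

theorem norm_mittagLeffler_term (hα : 0 < α) (k : ℕ) (z : ℂ) :
    ‖(((Real.Gamma (α * k + 1))⁻¹ : ℝ) : ℂ) * z ^ k‖ = ‖z‖ ^ k / Real.Gamma (α * k + 1) := by
  have := (Real.Gamma_pos_of_pos (show 0 < α * k + 1 by positivity)).le
  rw [norm_mul, Complex.norm_real, norm_pow, Real.norm_of_nonneg (inv_nonneg.2 this)]
  ring

theorem hasSum_mittagLeffler (hα : 0 < α) (z : ℂ) :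
    HasSum (fun k : ℕ => (((Real.Gamma (α * k + 1))⁻¹ : ℝ) : ℂ) * z ^ k) (mittagLeffler α z) := by
  refine Summable.hasSum ?_
  refine (summable_pow_div_Gamma hα one_pos ‖z‖).of_norm_bounded fun k => ?_
  rw [norm_mittagLeffler_term hα]

theorem norm_mittagLeffler_term_le (hα : 0 < α) {R : ℝ} (k : ℕ) (w : ℂ)
    (hw : w ∈ Metric.ball (0 : ℂ) R) :
    ‖(((Real.Gamma (α * k + 1))⁻¹ : ℝ) : ℂ) * w ^ k‖ ≤ R ^ k / Real.Gamma (α * k + 1) := by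
  have := (Real.Gamma_pos_of_pos (show 0 < α * k + 1 by positivity)).le
  rw [norm_mittagLeffler_term hα]
  have hw' : ‖w‖ ≤ R := (mem_ball_zero_iff.1 hw).le
  gcongr

theorem differentiable_mittagLeffler (hα : 0 < α) : Differentiable ℂ (mittagLeffler α) := by
  intro z
  have h := Complex.differentiableOn_tsum_of_summable_norm
    (summable_pow_div_Gamma hα one_pos (‖z‖ + 1))
    (F := fun (k : ℕ) w => (((Real.Gamma (α * k + 1))⁻¹ : ℝ) : ℂ) * w ^ k)
    (fun k => (by fun_prop)) Metric.isOpen_ball (norm_mittagLeffler_term_le hα)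
  exact h.differentiableAt (Metric.isOpen_ball.mem_nhds (by simp))

theorem hasSum_mul_deriv_mittagLeffler (hα : 0 < α) (z : ℂ) :
    HasSum (fun k : ℕ => ((k * (Real.Gamma (α * k + 1))⁻¹ : ℝ) : ℂ) * z ^ k)
      (z * deriv (mittagLeffler α) z) := by
  have h := Complex.hasSum_deriv_of_summable_norm
    (summable_pow_div_Gamma hα one_pos (‖z‖ + 1))
    (F := fun (k : ℕ) w => (((Real.Gamma (α * k + 1))⁻¹ : ℝ) : ℂ) * w ^ k)
    (fun k => (by fun_prop)) Metric.isOpen_ball (norm_mittagLeffler_term_le hα)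
    (z := z) (by simp)
  refine (h.mul_left z).congr_fun fun k => ?_
  have hd : HasDerivAt (fun w : ℂ => (((Real.Gamma (α * k + 1))⁻¹ : ℝ) : ℂ) * w ^ k)
      ((((Real.Gamma (α * k + 1))⁻¹ : ℝ) : ℂ) * (k * z ^ (k - 1))) z :=
    (hasDerivAt_pow k z).const_mul _
  rw [hd.deriv]
  rcases k with _ | k
  · simp
  · push_cast
    rw [pow_succ]
    ring

theorem mul_deriv_mittagLeffler (hα : 0 < α) (z : ℂ) :
    z * deriv (mittagLeffler α) z = mittagLefflerDeriv α z :=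
  (hasSum_mul_deriv_mittagLeffler hα z).tsum_eq.symm

theorem continuous_mittagLefflerDeriv (hα : 0 < α) : Continuous (mittagLefflerDeriv α) := by
  have : mittagLefflerDeriv α = fun z => z * deriv (mittagLeffler α) z :=
    funext fun z => (mul_deriv_mittagLeffler hα z).symm
  rw [this]
  exact continuous_id.mul (differentiable_mittagLeffler hα).deriv.continuous

/-- The logarithmic-type derivative `t ∂ₜ E_α(ω t^α)` along a ray. -/
noncomputable def mittagLefflerRay (α : ℝ) (ω : ℂ) (t : ℝ) : ℂ :=
  α * mittagLefflerDeriv α (ω * (t ^ α : ℝ))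

theorem hasDerivAt_mittagLeffler_ray (hα : 0 < α) (ω : ℂ) {t : ℝ} (ht : 0 < t) :
    HasDerivAt (fun t : ℝ => mittagLeffler α (ω * (t ^ α : ℝ)))
      (mittagLefflerRay α ω t / t) t := by
  have h1 : HasDerivAt (fun t : ℝ => ω * ((t ^ α : ℝ) : ℂ)) (ω * ((α * t ^ (α - 1) : ℝ) : ℂ)) t :=
    ((Real.hasDerivAt_rpow_const (Or.inl ht.ne')).ofReal_comp).const_mul ω
  have h2 := ((differentiable_mittagLeffler hα _).hasDerivAt).comp t h1
  refine h2.congr_deriv ?_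
  have ht' : (t : ℂ) ≠ 0 := by exact_mod_cast ht.ne'
  rw [mittagLefflerRay, ← mul_deriv_mittagLeffler hα, Real.rpow_sub_one ht.ne']
  push_cast
  field_simp

/-- The series is transformed term by term and summed by ∑ k qᵏ = q/(1-q)² with q = ω s^(-α). The
transform decays like |s|^(-1-α), hence is integrable on vertical lines, whereas that of E_α itself
decays only like 1/|s|; this is why t ∂ₜ E_α is studied first. -/
theorem mittagLefflerRay_laplace (hα : 0 < α) {ω : ℂ} (hω : ‖ω‖ = 1) {s : ℂ} (hs : 1 < s.re) :
    IntegrableOn (fun t : ℝ => Complex.exp (-(s * t)) * mittagLefflerRay α ω t) (Set.Ioi 0) ∧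
    ∫ t in Set.Ioi (0 : ℝ), Complex.exp (-(s * t)) * mittagLefflerRay α ω t =
      α * ω * s ^ ((α : ℂ) - 1) / (s ^ (α : ℂ) - ω) ^ 2 := by
  have hs0 : 0 < s.re := by linarith
  have hsne : s ≠ 0 := fun h => by simp [h] at hs0
  set c : ℕ → ℝ := fun k => α * (k * (Real.Gamma (α * k + 1))⁻¹) with hc
  have hΓ : ∀ k : ℕ, 0 < Real.Gamma (α * k + 1) := fun k =>
    Real.Gamma_pos_of_pos (by positivity)
  set F : ℕ → ℝ → ℂ := fun k t =>
    ((c k : ℂ) * ω ^ k) * (((t ^ (α * k) : ℝ) : ℂ) * Complex.exp (-(s * t))) with hF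
  have hFint : ∀ k, IntegrableOn (F k) (Set.Ioi 0) := fun k =>
    (integrableOn_rpow_mul_cexp (by positivity) hs0).const_mul _
  have hpt : ∀ t ∈ Set.Ioi (0 : ℝ), HasSum (fun k => F k t)
      (Complex.exp (-(s * t)) * mittagLefflerRay α ω t) := fun t ht => by
    have ht : 0 < t := ht
    have h := (hasSum_mul_deriv_mittagLeffler hα (ω * (t ^ α : ℝ))).mul_left
      (Complex.exp (-(s * t)) * α)
    rw [mul_deriv_mittagLeffler hα, mul_assoc, ← mittagLefflerRay] at h
    refine h.congr_fun fun k => ?_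
    simp only [hF, hc]
    rw [Real.rpow_mul ht.le, Real.rpow_natCast, mul_pow]
    push_cast
    ring
  have hFnorm : ∀ k, ∫ t in Set.Ioi (0 : ℝ), ‖F k t‖ =
      α * s.re⁻¹ * (k * (s.re ^ (-α)) ^ k) := fun k => by
    have h1 : ∫ t in Set.Ioi (0 : ℝ), ‖F k t‖ =
        ∫ t in Set.Ioi (0 : ℝ), c k * (t ^ (α * k + 1 - 1) * Real.exp (-(s.re * t))) := by
      refine setIntegral_congr_fun measurableSet_Ioi fun t ht => ?_
      simp only [hF]
      rw [norm_mul, norm_rpow_mul_exp _ _ ht, norm_mul, norm_pow, hω, one_pow, mul_one,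
        Complex.norm_real, Real.norm_of_nonneg, add_sub_cancel_right]
      have := hΓ k
      positivity
    rw [h1, integral_const_mul, Real.integral_rpow_mul_exp_neg_mul_Ioi (by positivity) hs0,
      one_div, Real.inv_rpow hs0.le, ← Real.rpow_neg hs0.le, neg_add, Real.rpow_add hs0,
      Real.rpow_neg_one, ← neg_mul, Real.rpow_mul hs0.le, Real.rpow_natCast]
    have := (hΓ k).ne'
    simp only [hc]
    field_simp
  -- This is where Re s > 1 enters: it makes the series of absolute integrals converge.
  have hq : ‖s.re ^ (-α)‖ < 1 := by
    rw [Real.norm_of_nonneg (by positivity)]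
    exact Real.rpow_lt_one_of_one_lt_of_neg hs (by linarith)
  have hsum : Summable fun k => ∫ t in Set.Ioi (0 : ℝ), ‖F k t‖ := by
    simp_rw [hFnorm]
    exact (hasSum_coe_mul_geometric_of_norm_lt_one hq).summable.mul_left _
  have hcongr : Set.EqOn (fun t => ∑' k, F k t)
      (fun t => Complex.exp (-(s * t)) * mittagLefflerRay α ω t) (Set.Ioi 0) :=
    fun t ht => (hpt t ht).tsum_eq
  constructor
  · refine IntegrableOn.congr_fun ?_ hcongr measurableSet_Ioi
    refine integrable_tsum_of_summable_integral_norm hFint hsum ?_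
    filter_upwards [ae_restrict_mem measurableSet_Ioi] with t ht using (hpt t ht).summable
  rw [← setIntegral_congr_fun measurableSet_Ioi hcongr,
    ← integral_tsum_of_summable_integral_norm hFint hsum]
  have hFval : ∀ k, ∫ t in Set.Ioi (0 : ℝ), F k t =
      α * s⁻¹ * (k * (ω * s ^ (-(α : ℂ))) ^ k) := fun k => by
    simp only [hF]
    rw [integral_const_mul, integral_rpow_mul_cexp (by positivity) hs0, neg_add,
      Complex.cpow_add _ _ hsne, Complex.cpow_neg_one, mul_pow, ← Complex.cpow_mul_nat]
    have h1 : (((Real.Gamma (α * k + 1)) : ℝ) : ℂ) ≠ 0 := by exact_mod_cast (hΓ k).ne'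
    simp only [hc]
    push_cast
    rw [neg_mul]
    field_simp
  simp_rw [hFval]
  have hsα : s ^ (α : ℂ) ≠ 0 := by simp [Complex.cpow_eq_zero_iff, hsne]
  have hnorm1 : 1 < ‖s ^ (α : ℂ)‖ := by
    rw [Complex.norm_cpow_real]
    exact Real.one_lt_rpow (hs.trans_le (Complex.re_le_norm s)) hα
  have hq2 : ‖ω * s ^ (-(α : ℂ))‖ < 1 := by
    rw [norm_mul, hω, one_mul, Complex.cpow_neg, norm_inv]
    exact inv_lt_one_of_one_lt₀ hnorm1
  rw [tsum_mul_left, tsum_coe_mul_geometric_of_norm_lt_one hq2, Complex.cpow_neg,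
    Complex.cpow_sub _ _ hsne, Complex.cpow_one]
  have h3 : s ^ (α : ℂ) - ω ≠ 0 := by
    intro h
    rw [sub_eq_zero.1 h, hω] at hnorm1
    exact lt_irrefl _ hnorm1
  have h4 : 1 - ω * (s ^ (α : ℂ))⁻¹ ≠ 0 := by
    intro h
    apply h3
    field_simp at h
    simpa using h
  field_simp

end MittagLeffler

/-! ### Laplace inversion and contour shift. -/

-- The damped function e^{-ct} f(t) is continuous, vanishes for t ≤ 0, and its Fourier transform at
-- v is H(c + 2πiv), so Fourier inversion applies.
open FourierTransform in
theorem laplace_inversion {f : ℝ → ℂ} {c : ℝ} {H : ℂ → ℂ} (hf : Continuous f)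
    (hf0 : ∀ t ≤ 0, f t = 0)
    (hint : IntegrableOn (fun t : ℝ => Complex.exp (-((c : ℂ) * t)) * f t) (Set.Ioi 0))
    (hL : ∀ y : ℝ, ∫ t in Set.Ioi (0 : ℝ), Complex.exp (-((c + y * Complex.I) * t)) * f t =
      H (c + y * Complex.I))
    (hH : Integrable fun y : ℝ => H (c + y * Complex.I)) (t : ℝ) :
    f t = (2 * Real.pi : ℂ)⁻¹ *
      ∫ y : ℝ, Complex.exp ((c + y * Complex.I) * t) * H (c + y * Complex.I) := by
  set F : ℝ → ℂ := fun t => Complex.exp (-((c : ℂ) * t)) * f t with hF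
  have hFc : Continuous F := by fun_prop
  have hF0 : ∀ t ≤ 0, F t = 0 := fun t ht => by simp [hF, hf0 t ht]
  have hFind : (Set.Ioi (0 : ℝ)).indicator F = F := by
    refine Set.indicator_eq_self.2 fun t ht => ?_
    by_contra h
    exact ht (hF0 t (not_lt.1 h))
  have hFint : Integrable F := by
    rw [← hFind]
    exact (integrable_indicator_iff measurableSet_Ioi).2 hint
  have hpi : (2 * Real.pi) ≠ 0 := by positivity
  have hFT : 𝓕 F = fun v : ℝ => H (c + ((2 * Real.pi * v : ℝ) : ℂ) * Complex.I) := by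
    funext v
    rw [← hL, Real.fourier_real_eq_integral_exp_smul, ← integral_indicator measurableSet_Ioi]
    congr 1
    funext τ
    by_cases hτ : τ ∈ Set.Ioi (0 : ℝ)
    · rw [Set.indicator_of_mem hτ]
      simp only [hF, smul_eq_mul]
      rw [← mul_assoc, ← Complex.exp_add]
      congr 2
      push_cast
      ring
    · rw [Set.indicator_of_notMem hτ, hF0 τ (not_lt.1 hτ), smul_zero]
  have hFTint : Integrable (𝓕 F) := by
    rw [hFT]
    exact hH.comp_mul_left' hpi
  have hinv := congrFun (hFc.fourierInv_fourier_eq hFint hFTint) t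
  rw [hFT, Real.fourierInv_eq'] at hinv
  set g : ℝ → ℂ := fun y => Complex.exp ((c + y * Complex.I) * t) * H (c + y * Complex.I) with hg
  have h1 : ∀ v : ℝ, Complex.exp (((2 * Real.pi * inner ℝ v t : ℝ) : ℂ) * Complex.I) •
      H (c + ((2 * Real.pi * v : ℝ) : ℂ) * Complex.I) =
      Complex.exp (-((c : ℂ) * t)) * g (2 * Real.pi * v) := fun v => by
    simp only [hg, smul_eq_mul]
    rw [← mul_assoc, ← Complex.exp_add]
    congr 2
    rw [show (inner ℝ v t : ℝ) = t * v by simp]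
    push_cast
    ring
  simp_rw [h1] at hinv
  rw [integral_const_mul, Measure.integral_comp_mul_left g] at hinv
  have h2 := mul_left_cancel₀ (Complex.exp_ne_zero _) hinv
  rw [← h2, abs_of_pos (by positivity), Complex.real_smul]
  push_cast
  rfl

/-- Cauchy's theorem on rectangles of growing height; the decay bound kills the horizontal sides. -/
theorem verticalIntegral_eq {F : ℂ → ℂ} {a c : ℝ} (ha : 0 < a) (hac : a ≤ c)
    (hF : DifferentiableOn ℂ F {s | 0 < s.re}) {M r : ℝ} (hr : 1 < r)
    (hb : ∀ x y : ℝ, x ∈ Set.Icc a c → ‖F (x + y * Complex.I)‖ ≤ M * (1 + |y|) ^ (-r)) :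
    ∫ y : ℝ, F (c + y * Complex.I) = ∫ y : ℝ, F (a + y * Complex.I) := by
  have hopen : IsOpen {s : ℂ | 0 < s.re} := isOpen_lt continuous_const Complex.continuous_re
  have hjap : Integrable fun y : ℝ => M * (1 + |y|) ^ (-r) := by
    have := (integrable_one_add_norm (E := ℝ) (μ := volume) (r := r) (by simpa using hr)).const_mul M
    simpa using this
  have hcont : ∀ x ∈ Set.Icc a c, Continuous fun y : ℝ => F (x + y * Complex.I) := fun x hx => by
    refine hF.continuousOn.comp_continuous (by fun_prop) fun y => ?_
    show 0 < (x + y * Complex.I : ℂ).re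
    simpa using ha.trans_le hx.1
  have hint : ∀ x ∈ Set.Icc a c, Integrable fun y : ℝ => F (x + y * Complex.I) := fun x hx =>
    hjap.mono' (hcont x hx).aestronglyMeasurable (ae_of_all _ fun y => hb x y hx)
  have hv : ∀ x ∈ Set.Icc a c, Tendsto (fun T : ℝ => ∫ y in (-T)..T, F (x + y * Complex.I)) atTop
      (𝓝 (∫ y : ℝ, F (x + y * Complex.I))) := fun x hx =>
    intervalIntegral_tendsto_integral (hint x hx) tendsto_neg_atTop_atBot tendsto_id
  have hdecay : Tendsto (fun T : ℝ => M * (1 + |T|) ^ (-r) * |c - a|) atTop (𝓝 0) := by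
    have h1 : Tendsto (fun T : ℝ => (1 + |T|) ^ (-r)) atTop (𝓝 0) :=
      (tendsto_rpow_neg_atTop (by linarith)).comp
        (tendsto_atTop_add_const_left _ _ tendsto_abs_atTop_atTop)
    simpa using (h1.const_mul M).mul_const |c - a|
  have hhor : ∀ σ : ℝ, |σ| = 1 → Tendsto (fun T : ℝ => ∫ x in a..c, F (x + (σ * T : ℝ) * Complex.I))
      atTop (𝓝 0) := fun σ hσ => by
    refine squeeze_zero_norm (fun T => ?_) hdecay
    refine intervalIntegral.norm_integral_le_of_norm_le_const fun x hx => ?_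
    rw [Set.uIoc_of_le hac] at hx
    refine (hb x (σ * T) ⟨hx.1.le, hx.2⟩).trans_eq ?_
    rw [abs_mul, hσ, one_mul]
  have hrect : ∀ T : ℝ, (∫ x in a..c, F (x + ((-1) * T : ℝ) * Complex.I)) -
      (∫ x in a..c, F (x + (1 * T : ℝ) * Complex.I)) +
      Complex.I * (∫ y in (-T)..T, F (c + y * Complex.I)) -
      Complex.I * (∫ y in (-T)..T, F (a + y * Complex.I)) = 0 := fun T => by
    have := Complex.integral_boundary_rect_eq_zero_of_differentiableOn F
      (a + ((-T : ℝ) : ℂ) * Complex.I) (c + (T : ℂ) * Complex.I) (hF.mono ?_)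
    · simpa using this
    · intro s hs
      rw [Complex.mem_reProdIm] at hs
      have := hs.1
      simp only [Complex.add_re, Complex.ofReal_re, Complex.mul_re, Complex.I_re, mul_zero,
        Complex.ofReal_im, Complex.I_im, zero_mul, sub_zero, add_zero, Set.uIcc_of_le hac] at this
      exact ha.trans_le this.1
  have hlim := (((hhor (-1) (by simp)).sub (hhor 1 (by simp))).add
    ((hv c ⟨hac, le_rfl⟩).const_mul Complex.I)).sub ((hv a ⟨le_rfl, hac⟩).const_mul Complex.I)
  simp_rw [hrect] at hlim
  have h0 := tendsto_nhds_unique hlim tendsto_const_nhds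
  rw [sub_zero, zero_add, ← mul_sub] at h0
  exact sub_eq_zero.1 ((mul_eq_zero.1 h0).resolve_left Complex.I_ne_zero)

/-! ### The double pole of the symbol and the resulting asymptotics. -/

/-- For α ≤ 1 the imaginary part of α log z stays in (-π, π), where exp is injective. Consequently
s₀ is the only zero of s^α - ω in the right half-plane. -/
theorem cpow_injOn_rightHalfPlane {α : ℝ} (hα : 0 < α) (hα1 : α ≤ 1) {s w : ℂ}
    (hs : 0 < s.re) (hw : 0 < w.re) (h : s ^ (α : ℂ) = w ^ (α : ℂ)) : s = w := by
  have hs0 : s ≠ 0 := fun h => by simp [h] at hs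
  have hw0 : w ≠ 0 := fun h => by simp [h] at hw
  have him : ∀ z : ℂ, 0 < z.re → -Real.pi < (Complex.log z * α).im ∧
      (Complex.log z * α).im ≤ Real.pi := fun z hz => by
    have h1 := abs_lt.1 (Complex.abs_arg_lt_pi_div_two_iff.2 (Or.inl hz))
    have h2 : (Complex.log z * α).im = α * z.arg := by
      simp [Complex.mul_im, Complex.log_im, mul_comm]
    rw [h2]
    constructor <;> nlinarith [Real.pi_pos]
  rw [Complex.cpow_def_of_ne_zero hs0, Complex.cpow_def_of_ne_zero hw0] at h
  have h1 := Complex.exp_inj_of_neg_pi_lt_of_le_pi (him s hs).1 (him s hs).2 (him w hw).1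
    (him w hw).2 h
  have h2 := mul_right_cancel₀ (by exact_mod_cast hα.ne') h1
  rw [← Complex.exp_log hs0, h2, Complex.exp_log hw0]

/-- The Laplace transform of `mittagLefflerRay`. -/
noncomputable def raySymbol (α : ℝ) (ω s : ℂ) : ℂ :=
  α * ω * s ^ ((α : ℂ) - 1) / (s ^ (α : ℂ) - ω) ^ 2

/-- The divided difference q of s^α at s₀ is holomorphic and has no zeros, so (s - s₀)² times the
symbol extends to a holomorphic function f with f(s₀) = s₀/α. Its second divided difference is the
symbol without its principal part. The extra 1/(s + 1) turns the simple pole term into one of order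
|s|⁻² at infinity. -/
theorem exists_raySymbol_pole_decomposition {α : ℝ} (hα : 0 < α) (hα1 : α ≤ 1) {s₀ : ℂ}
    (hs₀ : 0 < s₀.re) : ∃ (H : ℂ → ℂ) (B : ℂ), DifferentiableOn ℂ H {s | 0 < s.re} ∧
    ∀ s : ℂ, 0 < s.re → s ≠ s₀ → H s = raySymbol α (s₀ ^ (α : ℂ)) s -
      s₀ / α * (1 / (s - s₀) ^ 2) - B * (1 / (s - s₀) - 1 / (s + 1)) := by
  have hopen : IsOpen {s : ℂ | 0 < s.re} := isOpen_lt continuous_const Complex.continuous_re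
  have hmem : {s : ℂ | 0 < s.re} ∈ 𝓝 s₀ := hopen.mem_nhds hs₀
  have hα' : (α : ℂ) ≠ 0 := by exact_mod_cast hα.ne'
  have hne : ∀ s : ℂ, 0 < s.re → s ≠ 0 := fun s hs h => by simp [h] at hs
  set q : ℂ → ℂ := dslope (fun s => s ^ (α : ℂ)) s₀ with hq
  have hpow : ∀ a : ℂ, DifferentiableOn ℂ (fun s : ℂ => s ^ a) {s | 0 < s.re} := fun a s hs =>
    (differentiableAt_id.cpow_const (Or.inl hs)).differentiableWithinAt
  have hqd : DifferentiableOn ℂ q {s | 0 < s.re} :=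
    (Complex.differentiableOn_dslope hmem).2 (hpow α)
  have hq0 : q s₀ = α * s₀ ^ ((α : ℂ) - 1) := by
    rw [hq, dslope_same]
    have h := (hasDerivAt_id s₀).cpow_const (c := (α : ℂ)) (Or.inl hs₀)
    simpa using h.deriv
  have hqs : ∀ s, s ≠ s₀ → q s = (s ^ (α : ℂ) - s₀ ^ (α : ℂ)) / (s - s₀) := fun s hs => by
    rw [hq, dslope_of_ne _ hs, slope_def_field]
  have hqne : ∀ s : ℂ, 0 < s.re → q s ≠ 0 := fun s hs => by
    by_cases h : s = s₀
    · rw [h, hq0]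
      exact mul_ne_zero hα' (by simp [Complex.cpow_eq_zero_iff, hne s₀ hs₀])
    · rw [hqs s h]
      exact div_ne_zero (sub_ne_zero.2 fun h' => h (cpow_injOn_rightHalfPlane hα hα1 hs hs₀ h'))
        (sub_ne_zero.2 h)
  set f : ℂ → ℂ := fun s => α * s₀ ^ (α : ℂ) * s ^ ((α : ℂ) - 1) / q s ^ 2 with hf
  have hfd : DifferentiableOn ℂ f {s | 0 < s.re} :=
    ((hpow _).const_mul _).div (hqd.pow 2) fun s hs => pow_ne_zero 2 (hqne s hs)
  have hf0 : f s₀ = s₀ / α := by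
    have h1 : s₀ ^ ((α : ℂ) - 1) ≠ 0 := by simp [Complex.cpow_eq_zero_iff, hne s₀ hs₀]
    have h2 : s₀ ^ (α : ℂ) = s₀ ^ ((α : ℂ) - 1) * s₀ := by
      rw [Complex.cpow_sub _ _ (hne s₀ hs₀), Complex.cpow_one, div_mul_cancel₀ _ (hne s₀ hs₀)]
    simp only [hf]
    rw [hq0, h2]
    field_simp
  -- This is f'(s₀), the residue of the symbol at s₀.
  set B : ℂ := dslope f s₀ s₀ with hB
  refine ⟨fun s => dslope (dslope f s₀) s₀ s + B / (s + 1), B, ?_, ?_⟩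
  · refine DifferentiableOn.add ?_ ?_
    · exact (Complex.differentiableOn_dslope hmem).2 ((Complex.differentiableOn_dslope hmem).2 hfd)
    · refine DifferentiableOn.div (by fun_prop) (by fun_prop) fun s hs h => ?_
      have hs : 0 < s.re := hs
      have := congrArg Complex.re h
      simp at this
      linarith
  · intro s hs hss
    have h1 : s - s₀ ≠ 0 := sub_ne_zero.2 hss
    have h2 : s ^ (α : ℂ) - s₀ ^ (α : ℂ) ≠ 0 :=
      sub_ne_zero.2 fun h' => hss (cpow_injOn_rightHalfPlane hα hα1 hs hs₀ h')
    have h3 : raySymbol α (s₀ ^ (α : ℂ)) s = f s / (s - s₀) ^ 2 := by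
      simp only [hf, raySymbol]
      rw [hqs s hss]
      field_simp
    have h4 : s + 1 ≠ 0 := fun h => by
      have := congrArg Complex.re h
      simp at this
      linarith
    beta_reduce
    rw [dslope_of_ne _ hss, slope_def_field, ← hB, dslope_of_ne _ hss, slope_def_field, hf0, h3]
    field_simp
    ring

theorem norm_raySymbol_le {α : ℝ} (hα : 0 < α) {ω s : ℂ} (hω : ‖ω‖ = 1) (hs : 2 ≤ ‖s‖) :
    ‖raySymbol α ω s‖ ≤ α / (1 - 2 ^ (-α)) ^ 2 * ‖s‖ ^ (-(1 + α)) := by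
  have hspos : 0 < ‖s‖ := by linarith
  have hδ : (2 : ℝ) ^ (-α) < 1 := Real.rpow_lt_one_of_one_lt_of_neg one_lt_two (by linarith)
  have hsα : 0 < ‖s‖ ^ α := Real.rpow_pos_of_pos hspos _
  have hlow : (1 - 2 ^ (-α)) * ‖s‖ ^ α ≤ ‖s ^ (α : ℂ) - ω‖ := by
    have h1 := norm_sub_norm_le (s ^ (α : ℂ)) ω
    rw [Complex.norm_cpow_real, hω] at h1
    have h2 : 1 ≤ (2 : ℝ) ^ (-α) * ‖s‖ ^ α := by
      rw [Real.rpow_neg zero_le_two, inv_mul_eq_div, one_le_div (by positivity)]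
      exact Real.rpow_le_rpow zero_le_two hs hα.le
    linarith
  have hpos : 0 < (1 - 2 ^ (-α)) * ‖s‖ ^ α := mul_pos (by linarith) hsα
  have hexp : ‖s ^ ((α : ℂ) - 1)‖ = ‖s‖ ^ (α - 1) := by
    rw [← Complex.norm_cpow_real]
    push_cast
    rfl
  rw [raySymbol, norm_div, norm_mul, norm_mul, norm_pow, hω, mul_one, hexp, Complex.norm_real,
    Real.norm_of_nonneg hα.le]
  calc α * ‖s‖ ^ (α - 1) / ‖s ^ (α : ℂ) - ω‖ ^ 2
      ≤ α * ‖s‖ ^ (α - 1) / ((1 - 2 ^ (-α)) * ‖s‖ ^ α) ^ 2 := by gcongr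
    _ = _ := by
      rw [mul_pow, ← Real.rpow_natCast (‖s‖ ^ α), ← Real.rpow_mul hspos.le,
        show -(1 + α) = (α - 1) - α * (2 : ℕ) by push_cast; ring, Real.rpow_sub hspos (α - 1)]
      have : 1 - (2 : ℝ) ^ (-α) ≠ 0 := by linarith
      field_simp

/-- For |s| ≥ 2 each term of the decomposition is O(|s|^(-1-α)), because α ≤ 1. The remaining |y| ≤
2 is a compact rectangle on which H is continuous, even across s₀. -/
theorem exists_norm_le_of_pole_decomposition {α : ℝ} (hα : 0 < α) (hα1 : α ≤ 1) {s₀ : ℂ}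
    (hs₁ : ‖s₀‖ = 1) {H : ℂ → ℂ} {B : ℂ}
    (hH : DifferentiableOn ℂ H {s | 0 < s.re})
    (hHs : ∀ s : ℂ, 0 < s.re → s ≠ s₀ → H s = raySymbol α (s₀ ^ (α : ℂ)) s -
      s₀ / α * (1 / (s - s₀) ^ 2) - B * (1 / (s - s₀) - 1 / (s + 1)))
    {a : ℝ} (ha : 0 < a) (c : ℝ) :
    ∃ M : ℝ, ∀ x y : ℝ, x ∈ Set.Icc a c →
      ‖H (x + y * Complex.I)‖ ≤ M * (1 + |y|) ^ (-(1 + α)) := by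
  have hω : ‖s₀ ^ (α : ℂ)‖ = 1 := by rw [Complex.norm_cpow_real, hs₁, Real.one_rpow]
  have hlarge : ∀ s : ℂ, 0 < s.re → 2 ≤ ‖s‖ →
      ‖H s‖ ≤ (α / (1 - 2 ^ (-α)) ^ 2 + α⁻¹ * 4 + ‖B‖ * 8) * ‖s‖ ^ (-(1 + α)) := by
    intro s hs hs2
    have hspos : 0 < ‖s‖ := by linarith
    have hss : s ≠ s₀ := fun h => by rw [h, hs₁] at hs2; linarith
    have hd1 : ‖s‖ / 2 ≤ ‖s - s₀‖ := by
      have := norm_sub_norm_le s s₀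
      rw [hs₁] at this
      linarith
    have hd2 : ‖s‖ / 2 ≤ ‖s + 1‖ := by
      have := norm_sub_norm_le s (-1)
      rw [sub_neg_eq_add, norm_neg, norm_one] at this
      linarith
    have hs1 : s - s₀ ≠ 0 := sub_ne_zero.2 hss
    have hs2' : s + 1 ≠ 0 := norm_pos_iff.1 (by linarith)
    have hsq : (‖s‖ ^ 2)⁻¹ ≤ ‖s‖ ^ (-(1 + α)) := by
      rw [← Real.rpow_natCast, ← Real.rpow_neg hspos.le]
      exact Real.rpow_le_rpow_of_exponent_le (by linarith) (by push_cast; linarith)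
    have e1 : ‖1 / (s - s₀) ^ 2‖ ≤ 4 * (‖s‖ ^ 2)⁻¹ := by
      rw [norm_div, norm_one, norm_pow]
      calc 1 / ‖s - s₀‖ ^ 2 ≤ 1 / (‖s‖ / 2) ^ 2 := by gcongr
        _ = _ := by field_simp; norm_num
    have e2 : ‖1 / (s - s₀) - 1 / (s + 1)‖ ≤ 8 * (‖s‖ ^ 2)⁻¹ := by
      have : 1 / (s - s₀) - 1 / (s + 1) = (1 + s₀) / ((s - s₀) * (s + 1)) := by
        field_simp
        ring
      rw [this, norm_div, norm_mul]
      have h1 : ‖1 + s₀‖ ≤ 2 := by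
        refine (norm_add_le _ _).trans ?_
        rw [norm_one, hs₁]
        norm_num
      calc ‖1 + s₀‖ / (‖s - s₀‖ * ‖s + 1‖) ≤ 2 / (‖s‖ / 2 * (‖s‖ / 2)) := by gcongr
        _ = _ := by field_simp; norm_num
    rw [hHs s hs hss]
    have e3 : ‖s₀ / α * (1 / (s - s₀) ^ 2)‖ ≤ α⁻¹ * 4 * ‖s‖ ^ (-(1 + α)) := by
      rw [norm_mul, norm_div, hs₁, Complex.norm_real, Real.norm_of_nonneg hα.le, one_div, mul_assoc]
      gcongr
      exact e1.trans (by gcongr)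
    have e4 : ‖B * (1 / (s - s₀) - 1 / (s + 1))‖ ≤ ‖B‖ * 8 * ‖s‖ ^ (-(1 + α)) := by
      rw [norm_mul, mul_assoc]
      gcongr
      exact e2.trans (by gcongr)
    calc _ ≤ ‖raySymbol α (s₀ ^ (α : ℂ)) s‖ + ‖s₀ / α * (1 / (s - s₀) ^ 2)‖ +
          ‖B * (1 / (s - s₀) - 1 / (s + 1))‖ := norm_sub_le_of_le (norm_sub_le _ _) le_rfl
      _ ≤ _ := by
        have := norm_raySymbol_le hα hω hs2
        linarith
  set K₁ : ℝ := α / (1 - 2 ^ (-α)) ^ 2 + α⁻¹ * 4 + ‖B‖ * 8 with hK₁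
  have hK₁nonneg : 0 ≤ K₁ := by positivity
  have hcont : ContinuousOn (fun p : ℝ × ℝ => H (p.1 + p.2 * Complex.I))
      (Set.Icc a c ×ˢ Set.Icc (-2) 2) := by
    refine hH.continuousOn.comp (by fun_prop) fun p hp => ?_
    show 0 < (p.1 + p.2 * Complex.I : ℂ).re
    simpa using ha.trans_le hp.1.1
  obtain ⟨K₂, hK₂⟩ := (isCompact_Icc.prod isCompact_Icc).exists_bound_of_continuousOn hcont
  refine ⟨|K₂| * 3 ^ (1 + α) + K₁ * 2 ^ (1 + α), fun x y hx => ?_⟩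
  have hr : 0 < 1 + α := by linarith
  have hy0 : 0 < 1 + |y| := by positivity
  have hyr : 0 ≤ (1 + |y|) ^ (-(1 + α)) := by positivity
  rw [add_mul]
  by_cases hy : |y| ≤ 2
  · have h1 : ‖H (x + y * Complex.I)‖ ≤ K₂ := hK₂ (x, y) ⟨hx, abs_le.1 hy⟩
    have h2 : 1 ≤ (3 : ℝ) ^ (1 + α) * (1 + |y|) ^ (-(1 + α)) := by
      rw [Real.rpow_neg hy0.le, ← div_eq_mul_inv, one_le_div (by positivity)]
      exact Real.rpow_le_rpow hy0.le (by linarith) hr.le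
    have h3 : |K₂| ≤ |K₂| * 3 ^ (1 + α) * (1 + |y|) ^ (-(1 + α)) := by
      rw [mul_assoc]
      exact le_mul_of_one_le_right (abs_nonneg _) h2
    have h4 : 0 ≤ K₁ * 2 ^ (1 + α) * (1 + |y|) ^ (-(1 + α)) := by positivity
    linarith [le_abs_self K₂]
  · rw [not_le] at hy
    have hns : |y| ≤ ‖(x + y * Complex.I : ℂ)‖ := by
      have := Complex.abs_im_le_norm (x + y * Complex.I)
      simpa using this
    have hre : 0 < (x + y * Complex.I : ℂ).re := by simpa using ha.trans_le hx.1
    have h1 := hlarge (x + y * Complex.I) hre (hy.le.trans hns)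
    have h2 : ‖(x + y * Complex.I : ℂ)‖ ^ (-(1 + α)) ≤ 2 ^ (1 + α) * (1 + |y|) ^ (-(1 + α)) := by
      have h3 : (1 + |y|) / 2 ≤ ‖(x + y * Complex.I : ℂ)‖ := by linarith
      calc ‖(x + y * Complex.I : ℂ)‖ ^ (-(1 + α)) ≤ ((1 + |y|) / 2) ^ (-(1 + α)) :=
            Real.rpow_le_rpow_of_nonpos (by positivity) h3 (by linarith)
        _ = _ := by
            rw [Real.div_rpow hy0.le zero_le_two, Real.rpow_neg zero_le_two]
            field_simp
    have h5 : 0 ≤ |K₂| * 3 ^ (1 + α) * (1 + |y|) ^ (-(1 + α)) := by positivity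
    have h6 := mul_le_mul_of_nonneg_left h2 hK₁nonneg
    rw [← mul_assoc] at h6
    linarith

/-- After subtraction of the pole terms, Laplace inversion on Re s = 2 and a shift to Re s = κ/2
leave a remainder O(e^{κt/2}). The simple pole contributes O(e^{κt}). -/
theorem exists_mittagLefflerRay_asymptotics {α : ℝ} (hα : 0 < α) (hα1 : α ≤ 1) {s₀ : ℂ}
    (hs₀ : 0 < s₀.re) (hs₁ : ‖s₀‖ = 1) : ∃ C : ℝ, ∀ t : ℝ, 0 ≤ t →
    ‖mittagLefflerRay α (s₀ ^ (α : ℂ)) t - s₀ / α * (t * Complex.exp (s₀ * t))‖ ≤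
      C * Real.exp (s₀.re * t) := by
  have hω : ‖s₀ ^ (α : ℂ)‖ = 1 := by rw [Complex.norm_cpow_real, hs₁, Real.one_rpow]
  obtain ⟨H, B, hH, hHs⟩ := exists_raySymbol_pole_decomposition hα hα1 hs₀
  set ω := s₀ ^ (α : ℂ) with hωdef
  have hκ1 : s₀.re ≤ 1 := hs₁ ▸ Complex.re_le_norm s₀
  set a : ℝ := s₀.re / 2 with ha
  have hapos : 0 < a := by positivity
  obtain ⟨M, hM⟩ := exists_norm_le_of_pole_decomposition hα hα1 hs₁ hH hHs hapos 2
  set G : ℝ → ℂ := fun t => mittagLefflerRay α ω t - s₀ / α * (t * Complex.exp (s₀ * t)) -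
    B * (Complex.exp (s₀ * t) - Complex.exp (-t)) with hG
  -- The extension by zero to negative times is continuous, since subtracting e^{-t} in the simple
  -- pole term makes G(0) = 0.
  set f : ℝ → ℂ := fun t => G (max t 0) with hf
  have hrayc : Continuous fun t : ℝ => mittagLefflerRay α ω (max t 0) := by
    unfold mittagLefflerRay
    refine continuous_const.mul ((continuous_mittagLefflerDeriv hα).comp
      (continuous_const.mul (Complex.continuous_ofReal.comp ?_)))
    exact (continuous_id.max continuous_const).rpow_const fun t => Or.inr hα.le
  have hfc : Continuous f := by
    simp only [hf, hG]
    have : Continuous fun t : ℝ => ((max t 0 : ℝ) : ℂ) := by fun_prop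
    fun_prop
  have hG0 : G 0 = 0 := by
    have : mittagLefflerDeriv α 0 = 0 := by rw [← mul_deriv_mittagLeffler hα, zero_mul]
    simp [hG, mittagLefflerRay, Real.zero_rpow hα.ne', this]
  have hf0 : ∀ t ≤ 0, f t = 0 := fun t ht => by simp only [hf, max_eq_right ht, hG0]
  have hfpos : ∀ t ∈ Set.Ioi (0 : ℝ), f t = G t := fun t ht => by
    simp only [hf, max_eq_left (le_of_lt (Set.mem_Ioi.1 ht))]
  have hlap : ∀ s : ℂ, s.re = 2 →
      IntegrableOn (fun t : ℝ => Complex.exp (-(s * t)) * f t) (Set.Ioi 0) ∧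
      ∫ t in Set.Ioi (0 : ℝ), Complex.exp (-(s * t)) * f t = H s := by
    intro s hs
    have hss : s ≠ s₀ := fun h => by rw [h] at hs; linarith
    have hsub : 0 < (s - s₀).re := by rw [Complex.sub_re, hs]; linarith
    have hadd : 0 < (s + 1).re := by rw [Complex.add_re, hs]; norm_num
    obtain ⟨i0, v0⟩ := mittagLefflerRay_laplace hα hω (s := s) (by rw [hs]; norm_num)
    have i1 := integrableOn_rpow_mul_cexp (b := 1) zero_le_one hsub
    have v1 := integral_rpow_mul_cexp (b := 1) zero_le_one hsub
    have i2 := integrableOn_rpow_mul_cexp (b := 0) le_rfl hsub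
    have v2 := integral_rpow_mul_cexp (b := 0) le_rfl hsub
    have i3 := integrableOn_rpow_mul_cexp (b := 0) le_rfl hadd
    have v3 := integral_rpow_mul_cexp (b := 0) le_rfl hadd
    have hcongr : Set.EqOn (fun t : ℝ => Complex.exp (-(s * t)) * f t) (fun t : ℝ =>
        Complex.exp (-(s * t)) * mittagLefflerRay α ω t -
        s₀ / α * (((t ^ (1 : ℝ) : ℝ) : ℂ) * Complex.exp (-((s - s₀) * t))) -
        B * (((t ^ (0 : ℝ) : ℝ) : ℂ) * Complex.exp (-((s - s₀) * t)) -
          ((t ^ (0 : ℝ) : ℝ) : ℂ) * Complex.exp (-((s + 1) * t)))) (Set.Ioi 0) := fun t ht => by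
      have h1 : Complex.exp (-((s - s₀) * t)) = Complex.exp (-(s * t)) * Complex.exp (s₀ * t) := by
        rw [← Complex.exp_add]; congr 1; ring
      have h2 : Complex.exp (-((s + 1) * t)) = Complex.exp (-(s * t)) * Complex.exp (-t) := by
        rw [← Complex.exp_add]; congr 1; ring
      simp only [hfpos t ht, hG, h1, h2, Real.rpow_one, Real.rpow_zero, Complex.ofReal_one]
      ring
    have hI1 : IntegrableOn (fun t : ℝ => Complex.exp (-(s * t)) * mittagLefflerRay α ω t -
        s₀ / α * (((t ^ (1 : ℝ) : ℝ) : ℂ) * Complex.exp (-((s - s₀) * t)))) (Set.Ioi 0) :=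
      i0.sub (i1.const_mul (s₀ / α))
    have hI2 : IntegrableOn (fun t : ℝ => B * (((t ^ (0 : ℝ) : ℝ) : ℂ) *
        Complex.exp (-((s - s₀) * t)) -
          ((t ^ (0 : ℝ) : ℝ) : ℂ) * Complex.exp (-((s + 1) * t)))) (Set.Ioi 0) :=
      (i2.sub i3).const_mul B
    constructor
    · exact (hI1.sub hI2).congr_fun hcongr.symm measurableSet_Ioi
    · rw [setIntegral_congr_fun measurableSet_Ioi hcongr, integral_sub hI1 hI2,
        integral_sub i0 (i1.const_mul _), integral_const_mul, integral_const_mul,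
        integral_sub i2 i3, v0, v1, v2, v3, hHs s (by rw [hs]; norm_num) hss]
      have e1 : Real.Gamma (1 + 1) = 1 := by
        rw [one_add_one_eq_two, Real.Gamma_two]
      have e2 : (s - s₀) ^ (-(((1 : ℝ) : ℂ) + 1)) = 1 / (s - s₀) ^ 2 := by
        rw [Complex.cpow_neg, Complex.ofReal_one, one_add_one_eq_two, Complex.cpow_ofNat, one_div]
      have e3 : ∀ w : ℂ, w ^ (-(((0 : ℝ) : ℂ) + 1)) = 1 / w := fun w => by
        rw [Complex.ofReal_zero, zero_add, Complex.cpow_neg_one, one_div]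
      rw [e1, e2, e3, e3, zero_add, Real.Gamma_one, raySymbol]
      simp
  have hjap : Integrable fun y : ℝ => M * (1 + |y|) ^ (-(1 + α)) := by
    have := (integrable_one_add_norm (E := ℝ) (μ := volume) (r := 1 + α)
      (by simpa using hα)).const_mul M
    simpa using this
  have hHint : Integrable fun y : ℝ => H ((2 : ℝ) + y * Complex.I) := by
    refine hjap.mono' (Continuous.aestronglyMeasurable ?_) (ae_of_all _ fun y =>
      hM 2 y ⟨by linarith, le_rfl⟩)
    refine hH.continuousOn.comp_continuous (by fun_prop) fun y => ?_
    show 0 < ((2 : ℝ) + y * Complex.I : ℂ).re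
    simp
  have hinv := laplace_inversion (c := 2) (H := H) hfc hf0
    (hlap ((2 : ℝ) : ℂ) (by simp)).1 (fun y => (hlap _ (by simp)).2) hHint
  have hGbound : ∀ t : ℝ, 0 ≤ t → ‖f t‖ ≤
      (2 * Real.pi)⁻¹ * ((∫ y : ℝ, M * (1 + |y|) ^ (-(1 + α))) * Real.exp (a * t)) := by
    intro t ht
    have hexp : ∀ x y : ℝ, ‖Complex.exp ((x + y * Complex.I) * t)‖ = Real.exp (x * t) :=
      fun x y => by rw [Complex.norm_exp]; simp
    have hshift := verticalIntegral_eq (F := fun s => Complex.exp (s * t) * H s) (a := a) (c := 2)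
      (M := Real.exp (2 * t) * M) (r := 1 + α) hapos (by linarith)
      (DifferentiableOn.mul (by fun_prop) hH) (by linarith) (fun x y hx => by
        rw [norm_mul, hexp, mul_assoc]
        exact mul_le_mul (Real.exp_le_exp.2 (mul_le_mul_of_nonneg_right hx.2 ht)) (hM x y hx)
          (norm_nonneg _) (Real.exp_pos _).le)
    rw [hinv t, hshift, norm_mul]
    have : ‖(2 * Real.pi : ℂ)⁻¹‖ = (2 * Real.pi)⁻¹ := by
      rw [norm_inv, norm_mul, Complex.norm_real, Real.norm_of_nonneg Real.pi_pos.le]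
      simp
    rw [this, ← integral_mul_const]
    refine mul_le_mul_of_nonneg_left ?_ (by positivity)
    refine norm_integral_le_of_norm_le (hjap.mul_const _) (ae_of_all _ fun y => ?_)
    rw [norm_mul, hexp, mul_comm]
    exact mul_le_mul_of_nonneg_right (hM a y ⟨le_rfl, by linarith⟩) (Real.exp_pos _).le
  set K := (2 * Real.pi)⁻¹ * (∫ y : ℝ, M * (1 + |y|) ^ (-(1 + α))) with hK
  refine ⟨|K| + ‖B‖ * 2, fun t ht => ?_⟩
  have hft : f t = G t := by simp only [hf, max_eq_left ht]
  have h1 : mittagLefflerRay α ω t - s₀ / α * (t * Complex.exp (s₀ * t)) =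
      f t + B * (Complex.exp (s₀ * t) - Complex.exp (-t)) := by
    rw [hft]
    simp only [hG]
    ring
  have h2 : ‖f t‖ ≤ |K| * Real.exp (s₀.re * t) := by
    refine (hGbound t ht).trans ?_
    rw [← mul_assoc]
    exact mul_le_mul (le_abs_self K) (Real.exp_le_exp.2 (by rw [ha]; nlinarith))
      (Real.exp_pos _).le (abs_nonneg _)
  have h3 : ‖Complex.exp (s₀ * t) - Complex.exp (-t)‖ ≤ 2 * Real.exp (s₀.re * t) := by
    refine (norm_sub_le _ _).trans ?_
    rw [Complex.norm_exp, Complex.norm_exp]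
    have e1 : (s₀ * (t : ℂ)).re = s₀.re * t := by simp
    have e2 : Real.exp ((-(t : ℂ)).re) ≤ Real.exp (s₀.re * t) := by
      refine Real.exp_le_exp.2 ?_
      simp only [Complex.neg_re, Complex.ofReal_re]
      nlinarith
    rw [e1]
    linarith
  rw [h1]
  refine (norm_add_le _ _).trans ?_
  rw [norm_mul]
  have := mul_le_mul_of_nonneg_left h3 (norm_nonneg B)
  linarith

/-- The bound on E_α comes from integrating its derivative W/t = O(e^{κt}) from t = 1. The summand
t^α in the bound on W is its order at t = 0, needed for frequencies near the origin. -/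
theorem exists_mittagLeffler_ray_bounds {α : ℝ} (hα : 0 < α) (hα1 : α ≤ 1) {s₀ : ℂ}
    (hs₀ : 0 < s₀.re) (hs₁ : ‖s₀‖ = 1) : ∃ C c T : ℝ, 0 < C ∧ 0 < c ∧
    (∀ t : ℝ, 0 ≤ t → ‖mittagLeffler α (s₀ ^ (α : ℂ) * (t ^ α : ℝ))‖ ≤ C * Real.exp (s₀.re * t)) ∧
    (∀ t : ℝ, 0 ≤ t → ‖mittagLefflerRay α (s₀ ^ (α : ℂ)) t‖ ≤
      C * (t ^ α + t) * Real.exp (s₀.re * t)) ∧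
    ∀ t : ℝ, T ≤ t → c * t * Real.exp (s₀.re * t) ≤ ‖mittagLefflerRay α (s₀ ^ (α : ℂ)) t‖ := by
  obtain ⟨C₀, hC₀⟩ := exists_mittagLefflerRay_asymptotics hα hα1 hs₀ hs₁
  have hω : ‖s₀ ^ (α : ℂ)‖ = 1 := by rw [Complex.norm_cpow_real, hs₁, Real.one_rpow]
  set ω := s₀ ^ (α : ℂ) with hωdef
  set κ := s₀.re with hκ
  have hA : ∀ t : ℝ, 0 ≤ t → ‖s₀ / α * (t * Complex.exp (s₀ * t))‖ =
      α⁻¹ * (t * Real.exp (κ * t)) := fun t ht => by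
    rw [norm_mul, norm_mul, norm_div, hs₁, Complex.norm_real, Complex.norm_real,
      Real.norm_of_nonneg hα.le, Real.norm_of_nonneg ht, Complex.norm_exp, one_div]
    simp [hκ]
  have hC₀nonneg : 0 ≤ C₀ := by
    have := (norm_nonneg _).trans (hC₀ 0 le_rfl)
    simpa using this
  have hα' : 0 < α⁻¹ := inv_pos.2 hα
  have hup1 : ∀ t : ℝ, 1 ≤ t → ‖mittagLefflerRay α ω t‖ ≤ (α⁻¹ + C₀) * t * Real.exp (κ * t) := by
    intro t ht
    have ht0 : 0 ≤ t := by linarith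
    have h1 := norm_le_norm_add_norm_sub' (mittagLefflerRay α ω t)
      (s₀ / α * (t * Complex.exp (s₀ * t)))
    rw [hA t ht0] at h1
    have h2 := hC₀ t ht0
    have h3 : C₀ * Real.exp (κ * t) ≤ C₀ * t * Real.exp (κ * t) := by
      gcongr
      exact le_mul_of_one_le_right hC₀nonneg ht
    linarith
  obtain ⟨C₁, hC₁⟩ := (isCompact_closedBall (0 : ℂ) 1).exists_bound_of_continuousOn
    (differentiable_mittagLeffler hα).deriv.continuous.continuousOn
  have hup2 : ∀ t : ℝ, 0 ≤ t → t ≤ 1 → ‖mittagLefflerRay α ω t‖ ≤ α * |C₁| * t ^ α := by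
    intro t ht ht1
    have hz : ‖ω * ((t ^ α : ℝ) : ℂ)‖ = t ^ α := by
      rw [norm_mul, hω, one_mul, Complex.norm_real, Real.norm_of_nonneg (Real.rpow_nonneg ht _)]
    have hd := hC₁ (ω * ((t ^ α : ℝ) : ℂ)) (by
      rw [mem_closedBall_zero_iff, hz]
      exact Real.rpow_le_one ht ht1 hα.le)
    rw [mittagLefflerRay, ← mul_deriv_mittagLeffler hα, norm_mul, norm_mul, hz, Complex.norm_real,
      Real.norm_of_nonneg hα.le, mul_assoc, mul_comm |C₁|]
    gcongr
    exact hd.trans (le_abs_self _)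
  set y : ℝ → ℂ := fun t => mittagLeffler α (ω * (t ^ α : ℝ)) with hy
  have hyc : Continuous y := by
    refine (differentiable_mittagLeffler hα).continuous.comp
      (continuous_const.mul (Complex.continuous_ofReal.comp ?_))
    exact continuous_id.rpow_const fun t => Or.inr hα.le
  obtain ⟨C₂, hC₂⟩ := (isCompact_Icc (a := (0 : ℝ)) (b := 1)).exists_bound_of_continuousOn
    hyc.continuousOn
  -- The first summand controls [0,1]; the second gives Kκ ≥ α⁻¹ + C₀, so that K e^{κt} grows at
  -- least as fast as the bound on |y| requires.
  set K : ℝ := |C₂| + (α⁻¹ + C₀) / κ with hK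
  have hexp1 : ∀ t : ℝ, 0 ≤ t → 1 ≤ Real.exp (κ * t) := fun t ht =>
    Real.one_le_exp (mul_nonneg hs₀.le ht)
  have hfrac : 0 < (α⁻¹ + C₀) / κ := by positivity
  have hyup : ∀ t : ℝ, 0 ≤ t → ‖y t‖ ≤ K * Real.exp (κ * t) := by
    intro t ht
    rcases le_total t 1 with h1 | h1
    · have h2 := hC₂ t ⟨ht, h1⟩
      have h3 : |C₂| ≤ K := by linarith
      calc ‖y t‖ ≤ K := h2.trans ((le_abs_self _).trans h3)
        _ ≤ K * Real.exp (κ * t) := le_mul_of_one_le_right (by positivity) (hexp1 t ht)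
    · refine image_norm_le_of_norm_deriv_right_le_deriv_boundary (f := y) (a := 1) (b := t)
        (f' := fun x => mittagLefflerRay α ω x / x) hyc.continuousOn
        (fun x hx => (hasDerivAt_mittagLeffler_ray hα ω (by linarith [hx.1])).hasDerivWithinAt)
        (B := fun x => K * Real.exp (κ * x)) (B' := fun x => K * (Real.exp (κ * x) * κ)) ?_ ?_ ?_
        ⟨h1, le_rfl⟩
      · have h2 := hC₂ 1 ⟨zero_le_one, le_rfl⟩
        have h3 : |C₂| ≤ K := by linarith
        calc ‖y 1‖ ≤ K := h2.trans ((le_abs_self _).trans h3)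
          _ ≤ K * Real.exp (κ * 1) :=
            le_mul_of_one_le_right (by positivity) (hexp1 1 zero_le_one)
      · intro x
        have h2 : HasDerivAt (fun x => κ * x) κ x := by
          simpa using (hasDerivAt_id x).const_mul κ
        exact h2.exp.const_mul K
      · intro x hx
        have hx0 : 0 < x := by linarith [hx.1]
        have h2 := hup1 x hx.1
        rw [norm_div, Complex.norm_real, Real.norm_of_nonneg hx0.le, div_le_iff₀ hx0]
        refine h2.trans ?_
        have h3 : α⁻¹ + C₀ ≤ K * κ := by
          rw [hK, add_mul, div_mul_cancel₀ _ hs₀.ne']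
          have : 0 ≤ |C₂| * κ := by positivity
          linarith
        have h4 : 0 ≤ x * Real.exp (κ * x) := by positivity
        nlinarith
  -- From t = 2αC₀ on, the error is at most half of the main term.
  refine ⟨K + (α⁻¹ + C₀) + α * |C₁|, α⁻¹ / 2, max 0 (2 * α * C₀), by positivity, by positivity,
    ?_, ?_, ?_⟩
  · intro t ht
    refine (hyup t ht).trans ?_
    gcongr
    have : 0 ≤ α * |C₁| := by positivity
    linarith
  · intro t ht
    have hta : 0 ≤ t ^ α := Real.rpow_nonneg ht _
    have hKpos : 0 ≤ K := by positivity
    have hC₁' : 0 ≤ α * |C₁| := by positivity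
    rcases le_total t 1 with h1 | h1
    · refine (hup2 t ht h1).trans ?_
      calc α * |C₁| * t ^ α ≤ (K + (α⁻¹ + C₀) + α * |C₁|) * (t ^ α + t) := by
            gcongr <;> linarith
        _ ≤ _ := le_mul_of_one_le_right (by positivity) (hexp1 t ht)
    · refine (hup1 t h1).trans (mul_le_mul_of_nonneg_right ?_ (Real.exp_pos _).le)
      exact mul_le_mul (by linarith) (by linarith) ht (by positivity)
  · intro t ht
    have ht0 : 0 ≤ t := (le_max_left _ _).trans ht
    have ht1 : 2 * α * C₀ ≤ t := (le_max_right _ _).trans ht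
    have h1 := norm_le_norm_add_norm_sub (mittagLefflerRay α ω t)
      (s₀ / α * (t * Complex.exp (s₀ * t)))
    rw [hA t ht0] at h1
    have h2 := hC₀ t ht0
    have h3 : C₀ ≤ α⁻¹ / 2 * t := by
      calc C₀ = α⁻¹ / 2 * (2 * α * C₀) := by field_simp
        _ ≤ _ := by gcongr
    have h4 := mul_le_mul_of_nonneg_right h3 (Real.exp_pos (κ * t)).le
    linarith

/-! ### Pointwise bounds for the gradient of the evolved symbol. -/

/-- The Fourier side of the evolution, `E_α(ω t^α (2π‖η‖)²) G(η)`. -/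
noncomputable def evolvedSymbol {d : ℕ} (α : ℝ) (ω : ℂ) (G : RSpace d → ℂ) (t : ℝ)
    (η : RSpace d) : ℂ :=
  mittagLeffler α (ω * ((t ^ α * (2 * Real.pi * ‖η‖) ^ 2 : ℝ) : ℂ)) * G η

/-- The rescaled time `(2π‖η‖)^(2/α) t`. -/
noncomputable def rescaledTime {d : ℕ} (α t : ℝ) (η : RSpace d) : ℝ :=
  (2 * Real.pi * ‖η‖) ^ (2 / α) * t

section
variable {d : ℕ} {α : ℝ} {ω : ℂ} {G : RSpace d → ℂ}

theorem rescaledTime_nonneg {t : ℝ} (ht : 0 ≤ t) (η : RSpace d) : 0 ≤ rescaledTime α t η := by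
  unfold rescaledTime
  positivity

theorem rescaledTime_rpow (hα : 0 < α) {t : ℝ} (ht : 0 ≤ t) (η : RSpace d) :
    rescaledTime α t η ^ α = t ^ α * (2 * Real.pi * ‖η‖) ^ 2 := by
  unfold rescaledTime
  rw [Real.mul_rpow (by positivity) ht, ← Real.rpow_mul (by positivity), div_mul_cancel₀ _ hα.ne',
    mul_comm, Real.rpow_two]

theorem contDiff_evolvedSymbol (hα : 0 < α) (hG : ContDiff ℝ 1 G) (t : ℝ) :
    ContDiff ℝ 1 (evolvedSymbol α ω G t) := by
  unfold evolvedSymbol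
  refine ContDiff.mul ?_ hG
  have h1 : ContDiff ℝ 1 (mittagLeffler α) :=
    ((differentiable_mittagLeffler hα).contDiff (n := 1)).restrict_scalars ℝ
  have h2 : ContDiff ℝ 1 fun η : RSpace d => (t ^ α * (2 * Real.pi * ‖η‖) ^ 2 : ℝ) := by
    simp only [mul_pow]
    exact contDiff_const.mul (contDiff_const.mul (contDiff_norm_sq ℝ))
  exact h1.comp (contDiff_const.mul (Complex.ofRealCLM.contDiff.comp h2))

theorem hasCompactSupport_evolvedSymbol (hG : HasCompactSupport G) (t : ℝ) :
    HasCompactSupport (evolvedSymbol α ω G t) := hG.mul_left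

theorem fderiv_evolvedSymbol (hα : 0 < α) (hG : ContDiff ℝ 1 G) {t : ℝ} (ht : 0 ≤ t)
    (η e : RSpace d) :
    fderiv ℝ (evolvedSymbol α ω G t) η e =
      ((2 / α * (inner ℝ η e / ‖η‖ ^ 2) : ℝ) : ℂ) *
        mittagLefflerRay α ω (rescaledTime α t η) * G η +
      mittagLeffler α (ω * ((rescaledTime α t η ^ α : ℝ) : ℂ)) * fderiv ℝ G η e := by
  set a : ℝ := t ^ α * (2 * Real.pi) ^ 2 with ha
  have hR : ∀ η : RSpace d, t ^ α * (2 * Real.pi * ‖η‖) ^ 2 = a * ‖η‖ ^ 2 := fun η => by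
    rw [ha]; ring
  have h1 : HasFDerivAt (fun η : RSpace d => ((a * ‖η‖ ^ 2 : ℝ) : ℂ))
      (Complex.ofRealCLM.comp (a • (2 • (innerSL ℝ η)))) η :=
    Complex.ofRealCLM.hasFDerivAt.comp η ((hasStrictFDerivAt_norm_sq η).hasFDerivAt.const_mul a)
  have h2 := h1.const_mul ω
  have h3 := ((differentiable_mittagLeffler hα (ω * ((a * ‖η‖ ^ 2 : ℝ) : ℂ))).hasDerivAt).comp_hasFDerivAt
    η h2
  have h4 := (hG.differentiable one_ne_zero η).hasFDerivAt
  have h5 := h3.mul h4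
  have hU : evolvedSymbol α ω G t =
      fun η => mittagLeffler α (ω * ((a * ‖η‖ ^ 2 : ℝ) : ℂ)) * G η := by
    funext η
    rw [evolvedSymbol, hR]
  have hd := h5.fderiv
  rw [hU]
  erw [hd]
  rw [mittagLefflerRay, rescaledTime_rpow hα ht, hR, ← mul_deriv_mittagLeffler hα]
  simp
  rcases eq_or_ne η 0 with rfl | hη
  · simp
  · have : (‖η‖ : ℂ) ≠ 0 := by exact_mod_cast (norm_ne_zero_iff.2 hη)
    have : (α : ℂ) ≠ 0 := by exact_mod_cast hα.ne'
    field_simp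
    ring
end

section
variable {d : ℕ} {α : ℝ} {G : RSpace d → ℂ} {s₀ : ℂ}

/-- Compare η with its radial projection to the sphere of radius R, where G vanishes. -/
theorem norm_le_mul_sub_norm_of_lipschitz {L : NNReal} (hL : LipschitzWith L G) {R : ℝ}
    (hGR : ∀ η, R ≤ ‖η‖ → G η = 0) {η : RSpace d} (hη : η ≠ 0) (hηR : ‖η‖ ≤ R) :
    ‖G η‖ ≤ L * (R - ‖η‖) := by
  have hn : 0 < ‖η‖ := norm_pos_iff.2 hη
  have h1 : ‖(R / ‖η‖) • η‖ = R := by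
    rw [norm_smul, Real.norm_of_nonneg (div_nonneg (hn.le.trans hηR) hn.le), div_mul_cancel₀ _ hn.ne']
  have h2 := hL.norm_sub_le η ((R / ‖η‖) • η)
  rw [hGR _ h1.ge, sub_zero] at h2
  refine h2.trans_eq ?_
  have h3 : η - (R / ‖η‖) • η = (1 - R / ‖η‖) • η := by rw [sub_smul, one_smul]
  rw [h3, norm_smul, Real.norm_eq_abs, abs_sub_comm, abs_of_nonneg]
  · field_simp
  · rw [sub_nonneg, le_div_iff₀ hn, one_mul]
    exact hηR

/-- There is no factor t on the right: the one carried by W is absorbed by the linear vanishing of G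
at the sphere of radius R. -/
theorem exists_norm_fderiv_evolvedSymbol_le (hα : 0 < α) (hα1 : α ≤ 1)
    (hs₀ : 0 < s₀.re) (hs₁ : ‖s₀‖ = 1) (hG : ContDiff ℝ 1 G) (hGc : HasCompactSupport G)
    {R : ℝ} (hR : 0 < R) (hGR : ∀ η, R ≤ ‖η‖ → G η = 0) :
    ∃ K : ℝ, 0 ≤ K ∧ ∀ t : ℝ, 1 ≤ t → ∀ η e : RSpace d, ‖e‖ ≤ 1 →
      ‖fderiv ℝ (evolvedSymbol α (s₀ ^ (α : ℂ)) G t) η e‖ ≤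
        (Metric.closedBall (0 : RSpace d) R).indicator
          (fun _ => K * Real.exp (s₀.re * ((2 * Real.pi * R) ^ (2 / α) * t))) η := by
  obtain ⟨C, -, -, hC, -, hy, hW, -⟩ := exists_mittagLeffler_ray_bounds hα hα1 hs₀ hs₁
  obtain ⟨L, hL⟩ := hG.lipschitzWith_of_hasCompactSupport hGc one_ne_zero
  set ω := s₀ ^ (α : ℂ) with hω
  set κ := s₀.re with hκ
  set p := 2 / α with hp
  have hp2 : 2 ≤ p := by rw [hp, le_div_iff₀ hα]; linarith
  have hπR : 0 < 2 * Real.pi * R := by positivity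
  set δ : ℝ := (2 * Real.pi * R) ^ (p - 1) * (2 * Real.pi) with hδ
  have hδpos : 0 < δ := by positivity
  set D : ℝ := 2 / α * (C * ((2 * Real.pi) ^ 2 * R + (2 * Real.pi) * (2 * Real.pi * R) ^ (p - 1)))
    with hD
  have hDpos : 0 ≤ D := by positivity
  refine ⟨D * L * (κ * δ)⁻¹ + C * L, by positivity, fun t ht η e he => ?_⟩
  have ht0 : 0 < t := by linarith
  rw [fderiv_evolvedSymbol hα hG ht0.le]
  by_cases hηR : ‖η‖ ≤ R
  · rw [Set.indicator_of_mem (by simpa using hηR)]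
    set τ := rescaledTime α t η with hτ
    have hτ0 : 0 ≤ τ := rescaledTime_nonneg ht0.le η
    set T := (2 * Real.pi * R) ^ p * t with hT
    have hτT : τ ≤ T := by
      rw [hτ, hT, rescaledTime]
      gcongr
    have h2 : ‖mittagLeffler α (ω * ((τ ^ α : ℝ) : ℂ)) * fderiv ℝ G η e‖ ≤
        C * L * Real.exp (κ * T) := by
      have h3 : ‖fderiv ℝ G η e‖ ≤ L := by
        calc ‖fderiv ℝ G η e‖ ≤ ‖fderiv ℝ G η‖ * ‖e‖ := (fderiv ℝ G η).le_opNorm e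
          _ ≤ L * 1 := mul_le_mul (norm_fderiv_le_of_lipschitz ℝ hL) he (norm_nonneg _) L.2
          _ = L := mul_one _
      rw [norm_mul]
      calc _ ≤ C * Real.exp (κ * τ) * L := mul_le_mul (hy τ hτ0) h3 (norm_nonneg _) (by positivity)
        _ ≤ C * Real.exp (κ * T) * L := by gcongr
        _ = _ := by ring
    have h1 : ‖((2 / α * (inner ℝ η e / ‖η‖ ^ 2) : ℝ) : ℂ) * mittagLefflerRay α ω τ * G η‖ ≤
        D * L * (κ * δ)⁻¹ * Real.exp (κ * T) := by
      rcases eq_or_ne η 0 with rfl | hη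
      · simp only [inner_zero_left, zero_div, mul_zero, Complex.ofReal_zero, zero_mul, norm_zero]
        positivity
      have hn : 0 < ‖η‖ := norm_pos_iff.2 hη
      have hGη := norm_le_mul_sub_norm_of_lipschitz hL hGR hη hηR
      have hinner : |inner ℝ η e / ‖η‖ ^ 2| ≤ ‖η‖⁻¹ := by
        rw [abs_div, abs_of_nonneg (by positivity : 0 ≤ ‖η‖ ^ 2), div_le_iff₀ (by positivity)]
        calc |inner ℝ η e| ≤ ‖η‖ * ‖e‖ := abs_real_inner_le_norm _ _
          _ ≤ ‖η‖ * 1 := by gcongr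
          _ = _ := by field_simp
      -- The singular factor ‖η‖⁻¹ is harmless because τ^α and τ are of order ‖η‖² and ‖η‖^(2/α),
      -- with 2/α ≥ 2.
      have hτbound : ‖η‖⁻¹ * (τ ^ α + τ) ≤
          ((2 * Real.pi) ^ 2 * R + (2 * Real.pi) * (2 * Real.pi * R) ^ (p - 1)) * t := by
        have e1 : τ ^ α = t ^ α * (2 * Real.pi * ‖η‖) ^ 2 := rescaledTime_rpow hα ht0.le η
        have e2 : τ = (2 * Real.pi * ‖η‖) ^ (p - 1) * (2 * Real.pi * ‖η‖) * t := by
          rw [hτ, rescaledTime, Real.rpow_sub_one (by positivity), div_mul_cancel₀ _ (by positivity)]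
        have e3 : t ^ α ≤ t := by
          simpa using Real.rpow_le_rpow_of_exponent_le ht hα1
        have e4 : (2 * Real.pi * ‖η‖) ^ (p - 1) ≤ (2 * Real.pi * R) ^ (p - 1) :=
          Real.rpow_le_rpow (by positivity) (by gcongr) (by linarith)
        calc ‖η‖⁻¹ * (τ ^ α + τ) = (2 * Real.pi) ^ 2 * ‖η‖ * t ^ α +
              (2 * Real.pi) * (2 * Real.pi * ‖η‖) ^ (p - 1) * t := by
              rw [e1]
              nth_rewrite 1 [e2]
              field_simp
          _ ≤ (2 * Real.pi) ^ 2 * R * t + (2 * Real.pi) * (2 * Real.pi * R) ^ (p - 1) * t := by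
              gcongr
          _ = _ := by ring
      -- The exponent loses an amount linear in the distance to the sphere; this loss pays for the
      -- factor (R - ‖η‖) t.
      have hgap : τ ≤ T - δ * ((R - ‖η‖) * t) := by
        have e4 : (2 * Real.pi * ‖η‖) ^ (p - 1) ≤ (2 * Real.pi * R) ^ (p - 1) :=
          Real.rpow_le_rpow (by positivity) (by gcongr) (by linarith)
        have e5 : (2 * Real.pi * ‖η‖) ^ p ≤ (2 * Real.pi * R) ^ p - δ * (R - ‖η‖) := by
          have a1 : (2 * Real.pi * ‖η‖) ^ p = (2 * Real.pi * ‖η‖) ^ (p - 1) * (2 * Real.pi * ‖η‖) := by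
            rw [Real.rpow_sub_one (by positivity), div_mul_cancel₀ _ (by positivity)]
          have a2 : (2 * Real.pi * R) ^ p = (2 * Real.pi * R) ^ (p - 1) * (2 * Real.pi * R) := by
            rw [Real.rpow_sub_one (by positivity), div_mul_cancel₀ _ (by positivity)]
          rw [a1, a2, hδ]
          have := mul_le_mul_of_nonneg_right e4 (by positivity : 0 ≤ 2 * Real.pi * ‖η‖)
          linarith
        rw [hτ, hT, rescaledTime]
        have := mul_le_mul_of_nonneg_right e5 ht0.le
        linarith
      have hx : 0 ≤ (R - ‖η‖) * t := mul_nonneg (sub_nonneg.2 hηR) ht0.le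
      have hexp : (R - ‖η‖) * t * Real.exp (κ * τ) ≤ (κ * δ)⁻¹ * Real.exp (κ * T) := by
        set x := (R - ‖η‖) * t
        have b1 : Real.exp (κ * τ) ≤ Real.exp (κ * T) * Real.exp (-(κ * δ * x)) := by
          rw [← Real.exp_add]
          refine Real.exp_le_exp.2 ?_
          have := mul_le_mul_of_nonneg_left hgap hs₀.le
          linarith
        have b2 : x * Real.exp (-(κ * δ * x)) ≤ (κ * δ)⁻¹ := by
          have hκδ : 0 < κ * δ := by positivity
          have := Real.add_one_le_exp (κ * δ * x)
          rw [Real.exp_neg, ← div_eq_mul_inv, div_le_iff₀ (Real.exp_pos _)]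
          calc x = (κ * δ)⁻¹ * (κ * δ * x) := by field_simp
            _ ≤ (κ * δ)⁻¹ * Real.exp (κ * δ * x) := by gcongr; linarith
        calc x * Real.exp (κ * τ) ≤ x * (Real.exp (κ * T) * Real.exp (-(κ * δ * x))) := by gcongr
          _ = x * Real.exp (-(κ * δ * x)) * Real.exp (κ * T) := by ring
          _ ≤ _ := by gcongr
      rw [norm_mul, norm_mul, Complex.norm_real, Real.norm_eq_abs, abs_mul,
        abs_of_pos (by positivity : 0 < 2 / α)]
      calc _ ≤ 2 / α * ‖η‖⁻¹ * (C * (τ ^ α + τ) * Real.exp (κ * τ)) * (L * (R - ‖η‖)) := by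
            gcongr
            exact hW τ hτ0
        _ = 2 / α * C * L * ((‖η‖⁻¹ * (τ ^ α + τ)) * ((R - ‖η‖) * Real.exp (κ * τ))) := by ring
        _ ≤ 2 / α * C * L * ((((2 * Real.pi) ^ 2 * R +
              (2 * Real.pi) * (2 * Real.pi * R) ^ (p - 1)) * t) *
              ((R - ‖η‖) * Real.exp (κ * τ))) := by
            have := sub_nonneg.2 hηR
            gcongr
        _ = D * L * ((R - ‖η‖) * t * Real.exp (κ * τ)) := by rw [hD]; ring
        _ ≤ D * L * ((κ * δ)⁻¹ * Real.exp (κ * T)) := by gcongr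
        _ = _ := by ring
    refine (norm_add_le _ _).trans ?_
    rw [add_mul]
    exact add_le_add h1 h2
  · rw [Set.indicator_of_notMem (by simpa using hηR)]
    rw [not_le] at hηR
    have h0 : G =ᶠ[𝓝 η] fun _ => 0 := by
      filter_upwards [continuous_norm.continuousAt.eventually (lt_mem_nhds hηR)] with w hw
      exact hGR w hw.le
    rw [hGR η hηR.le, h0.fderiv_eq]
    simp

/-- On a set where ‖η‖, ‖G‖ and the component along e are bounded below, the W term is at least c₁ τ
e^{κτ}. It exceeds the other term, at most C L e^{κτ}, by e^{κτ} once c₁τ ≥ 1 + CL. -/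
theorem exists_le_norm_fderiv_evolvedSymbol (hα : 0 < α) (hα1 : α ≤ 1)
    (hs₀ : 0 < s₀.re) (hs₁ : ‖s₀‖ = 1) (hG : ContDiff ℝ 1 G) (hGc : HasCompactSupport G)
    {S : Set (RSpace d)} {e : RSpace d} (he : ‖e‖ ≤ 1) {R ρ b₀ c₀ : ℝ} (hR : 0 < R) (hρ : 0 < ρ)
    (hb₀ : 0 < b₀) (hc₀ : 0 < c₀) (hSR : ∀ η ∈ S, ‖η‖ ≤ R) (hSρ : ∀ η ∈ S, ρ ≤ 2 * Real.pi * ‖η‖)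
    (hSb : ∀ η ∈ S, b₀ ≤ |inner ℝ η e|) (hSc : ∀ η ∈ S, c₀ ≤ ‖G η‖) :
    ∃ T : ℝ, 0 ≤ T ∧ ∀ t : ℝ, T ≤ t → ∀ η ∈ S, Real.exp (s₀.re * (ρ ^ (2 / α) * t)) ≤
      ‖fderiv ℝ (evolvedSymbol α (s₀ ^ (α : ℂ)) G t) η e‖ := by
  obtain ⟨C, c, T₀, hC, hc, hy, -, hW⟩ := exists_mittagLeffler_ray_bounds hα hα1 hs₀ hs₁
  obtain ⟨L, hL⟩ := hG.lipschitzWith_of_hasCompactSupport hGc one_ne_zero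
  set ω := s₀ ^ (α : ℂ) with hω
  set κ := s₀.re with hκ
  set p := 2 / α with hp
  have hp0 : 0 < p := by positivity
  set c₁ : ℝ := 2 / α * (b₀ / R ^ 2) * c * c₀ with hc₁
  have hc₁pos : 0 < c₁ := by positivity
  have hρp : 0 < ρ ^ p := Real.rpow_pos_of_pos hρ _
  refine ⟨max 0 (max T₀ ((1 + C * L) / c₁) / ρ ^ p), le_max_left _ _, fun t ht η hη => ?_⟩
  have ht0 : 0 ≤ t := (le_max_left _ _).trans ht
  rw [fderiv_evolvedSymbol hα hG ht0]
  set τ := rescaledTime α t η with hτ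
  have hτρ : ρ ^ p * t ≤ τ := by
    rw [hτ, rescaledTime]
    have := hSρ η hη
    gcongr
  have hτ0 : 0 ≤ τ := rescaledTime_nonneg ht0 η
  have hτmax : max T₀ ((1 + C * L) / c₁) ≤ τ := by
    refine le_trans ?_ hτρ
    rw [← div_le_iff₀' hρp]
    exact (le_max_right _ _).trans ht
  have hτ1 : T₀ ≤ τ := (le_max_left _ _).trans hτmax
  have hτ2 : 1 + C * L ≤ c₁ * τ := by
    rw [← div_le_iff₀' hc₁pos]
    exact (le_max_right _ _).trans hτmax
  have hn : 0 < ‖η‖ := by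
    have h := hρ.trans_le (hSρ η hη)
    exact pos_of_mul_pos_right h (by positivity)
  have h2 : ‖mittagLeffler α (ω * ((τ ^ α : ℝ) : ℂ)) * fderiv ℝ G η e‖ ≤
      C * L * Real.exp (κ * τ) := by
    have h3 : ‖fderiv ℝ G η e‖ ≤ L := by
      calc ‖fderiv ℝ G η e‖ ≤ ‖fderiv ℝ G η‖ * ‖e‖ := (fderiv ℝ G η).le_opNorm e
        _ ≤ L * 1 := mul_le_mul (norm_fderiv_le_of_lipschitz ℝ hL) he (norm_nonneg _) L.2
        _ = L := mul_one _
    rw [norm_mul]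
    calc _ ≤ C * Real.exp (κ * τ) * L := mul_le_mul (hy τ hτ0) h3 (norm_nonneg _) (by positivity)
      _ = _ := by ring
  have h1 : c₁ * τ * Real.exp (κ * τ) ≤
      ‖((2 / α * (inner ℝ η e / ‖η‖ ^ 2) : ℝ) : ℂ) * mittagLefflerRay α ω τ * G η‖ := by
    rw [norm_mul, norm_mul, Complex.norm_real, Real.norm_eq_abs, abs_mul,
      abs_of_pos (by positivity : 0 < 2 / α), abs_div, abs_of_nonneg (by positivity : 0 ≤ ‖η‖ ^ 2)]
    have e1 := hSb η hη
    have e2 := hSR η hη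
    have e3 := hSc η hη
    have e4 := hW τ hτ1
    calc c₁ * τ * Real.exp (κ * τ) =
        2 / α * (b₀ / R ^ 2) * (c * τ * Real.exp (κ * τ)) * c₀ := by rw [hc₁]; ring
      _ ≤ _ := by gcongr
  have h3 := norm_sub_le_norm_add (((2 / α * (inner ℝ η e / ‖η‖ ^ 2) : ℝ) : ℂ) *
    mittagLefflerRay α ω τ * G η) (mittagLeffler α (ω * ((τ ^ α : ℝ) : ℂ)) * fderiv ℝ G η e)
  have h4 : Real.exp (κ * (ρ ^ p * t)) ≤ Real.exp (κ * τ) :=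
    Real.exp_le_exp.2 (mul_le_mul_of_nonneg_left hτρ hs₀.le)
  have h5 := mul_le_mul_of_nonneg_right hτ2 (Real.exp_pos (κ * τ)).le
  linarith
end

/-! ### The Fourier transform on L², the Laplacian and the displacement. -/

section
open FourierTransform TemperedDistribution
open scoped ContDiff
variable {d : ℕ}

theorem Lp.ae_eq_of_toTemperedDistribution {φ : L2Space d} {ψ : RSpace d → ℂ}
    (hψ : LocallyIntegrable ψ volume)
    (h : ∀ u : 𝓢(RSpace d, ℂ), (φ : 𝓢'(RSpace d, ℂ)) u = ∫ x, u x • ψ x) :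
    (φ : RSpace d → ℂ) =ᵐ[volume] ψ := by
  refine ae_eq_of_integral_contDiff_smul_eq ((Lp.memLp φ).locallyIntegrable (by norm_num)) hψ
    fun g hg hgc => ?_
  have hg₁ : HasCompactSupport (Complex.ofRealCLM ∘ g) := hgc.comp_left rfl
  have hg₂ : ContDiff ℝ ∞ (Complex.ofRealCLM ∘ g) := by fun_prop
  have := h (hg₁.toSchwartzMap hg₂)
  rw [Lp.toTemperedDistribution_apply] at this
  simpa using this

theorem smulLeftCLM_toTemperedDistribution_eq_iff {g : RSpace d → ℂ} (hg : g.HasTemperateGrowth)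
    (φ ψ : L2Space d) :
    smulLeftCLM ℂ g (φ : 𝓢'(RSpace d, ℂ)) = (ψ : 𝓢'(RSpace d, ℂ)) ↔
      (ψ : RSpace d → ℂ) =ᵐ[volume] fun x => g x * φ x := by
  have happ : ∀ u : 𝓢(RSpace d, ℂ), smulLeftCLM ℂ g (φ : 𝓢'(RSpace d, ℂ)) u =
      ∫ x, u x • (g x * φ x) := fun u => by
    rw [smulLeftCLM_apply_apply, Lp.toTemperedDistribution_apply]
    refine integral_congr_ae (ae_of_all _ fun x => ?_)
    simp only [SchwartzMap.smulLeftCLM_apply_apply hg, smul_eq_mul]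
    ring
  constructor
  · intro h
    refine Lp.ae_eq_of_toTemperedDistribution ?_ fun u => by rw [← h, happ]
    have h1 : LocallyIntegrable (φ : RSpace d → ℂ) volume :=
      (Lp.memLp φ).locallyIntegrable (by norm_num)
    have := (locallyIntegrableOn_univ.2 h1).continuousOn_smul isOpen_univ.isLocallyClosed
      hg.1.continuous.continuousOn
    exact locallyIntegrableOn_univ.1 this
  · intro h
    ext u
    rw [happ, Lp.toTemperedDistribution_apply]
    refine integral_congr_ae ?_
    filter_upwards [h] with x hx
    rw [hx]

theorem hasTemperateGrowth_freeSymbol :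
    (fun x : RSpace d => (((2 * Real.pi) ^ 2 * ‖x‖ ^ 2 : ℝ) : ℂ)).HasTemperateGrowth := by
  fun_prop

theorem neg_laplacian_eq_iff (f h : L2Space d) :
    -(Δ (f : 𝓢'(RSpace d, ℂ))) = (h : 𝓢'(RSpace d, ℂ)) ↔
      ((𝓕 h : L2Space d) : RSpace d → ℂ) =ᵐ[volume]
        fun η => (((2 * Real.pi) ^ 2 * ‖η‖ ^ 2 : ℝ) : ℂ) * (𝓕 f : L2Space d) η := by
  have hsq : (fun x : RSpace d => Complex.ofReal (‖x‖ ^ 2)).HasTemperateGrowth := by fun_prop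
  have hsym : (fun x : RSpace d => (((2 * Real.pi) ^ 2 * ‖x‖ ^ 2 : ℝ) : ℂ)) =
      ((2 * Real.pi) ^ 2 : ℂ) • fun x : RSpace d => Complex.ofReal (‖x‖ ^ 2) := by
    funext x
    simp
  have hF : 𝓕 (-(Δ (f : 𝓢'(RSpace d, ℂ)))) =
      smulLeftCLM ℂ (fun x : RSpace d => (((2 * Real.pi) ^ 2 * ‖x‖ ^ 2 : ℝ) : ℂ))
        ((𝓕 f : L2Space d) : 𝓢'(RSpace d, ℂ)) := by
    rw [laplacian_eq_fourierMultiplierCLM, neg_smul, neg_neg, fourierMultiplierCLM_apply, hsym,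
      smulLeftCLM_smul hsq, ← Lp.fourier_toTemperedDistribution_eq]
    have : ∀ T : 𝓢'(RSpace d, ℂ), 𝓕 (((2 * Real.pi) ^ 2 : ℝ) • 𝓕⁻ T) =
        (((2 * Real.pi) ^ 2 : ℝ) : ℂ) • T := fun T => by
      ext u
      simp
    rw [this]
    push_cast
    rfl
  rw [← smulLeftCLM_toTemperedDistribution_eq_iff hasTemperateGrowth_freeSymbol, ← hF,
    ← Lp.fourier_toTemperedDistribution_eq]
  constructor
  · intro h
    rw [h]
  · intro h
    have := congrArg (fun T => 𝓕⁻ T) h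
    simpa using this

theorem isFreeHamiltonian_iff (f h : L2Space d) :
    IsFreeHamiltonian f h ↔ ((𝓕 h : L2Space d) : RSpace d → ℂ) =ᵐ[volume]
      fun η => (((2 * Real.pi) ^ 2 * ‖η‖ ^ 2 : ℝ) : ℂ) * (𝓕 f : L2Space d) η := by
  rw [IsFreeHamiltonian, neg_laplacian_eq_iff]
  refine ⟨fun H => H.2, fun H => ⟨?_, H⟩⟩
  rw [memSobolev_iff_exists_smulLeftCLM_fourier]
  -- H² regularity is automatic: (1 + ‖η‖²) 𝓕f equals this sum of two L² functions.
  refine ⟨𝓕 f + (((2 * Real.pi) ^ 2)⁻¹ : ℂ) • 𝓕 h, ?_⟩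
  rw [Lp.fourier_toTemperedDistribution_eq,
    smulLeftCLM_toTemperedDistribution_eq_iff (by fun_prop)]
  filter_upwards [H, Lp.coeFn_add (𝓕 f) ((((2 * Real.pi) ^ 2)⁻¹ : ℂ) • 𝓕 h),
    Lp.coeFn_smul (((2 * Real.pi) ^ 2)⁻¹ : ℂ) (𝓕 h)] with x h1 h2 h3
  rw [h2, Pi.add_apply, h3, Pi.smul_apply, h1]
  have : (Real.pi : ℂ) ≠ 0 := by exact_mod_cast Real.pi_ne_zero
  simp
  field_simp

theorem continuous_fourierInv {U : RSpace d → ℂ} (hU : Integrable U) : Continuous (𝓕⁻ U) :=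
  VectorFourier.fourierIntegral_continuous Real.continuous_fourierChar
    (by exact (continuous_inner (𝕜 := ℝ)).neg) hU

/-- Identifies the L² inverse transform with the integral one by moving the transform onto Schwartz
test functions. -/
theorem fourierInv_toLp_ae_eq {U : RSpace d → ℂ} (hU : Integrable U) (hU2 : MemLp U 2) :
    (𝓕⁻ (hU2.toLp U) : L2Space d) =ᵐ[volume] 𝓕⁻ U := by
  refine Lp.ae_eq_of_toTemperedDistribution (continuous_fourierInv hU).locallyIntegrable fun u => ?_
  rw [← Lp.fourierInv_toTemperedDistribution_eq, TemperedDistribution.fourierInv_apply,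
    Lp.toTemperedDistribution_apply]
  have h1 : ∫ x, (𝓕⁻ u) x • hU2.toLp U x = ∫ x, 𝓕⁻ (u : RSpace d → ℂ) x • U x := by
    refine integral_congr_ae ?_
    filter_upwards [hU2.coeFn_toLp] with x hx
    rw [hx, SchwartzMap.fourierInv_coe]
  rw [h1]
  have := VectorFourier.integral_fourierIntegral_smul_eq_flip (L := -innerₗ (RSpace d))
    Real.continuous_fourierChar (by exact (continuous_inner (𝕜 := ℝ)).neg)
    (u.integrable (μ := volume)) hU
  refine this.trans ?_
  have hflip : (-innerₗ (RSpace d)).flip = -innerₗ (RSpace d) := by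
    ext x y
    simp [real_inner_comm]
  rw [hflip]
  rfl

theorem fourierInv_fderiv_apply {U : RSpace d → ℂ} (hU : ContDiff ℝ 1 U)
    (hUc : HasCompactSupport U) (e x : RSpace d) :
    𝓕⁻ (fun η => fderiv ℝ U η e) x = -(2 * Real.pi * Complex.I * (inner ℝ x e : ℝ)) * 𝓕⁻ U x := by
  have hint : Integrable U := hU.continuous.integrable_of_hasCompactSupport hUc
  have hdint : Integrable (fderiv ℝ U) :=
    (hU.continuous_fderiv one_ne_zero).integrable_of_hasCompactSupport (hUc.fderiv ℝ)
  have h := congrFun (Real.fourier_fderiv hint (hU.differentiable one_ne_zero) hdint) (-x)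
  have h2 := congrArg (fun T : RSpace d →L[ℝ] ℂ => T e) h
  rw [Real.fourierInv_eq_fourier_neg, Real.fourierInv_eq_fourier_neg]
  have h3 : 𝓕 (fun η => fderiv ℝ U η e) (-x) = 𝓕 (fderiv ℝ U) (-x) e :=
    (Real.fourierIntegral_continuousLinearMap_apply' (L := innerSL ℝ) hdint).symm
  rw [h3]
  refine h2.trans ?_
  have h4 : (innerSL ℝ x) e = inner ℝ x e := rfl
  simp only [VectorFourier.fourierSMulRight_apply, neg_apply, map_neg, neg_neg,
    h4, smul_eq_mul, Complex.real_smul]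
  ring

theorem integral_norm_sq_Lp (φ : L2Space d) :
    Integrable (fun x => ‖φ x‖ ^ 2) volume ∧ ∫ x, ‖φ x‖ ^ 2 = ‖φ‖ ^ 2 := by
  refine ⟨(Lp.memLp φ).integrable_norm_pow two_ne_zero, ?_⟩
  have h := L2.inner_def (𝕜 := ℂ) φ φ
  rw [inner_self_eq_norm_sq_to_K] at h
  have h2 : ∫ x, inner ℂ (φ x) (φ x) = ((∫ x, ‖φ x‖ ^ 2 : ℝ) : ℂ) := by
    rw [← integral_complex_ofReal]
    refine integral_congr_ae (ae_of_all _ fun x => ?_)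
    simp only [inner_self_eq_norm_sq_to_K]
    push_cast
    rfl
  rw [h2] at h
  exact Complex.ofReal_injective (h.symm.trans (by push_cast; rfl))

/-- Plancherel in each coordinate: multiplication by x_j corresponds to ∂_j on the Fourier side, up
to a factor of modulus 2π. -/
theorem meanSquareDisplacement_fourierInv {U : RSpace d → ℂ} (hU : ContDiff ℝ 1 U)
    (hUc : HasCompactSupport U) (φ : L2Space d)
    (hφ : (𝓕 φ : L2Space d) =ᵐ[volume] U) :
    MemWeightedL2 φ ∧ meanSquareDisplacement φ = ((2 * Real.pi) ^ 2)⁻¹ *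
      ∑ j : Fin d, ∫ η, ‖fderiv ℝ U η (EuclideanSpace.single j 1)‖ ^ 2 := by
  have hint : Integrable U := hU.continuous.integrable_of_hasCompactSupport hUc
  have hU2 : MemLp U 2 := hU.continuous.memLp_of_hasCompactSupport hUc
  have hφU : (φ : RSpace d → ℂ) =ᵐ[volume] 𝓕⁻ U := by
    have : φ = 𝓕⁻ (hU2.toLp U) := by
      have h1 : 𝓕 φ = hU2.toLp U := Lp.ext (hφ.trans hU2.coeFn_toLp.symm)
      rw [← h1]
      exact ((Lp.fourierTransformₗᵢ (RSpace d) ℂ).symm_apply_apply φ).symm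
    rw [this]
    exact fourierInv_toLp_ae_eq hint hU2
  have hj : ∀ j : Fin d, Integrable (fun x : RSpace d => x j ^ 2 * ‖φ x‖ ^ 2) ∧
      ∫ x : RSpace d, x j ^ 2 * ‖φ x‖ ^ 2 = ((2 * Real.pi) ^ 2)⁻¹ *
        ∫ η, ‖fderiv ℝ U η (EuclideanSpace.single j 1)‖ ^ 2 := fun j => by
    set D : RSpace d → ℂ := fun η => fderiv ℝ U η (EuclideanSpace.single j 1) with hD
    have hDc : Continuous D := (hU.continuous_fderiv one_ne_zero).clm_apply continuous_const
    have hDs : HasCompactSupport D :=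
      (hUc.fderiv ℝ).comp_left (g := fun T : RSpace d →L[ℝ] ℂ => T (EuclideanSpace.single j 1)) rfl
    have hD1 : Integrable D := hDc.integrable_of_hasCompactSupport hDs
    have hD2 : MemLp D 2 := hDc.memLp_of_hasCompactSupport hDs
    set ψ : L2Space d := 𝓕⁻ (hD2.toLp D) with hψ
    have hae : (fun x : RSpace d => ‖ψ x‖ ^ 2) =ᵐ[volume]
        fun x => (2 * Real.pi) ^ 2 * (x j ^ 2 * ‖φ x‖ ^ 2) := by
      filter_upwards [fourierInv_toLp_ae_eq hD1 hD2, hφU] with x h1 h2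
      rw [hψ, h1, h2, hD, fourierInv_fderiv_apply hU hUc]
      simp only [norm_mul, norm_neg, Complex.norm_real, Complex.norm_I, EuclideanSpace.inner_single_right]
      simp [mul_pow, abs_of_pos Real.pi_pos]
      ring
    obtain ⟨hI, hV⟩ := integral_norm_sq_Lp ψ
    have hnorm : ‖ψ‖ = ‖hD2.toLp D‖ := by
      rw [← Lp.norm_fourier_eq ψ, hψ, fourier_fourierInv_eq]
    have hD3 : ∫ η, ‖D η‖ ^ 2 = ‖hD2.toLp D‖ ^ 2 := by
      rw [← (integral_norm_sq_Lp (hD2.toLp D)).2]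
      refine integral_congr_ae ?_
      filter_upwards [hD2.coeFn_toLp] with x hx
      rw [hx]
    have hc : (2 * Real.pi) ^ 2 ≠ 0 := by positivity
    constructor
    · have := (hI.congr hae).const_mul ((2 * Real.pi) ^ 2)⁻¹
      refine this.congr (ae_of_all _ fun x => ?_)
      simp only
      rw [inv_mul_cancel_left₀ hc]
    · rw [hD3, ← hnorm, ← hV, integral_congr_ae hae, integral_const_mul, inv_mul_cancel_left₀ hc]
  have hsum : ∀ x : RSpace d, ‖x‖ ^ 2 * ‖φ x‖ ^ 2 = ∑ j : Fin d, x j ^ 2 * ‖φ x‖ ^ 2 := fun x => by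
    rw [EuclideanSpace.norm_sq_eq, Finset.sum_mul]
    simp
  constructor
  · have h1 : Integrable fun x : RSpace d => ‖x‖ ^ 2 * ‖φ x‖ ^ 2 := by
      simp_rw [hsum]
      exact integrable_finsetSum _ fun j _ => (hj j).1
    have := (integral_norm_sq_Lp φ).1.add h1
    refine this.congr (ae_of_all _ fun x => ?_)
    simp only [Pi.add_apply]
    ring
  · rw [meanSquareDisplacement]
    simp_rw [hsum]
    rw [integral_finsetSum _ fun j _ => (hj j).1, Finset.mul_sum]
    exact Finset.sum_congr rfl fun j _ => (hj j).2
end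

/-! ### Fourier normalization, truncated multipliers and the symbol of the series. -/

section
open FourierTransform
variable {d : ℕ}

/-- The substitution ξ = 2πη; its Jacobian (2π)^d turns the unitary factor into (2π)^(d/2). -/
theorem adjointFourier_eq_fourierInv (g : RSpace d → ℂ) (x : RSpace d) :
    adjointFourier g x =
      𝓕⁻ (fun η => (((2 * Real.pi) ^ ((d : ℝ) / 2) : ℝ) : ℂ) * g ((2 * Real.pi) • η)) x := by
  have h2 : (0 : ℝ) < 2 * Real.pi := by positivity
  have h := Measure.integral_comp_smul (volume : Measure (RSpace d))
    (fun ξ => Complex.exp (Complex.I * ((inner ℝ x ξ : ℝ) : ℂ)) * g ξ) (2 * Real.pi)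
  rw [finrank_euclideanSpace_fin, abs_of_pos (by positivity)] at h
  have h3 : ∫ ξ, Complex.exp (Complex.I * ((inner ℝ x ξ : ℝ) : ℂ)) * g ξ =
      (((2 * Real.pi) ^ d : ℝ) : ℂ) * ∫ η : RSpace d, Complex.exp
        (Complex.I * ((inner ℝ x ((2 * Real.pi) • η) : ℝ) : ℂ)) * g ((2 * Real.pi) • η) := by
    rw [h, Complex.real_smul, ← mul_assoc, ← Complex.ofReal_mul,
      mul_inv_cancel₀ (by positivity), Complex.ofReal_one, one_mul]
  rw [adjointFourier, h3, ← mul_assoc, ← Complex.ofReal_mul, Real.fourierInv_eq',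
    ← integral_const_mul]
  have h4 : (2 * Real.pi) ^ (-(d : ℝ) / 2) * (2 * Real.pi) ^ d = (2 * Real.pi) ^ ((d : ℝ) / 2) := by
    rw [← Real.rpow_natCast, ← Real.rpow_add h2]
    ring_nf
  rw [h4]
  refine integral_congr_ae (ae_of_all _ fun η => ?_)
  simp only [inner_smul_right, real_inner_comm, smul_eq_mul]
  rw [mul_comm Complex.I]
  ring

theorem fourier_ae_eq_of_ae_eq_fourierInv {U : RSpace d → ℂ} (hU : Continuous U)
    (hUc : HasCompactSupport U) {φ : L2Space d} (hφ : (φ : RSpace d → ℂ) =ᵐ[volume] 𝓕⁻ U) :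
    ((𝓕 φ : L2Space d) : RSpace d → ℂ) =ᵐ[volume] U := by
  have hU2 : MemLp U 2 := hU.memLp_of_hasCompactSupport hUc
  have h : φ = 𝓕⁻ (hU2.toLp U) := Lp.ext
    (hφ.trans (fourierInv_toLp_ae_eq (hU.integrable_of_hasCompactSupport hUc) hU2).symm)
  rw [h, fourier_fourierInv_eq]
  exact hU2.coeFn_toLp

theorem memLp_top_indicator_closedBall (m : C(RSpace d, ℂ)) (R : ℝ) :
    MemLp ((Metric.closedBall (0 : RSpace d) R).indicator m) ⊤ volume := by
  obtain ⟨M, hM⟩ := (isCompact_closedBall (0 : RSpace d) R).exists_bound_of_continuousOn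
    m.continuous.continuousOn
  refine memLp_top_of_bound
    (m.continuous.measurable.indicator measurableSet_closedBall).aestronglyMeasurable (max M 0)
    (ae_of_all _ fun η => ?_)
  by_cases hη : η ∈ Metric.closedBall (0 : RSpace d) R
  · rw [Set.indicator_of_mem hη]
    exact (hM η hη).trans (le_max_left _ _)
  · rw [Set.indicator_of_notMem hη, norm_zero]
    exact le_max_right _ _

/-- The Fourier multiplier with symbol `m` on the ball of radius `R` and `0` outside of it. -/
noncomputable def ballMultiplier (m : C(RSpace d, ℂ)) (R : ℝ) : L2Space d →L[ℂ] L2Space d :=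
  (Lp.fourierTransformₗᵢ (RSpace d) ℂ).symm.toContinuousLinearEquiv.toContinuousLinearMap ∘L
    ((ContinuousLinearMap.lsmul ℂ ℂ (E := ℂ)).holderL volume ⊤ 2 2
      ((memLp_top_indicator_closedBall m R).toLp _)) ∘L
    (Lp.fourierTransformₗᵢ (RSpace d) ℂ).toContinuousLinearEquiv.toContinuousLinearMap

theorem fourier_ballMultiplier (m : C(RSpace d, ℂ)) (R : ℝ) (f : L2Space d) :
    ((𝓕 (ballMultiplier m R f) : L2Space d) : RSpace d → ℂ) =ᵐ[volume]
      (Metric.closedBall (0 : RSpace d) R).indicator fun η => m η * (𝓕 f : L2Space d) η := by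
  have h : 𝓕 (ballMultiplier m R f) = (ContinuousLinearMap.lsmul ℂ ℂ (E := ℂ)).holder 2
      ((memLp_top_indicator_closedBall m R).toLp _) (𝓕 f) :=
    (Lp.fourierTransformₗᵢ (RSpace d) ℂ).apply_symm_apply _
  rw [h]
  filter_upwards [(ContinuousLinearMap.lsmul ℂ ℂ (E := ℂ)).coeFn_holder (r := 2)
    ((memLp_top_indicator_closedBall m R).toLp _) (𝓕 f),
    (memLp_top_indicator_closedBall m R).coeFn_toLp] with η h1 h2
  rw [h1, h2]
  by_cases hη : η ∈ Metric.closedBall (0 : RSpace d) R <;> simp [hη]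

/-- The symbol of `-Δ`. -/
noncomputable def freeSymbol (d : ℕ) : C(RSpace d, ℂ) :=
  ⟨fun η => (((2 * Real.pi) ^ 2 * ‖η‖ ^ 2 : ℝ) : ℂ), by fun_prop⟩

theorem Lp.fourier_ext {f h : L2Space d}
    (H : ((𝓕 f : L2Space d) : RSpace d → ℂ) =ᵐ[volume] (𝓕 h : L2Space d)) : f = h :=
  (Lp.fourierTransformₗᵢ (RSpace d) ℂ).injective (Lp.ext H)

/-- Along a subsequence the partial sums converge almost everywhere to the L² limit, and pointwise
to U. -/
theorem Lp.ae_eq_of_hasSum {f : ℕ → L2Space d} {F : L2Space d} (hf : HasSum f F)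
    {p : ℕ → RSpace d → ℂ} (hp : ∀ k, (f k : RSpace d → ℂ) =ᵐ[volume] p k) {U : RSpace d → ℂ}
    (hU : ∀ η, HasSum (fun k => p k η) (U η)) : (F : RSpace d → ℂ) =ᵐ[volume] U := by
  have hsum : ∀ n : ℕ, ((∑ k ∈ Finset.range n, f k : L2Space d) : RSpace d → ℂ) =ᵐ[volume]
      fun η => ∑ k ∈ Finset.range n, p k η := fun n => by
    induction n with
    | zero => simpa using! Lp.coeFn_zero ℂ 2 volume
    | succ n ih =>
      rw [Finset.sum_range_succ]
      filter_upwards [Lp.coeFn_add (∑ k ∈ Finset.range n, f k) (f n), ih, hp n] with η h1 h2 h3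
      rw [h1, Pi.add_apply, h2, h3, Finset.sum_range_succ]
  obtain ⟨ns, hns, hlim⟩ :=
    (tendstoInMeasure_of_tendsto_Lp hf.tendsto_sum_nat).exists_seq_tendsto_ae
  filter_upwards [hlim, ae_all_iff.2 hsum] with η h1 h2
  refine tendsto_nhds_unique h1 ?_
  simp_rw [h2]
  exact (hU η).tendsto_sum_nat.comp hns.tendsto_atTop

theorem fourier_smul_ballMultiplier_pow {G : RSpace d → ℂ} {R : ℝ}
    (hGR : ∀ η, R < ‖η‖ → G η = 0) (ω : ℂ) {φ : L2Space d}
    (hφ : ((𝓕 φ : L2Space d) : RSpace d → ℂ) =ᵐ[volume] G) (k : ℕ) :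
    ((𝓕 (((ω • ballMultiplier (freeSymbol d) R) ^ k) φ) : L2Space d) : RSpace d → ℂ) =ᵐ[volume]
      fun η => (ω * (((2 * Real.pi * ‖η‖) ^ 2 : ℝ) : ℂ)) ^ k * G η := by
  induction k with
  | zero => simpa using hφ
  | succ k ih =>
    rw [pow_succ_apply', smul_apply, FourierTransform.fourier_smul]
    filter_upwards [ih, fourier_ballMultiplier (freeSymbol d) R
      (((ω • ballMultiplier (freeSymbol d) R) ^ k) φ), Lp.coeFn_smul ω
      (𝓕 (ballMultiplier (freeSymbol d) R (((ω • ballMultiplier (freeSymbol d) R) ^ k) φ)))]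
      with η h1 h2 h3
    rw [h3, Pi.smul_apply, h2, smul_eq_mul]
    by_cases hη : η ∈ Metric.closedBall (0 : RSpace d) R
    · rw [Set.indicator_of_mem hη, h1]
      simp only [freeSymbol, ContinuousMap.coe_mk]
      push_cast
      ring
    · rw [Set.indicator_of_notMem hη, hGR η (by simpa using hη)]
      simp

theorem fourier_fracSeries {α : ℝ} (hα : 0 < α) {G : RSpace d → ℂ} {R : ℝ}
    (hGR : ∀ η, R < ‖η‖ → G η = 0) (ω : ℂ) {φ : L2Space d}
    (hφ : ((𝓕 φ : L2Space d) : RSpace d → ℂ) =ᵐ[volume] G) {t : ℝ} (ht : 0 ≤ t) :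
    ((𝓕 (fracSeries α 1 (ω • ballMultiplier (freeSymbol d) R) φ t) : L2Space d) :
      RSpace d → ℂ) =ᵐ[volume] evolvedSymbol α ω G t := by
  have hU : ∀ η, HasSum (fun k : ℕ => ((fracKernel (α * k + 1) t : ℝ) : ℂ) *
      ((ω * (((2 * Real.pi * ‖η‖) ^ 2 : ℝ) : ℂ)) ^ k * G η)) (evolvedSymbol α ω G t η) := by
    intro η
    have h := (hasSum_mittagLeffler hα
      (ω * ((t ^ α * (2 * Real.pi * ‖η‖) ^ 2 : ℝ) : ℂ))).mul_right (G η)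
    refine (congrArg (fun p => HasSum p _) (funext fun k => ?_)).mp h
    rw [fracKernel, add_sub_cancel_right, Real.rpow_mul ht, Real.rpow_natCast]
    push_cast
    ring
  rcases ht.eq_or_lt with rfl | ht
  · rw [fracSeries_one_zero hα]
    refine hφ.trans (ae_of_all _ fun η => HasSum.unique ?_ (hU η))
    convert hasSum_single (f := fun k : ℕ => ((fracKernel (α * k + 1) 0 : ℝ) : ℂ) *
      ((ω * (((2 * Real.pi * ‖η‖) ^ 2 : ℝ) : ℂ)) ^ k * G η)) 0 fun k hk => ?_
    · simp [fracKernel_one]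
    · have : 0 < α * k := by positivity
      rw [fracKernel_zero_right (by linarith)]
      simp
  · refine Lp.ae_eq_of_hasSum ((summable_fracSeries hα one_pos _ φ ht).hasSum.map
      (Lp.fourierTransformₗᵢ (RSpace d) ℂ) (Lp.fourierTransformₗᵢ (RSpace d) ℂ).continuous)
      (fun k => ?_) hU
    have h : 𝓕 (fracKernel (α * k + 1) t • ((ω • ballMultiplier (freeSymbol d) R) ^ k) φ) =
        ((fracKernel (α * k + 1) t : ℝ) : ℂ) •
          𝓕 (((ω • ballMultiplier (freeSymbol d) R) ^ k) φ) := by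
      rw [← FourierTransform.fourier_smul]
      exact congrArg _ (algebraMap_smul ℂ _ _).symm
    change ((𝓕 (fracKernel (α * k + 1) t • ((ω • ballMultiplier (freeSymbol d) R) ^ k) φ) :
      L2Space d) : RSpace d → ℂ) =ᵐ[volume] _
    rw [h]
    filter_upwards [Lp.coeFn_smul ((fracKernel (α * k + 1) t : ℝ) : ℂ)
      (𝓕 (((ω • ballMultiplier (freeSymbol d) R) ^ k) φ)),
      fourier_smul_ballMultiplier_pow hGR ω hφ k] with η h1 h2
    rw [h1, Pi.smul_apply, h2, smul_eq_mul]
end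

/-! ### Existence and uniqueness of the solution. -/

section
open FourierTransform
variable {d : ℕ} {α β : ℝ}

theorem caputo_eq_integral_fracKernel (hα : α < 1) (v : ℝ → L2Space d) (t : ℝ) :
    caputo α v t = ∫ s in (0 : ℝ)..t, fracKernel (1 - α) (t - s) • v s := by
  rw [caputo, if_neg hα.ne, ← intervalIntegral.integral_smul]
  refine intervalIntegral.integral_congr fun s _ => ?_
  simp only [fracKernel, smul_smul, sub_sub_cancel_left]
  rw [div_eq_inv_mul]

theorem IsW11WithDeriv.continuousOn {u v : ℝ → L2Space d} (h : IsW11WithDeriv u v) {T : ℝ}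
    (hT : 0 < T) : ContinuousOn u (Set.Icc 0 T) := by
  have h1 : IntegrableOn v (Set.uIcc 0 T) volume := by
    rw [Set.uIcc_of_le hT.le, integrableOn_Icc_iff_integrableOn_Ioc]
    exact h.1 T hT
  have h2 := intervalIntegral.continuousOn_primitive_interval h1
  rw [Set.uIcc_of_le hT.le] at h2
  exact (continuousOn_const.add h2).congr fun t ht => h.2 t ht.1

theorem IsW11WithDeriv.tendsto_zero {u v : ℝ → L2Space d} (h : IsW11WithDeriv u v) :
    Tendsto u (𝓝[>] 0) (𝓝 (u 0)) := by
  have h1 := h.continuousOn one_pos 0 ⟨le_rfl, zero_le_one⟩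
  refine h1.tendsto.mono_left ?_
  rw [← nhdsWithin_Ioc_eq_nhdsGT (zero_lt_one' ℝ)]
  exact nhdsWithin_mono 0 Set.Ioc_subset_Icc_self

theorem I_cpow_ne_zero (z : ℂ) : Complex.I ^ z ≠ 0 := by
  simp [Complex.cpow_eq_zero_iff]

theorem caputo_fracSeries (hα : 0 < α) (hα1 : α ≤ 1) (B : L2Space d →L[ℂ] L2Space d)
    (φ : L2Space d) {t : ℝ} (ht : 0 < t) :
    caputo α (fracSeries α α B (B φ)) t = B (fracSeries α 1 B φ t) := by
  rw [map_fracSeries hα one_pos B φ ht]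
  rcases hα1.eq_or_lt with rfl | h1
  · rw [caputo, if_pos rfl]
  · rw [caputo_eq_integral_fracKernel h1,
      (fracSeries_convolution hα (sub_pos.2 h1) hα B (B φ) ht).2, sub_add_cancel]

theorem isTFSESolution_fracSeries (hα : 0 < α) (hα1 : α ≤ 1) {G : RSpace d → ℂ} {R : ℝ}
    (hGR : ∀ η, R < ‖η‖ → G η = 0) {φ : L2Space d}
    (hφ : ((𝓕 φ : L2Space d) : RSpace d → ℂ) =ᵐ[volume] G) :
    IsTFSESolution α β φ
      (fracSeries α 1 ((Complex.I ^ (β : ℂ))⁻¹ • ballMultiplier (freeSymbol d) R) φ) := by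
  set H := ballMultiplier (freeSymbol d) R with hH
  set B := (Complex.I ^ (β : ℂ))⁻¹ • H with hB
  have hW : IsW11WithDeriv (fracSeries α 1 B φ) (fracSeries α α B (B φ)) := by
    refine ⟨fun T hT => integrableOn_fracSeries hα hα B (B φ) hT, fun t ht => ?_⟩
    rw [fracSeries_one_zero hα]
    rcases ht.eq_or_lt with rfl | ht
    · rw [fracSeries_one_zero hα, intervalIntegral.integral_same, add_zero]
    · rw [integral_fracSeries hα hα B (B φ) ht, fracSeries_one_eq_add hα B φ ht]
  -- The derivative series comes from differentiating term by term: the constant term drops and the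
  -- shifted index produces B φ.
  refine ⟨fracSeries α α B (B φ), fun t => H (fracSeries α 1 B φ t), hW, ?_, ?_, ?_, ?_⟩
  · intro t ht
    refine ⟨Set.Ioc 0 (t + 1), ?_, ?_⟩
    · rw [mem_nhdsWithin]
      exact ⟨Set.Iio (t + 1), isOpen_Iio, by simp, fun s hs => ⟨hs.2, hs.1.le⟩⟩
    · exact H.integrable_comp (integrableOn_fracSeries hα one_pos B φ
        (by linarith [Set.mem_Ioi.1 ht]))
  · refine (ae_restrict_mem measurableSet_Ioi).mono fun t ht => ?_
    rw [isFreeHamiltonian_iff]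
    filter_upwards [fourier_ballMultiplier (freeSymbol d) R (fracSeries α 1 B φ t),
      fourier_fracSeries hα hGR (Complex.I ^ (β : ℂ))⁻¹ hφ (Set.mem_Ioi.1 ht).le] with η h1 h2
    rw [h1]
    -- In the ball the truncated symbol is that of -Δ; outside it the evolved symbol vanishes along
    -- with G.
    by_cases hη : η ∈ Metric.closedBall (0 : RSpace d) R
    · rw [Set.indicator_of_mem hη]
      rfl
    · rw [Set.indicator_of_notMem hη, h2, evolvedSymbol, hGR η (by simpa using hη)]
      simp
  · refine (ae_restrict_mem measurableSet_Ioi).mono fun t ht => ?_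
    simp only
    rw [caputo_fracSeries hα hα1 B φ ht, hB, smul_apply, smul_smul,
      mul_inv_cancel₀ (I_cpow_ne_zero _), one_smul, neg_add_cancel]
  · have h := (hW.tendsto_zero.sub_const φ).norm
    rwa [fracSeries_one_zero hα, sub_self, norm_zero] at h

/-- Fractional integration of order α applied to the equation gives its Volterra form, in which no
derivative of the solution is left. -/
theorem IsTFSESolution.eq_add_integral (hα : 0 < α) (hα1 : α ≤ 1) {φ : L2Space d}
    {w : ℝ → L2Space d} (hw : IsTFSESolution α β φ w) :
    (∀ T, 0 < T → ContinuousOn w (Set.Icc 0 T)) ∧ w 0 = φ ∧ ∃ h : ℝ → L2Space d,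
      (∀ᵐ t : ℝ ∂(volume.restrict (Set.Ioi 0)), IsFreeHamiltonian (w t) (h t)) ∧
      ∀ t, 0 < t →
        IntegrableOn (fun τ => fracKernel α (t - τ) • (Complex.I ^ (β : ℂ))⁻¹ • h τ)
          (Set.Ioc 0 t) volume ∧
        w t = φ + ∫ τ in (0 : ℝ)..t,
          fracKernel α (t - τ) • (Complex.I ^ (β : ℂ))⁻¹ • h τ := by
  obtain ⟨v, h, hW, -, hH, heq, hlim⟩ := hw
  have h0 : w 0 = φ := by
    have h1 := (hW.tendsto_zero.sub_const φ).norm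
    exact sub_eq_zero.1 (norm_eq_zero.1 (tendsto_nhds_unique h1 hlim))
  refine ⟨fun T => hW.continuousOn, h0, h, hH, fun t ht => ?_⟩
  have hcap : ∀ᵐ τ ∂(volume.restrict (Set.Ioc 0 t)),
      caputo α v τ = (Complex.I ^ (β : ℂ))⁻¹ • h τ := by
    filter_upwards [ae_restrict_of_ae_restrict_of_subset Set.Ioc_subset_Ioi_self heq] with τ hτ
    rw [← neg_add_eq_zero.1 hτ, smul_smul, inv_mul_cancel₀ (I_cpow_ne_zero _), one_smul]
  have key : IntegrableOn (fun τ => fracKernel α (t - τ) • caputo α v τ) (Set.Ioc 0 t) volume ∧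
      ∫ τ in (0 : ℝ)..t, fracKernel α (t - τ) • caputo α v τ = ∫ s in (0 : ℝ)..t, v s := by
    rcases hα1.eq_or_lt with rfl | h1
    · simpa [fracKernel_one, caputo] using hW.1 t ht
    · simp_rw [caputo_eq_integral_fracKernel h1]
      exact integral_fracKernel_convolution hα h1 ht (hW.1 t ht)
  have hae : (fun τ => fracKernel α (t - τ) • caputo α v τ) =ᵐ[volume.restrict (Set.Ioc 0 t)]
      fun τ => fracKernel α (t - τ) • (Complex.I ^ (β : ℂ))⁻¹ • h τ := by
    filter_upwards [hcap] with τ hτ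
    rw [hτ]
  refine ⟨key.1.congr hae, ?_⟩
  rw [hW.2 t ht.le, h0, ← key.2, intervalIntegral.integral_of_le ht.le,
    intervalIntegral.integral_of_le ht.le, integral_congr_ae hae]

theorem ballMultiplier_freeHamiltonian (r : ℝ) {f h : L2Space d} (hf : IsFreeHamiltonian f h) :
    ballMultiplier 1 r h = ballMultiplier (freeSymbol d) r (ballMultiplier 1 r f) := by
  refine Lp.fourier_ext ?_
  filter_upwards [fourier_ballMultiplier 1 r h, fourier_ballMultiplier 1 r f,
    fourier_ballMultiplier (freeSymbol d) r (ballMultiplier 1 r f),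
    (isFreeHamiltonian_iff f h).1 hf] with η h1 h2 h3 h4
  rw [h1, h3]
  by_cases hη : η ∈ Metric.closedBall (0 : RSpace d) r
  · rw [Set.indicator_of_mem hη, Set.indicator_of_mem hη, h2, Set.indicator_of_mem hη, h4]
    simp [freeSymbol]
  · rw [Set.indicator_of_notMem hη, Set.indicator_of_notMem hη]

theorem eq_zero_of_forall_ballMultiplier_eq_zero {f : L2Space d}
    (hf : ∀ n : ℕ, ballMultiplier 1 n f = 0) : f = 0 := by
  refine Lp.fourier_ext ?_
  have h0 : ∀ n : ℕ, ∀ᵐ η, η ∈ Metric.closedBall (0 : RSpace d) n →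
      (𝓕 f : L2Space d) η = (𝓕 (0 : L2Space d) : L2Space d) η := fun n => by
    have h1 := fourier_ballMultiplier 1 n f
    rw [hf n] at h1
    filter_upwards [h1] with η h1 hη
    rw [h1, Set.indicator_of_mem hη]
    simp
  filter_upwards [ae_all_iff.2 h0] with η hη
  obtain ⟨n, hn⟩ := exists_nat_ge ‖η‖
  exact hη n (by simpa using hn)

theorem IsTFSESolution.ballMultiplier_eq (hα : 0 < α) (hα1 : α ≤ 1) {φ : L2Space d}
    {w : ℝ → L2Space d} (hw : IsTFSESolution α β φ w) (r : ℝ) {t : ℝ} (ht : 0 < t) :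
    IntervalIntegrable (fun τ => fracKernel α (t - τ) • ((Complex.I ^ (β : ℂ))⁻¹ •
      ballMultiplier (freeSymbol d) r) (ballMultiplier 1 r (w τ))) volume 0 t ∧
    ballMultiplier 1 r (w t) = ballMultiplier 1 r φ + ∫ τ in (0 : ℝ)..t, fracKernel α (t - τ) •
      ((Complex.I ^ (β : ℂ))⁻¹ • ballMultiplier (freeSymbol d) r) (ballMultiplier 1 r (w τ)) := by
  obtain ⟨-, -, h, hH, hint⟩ := hw.eq_add_integral hα hα1
  obtain ⟨hI, hE⟩ := hint t ht
  have hae : (fun τ => ballMultiplier 1 r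
      (fracKernel α (t - τ) • (Complex.I ^ (β : ℂ))⁻¹ • h τ)) =ᵐ[volume.restrict (Set.Ioc 0 t)]
      fun τ => fracKernel α (t - τ) • ((Complex.I ^ (β : ℂ))⁻¹ •
        ballMultiplier (freeSymbol d) r) (ballMultiplier 1 r (w τ)) := by
    filter_upwards [ae_restrict_of_ae_restrict_of_subset Set.Ioc_subset_Ioi_self hH] with τ hτ
    rw [map_real_smul_apply, map_smul, ballMultiplier_freeHamiltonian r hτ, smul_apply]
  refine ⟨(intervalIntegrable_iff_integrableOn_Ioc_of_le ht.le).2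
    (((ballMultiplier 1 r).integrable_comp hI).congr hae), ?_⟩
  rw [hE, map_add, intervalIntegral.integral_of_le ht.le, intervalIntegral.integral_of_le ht.le,
    ← integral_congr_ae hae, ContinuousLinearMap.integral_comp_comm _ hI]

/-- The frequency cutoff to a ball commutes with -Δ and makes it bounded, so the Volterra argument
applies to each cutoff of the difference. The balls exhaust the frequency space. -/
theorem IsTFSESolution.unique (hα : 0 < α) (hα1 : α ≤ 1) {φ : L2Space d} {u w : ℝ → L2Space d}
    (hu : IsTFSESolution α β φ u) (hw : IsTFSESolution α β φ w) {t : ℝ} (ht : 0 ≤ t) :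
    w t = u t := by
  obtain ⟨hcu, hu0, -⟩ := hu.eq_add_integral hα hα1
  obtain ⟨hcw, hw0, -⟩ := hw.eq_add_integral hα hα1
  rcases ht.eq_or_lt with rfl | ht
  · rw [hu0, hw0]
  rw [← sub_eq_zero]
  refine eq_zero_of_forall_ballMultiplier_eq_zero fun n => ?_
  set P : L2Space d →L[ℂ] L2Space d := ballMultiplier 1 (n : ℝ) with hP
  obtain ⟨M, hM⟩ := isCompact_Icc.exists_bound_of_continuousOn
    (P.continuous.comp_continuousOn ((hcw t ht).sub (hcu t ht)))
  refine fractional_volterra_unique hα ((Complex.I ^ (β : ℂ))⁻¹ • ballMultiplier (freeSymbol d) n)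
    (z := fun τ => P (w τ - u τ)) (T := t) (M := M)
    (fun τ hτ => hM τ ⟨hτ.1.le, hτ.2⟩) (fun τ hτ => ?_) t ⟨ht, le_rfl⟩
  obtain ⟨h1, h2⟩ := hw.ballMultiplier_eq hα hα1 n hτ.1
  obtain ⟨h3, h4⟩ := hu.ballMultiplier_eq hα hα1 n hτ.1
  simp only [map_sub, smul_sub]
  rw [hP, h2, h4, add_sub_add_left_eq_sub, ← intervalIntegral.integral_sub h1 h3]
end

/-! ### Bounds for the mean square displacement. -/

section
open FourierTransform
variable {d : ℕ} {α : ℝ} {s₀ : ℂ} {G : RSpace d → ℂ}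

theorem exists_meanSquareDisplacement_le (hα : 0 < α) (hα1 : α ≤ 1)
    (hs₀ : 0 < s₀.re) (hs₁ : ‖s₀‖ = 1) (hG : ContDiff ℝ 1 G) (hGc : HasCompactSupport G)
    {R : ℝ} (hR : 0 < R) (hGR : ∀ η, R ≤ ‖η‖ → G η = 0) :
    ∃ K : ℝ, 0 ≤ K ∧ ∀ t : ℝ, 1 ≤ t → ∀ φ : L2Space d,
      ((𝓕 φ : L2Space d) : RSpace d → ℂ) =ᵐ[volume] evolvedSymbol α (s₀ ^ (α : ℂ)) G t →
      meanSquareDisplacement φ ≤ K * Real.exp (2 * s₀.re * (2 * Real.pi * R) ^ (2 / α) * t) := by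
  obtain ⟨K, hK, hb⟩ := exists_norm_fderiv_evolvedSymbol_le hα hα1 hs₀ hs₁ hG hGc hR hGR
  set V := volume.real (Metric.closedBall (0 : RSpace d) R)
  refine ⟨((2 * Real.pi) ^ 2)⁻¹ * (d * (V * K ^ 2)), by positivity, fun t ht φ hφ => ?_⟩
  rw [(meanSquareDisplacement_fourierInv (contDiff_evolvedSymbol hα hG t)
    (hasCompactSupport_evolvedSymbol hGc t) φ hφ).2, mul_assoc]
  refine mul_le_mul_of_nonneg_left ?_ (by positivity)
  set E := K * Real.exp (s₀.re * ((2 * Real.pi * R) ^ (2 / α) * t)) with hE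
  have hE2 : V * E ^ 2 = V * K ^ 2 * Real.exp (2 * s₀.re * (2 * Real.pi * R) ^ (2 / α) * t) := by
    rw [hE, mul_pow, ← Real.exp_nat_mul]
    push_cast
    ring_nf
  have hj : ∀ j : Fin d, ∫ η, ‖fderiv ℝ (evolvedSymbol α (s₀ ^ (α : ℂ)) G t) η
      (EuclideanSpace.single j 1)‖ ^ 2 ≤ V * E ^ 2 := fun j => by
    have hind : ∫ η, (Metric.closedBall (0 : RSpace d) R).indicator (fun _ => E ^ 2) η =
        V * E ^ 2 := by
      rw [integral_indicator_const _ measurableSet_closedBall, smul_eq_mul]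
    rw [← hind]
    refine integral_mono_of_nonneg (ae_of_all _ fun η => by positivity) ?_
      (ae_of_all _ fun η => ?_)
    · exact (integrableOn_const (C := E ^ 2)
        (isCompact_closedBall (0 : RSpace d) R).measure_ne_top).integrable_indicator
        measurableSet_closedBall
    · have h := pow_le_pow_left₀ (norm_nonneg _)
        (hb t ht η (EuclideanSpace.single j 1) (by simp)) 2
      refine h.trans (le_of_eq ?_)
      by_cases hη : η ∈ Metric.closedBall (0 : RSpace d) R <;> simp [hη, hE]
  calc _ ≤ ∑ _j : Fin d, V * E ^ 2 := Finset.sum_le_sum fun j _ => hj j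
    _ = _ := by
      rw [Finset.sum_const, Finset.card_univ, Fintype.card_fin, nsmul_eq_mul, hE2]
      ring

theorem exists_le_meanSquareDisplacement (hα : 0 < α) (hα1 : α ≤ 1)
    (hs₀ : 0 < s₀.re) (hs₁ : ‖s₀‖ = 1) (hG : ContDiff ℝ 1 G) (hGc : HasCompactSupport G)
    {η₁ : RSpace d} (hη₁ : G η₁ ≠ 0) {j : Fin d} (hj : η₁ j ≠ 0) {ρ : ℝ} (hρ : 0 < ρ)
    (hρη : ρ < 2 * Real.pi * ‖η₁‖) :
    ∃ c T : ℝ, 0 < c ∧ ∀ t : ℝ, T ≤ t → ∀ φ : L2Space d,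
      ((𝓕 φ : L2Space d) : RSpace d → ℂ) =ᵐ[volume] evolvedSymbol α (s₀ ^ (α : ℂ)) G t →
      c * Real.exp (2 * s₀.re * ρ ^ (2 / α) * t) ≤ meanSquareDisplacement φ := by
  set e : RSpace d := EuclideanSpace.single j 1 with he
  have hinner : ∀ η : RSpace d, inner ℝ η e = η j := fun η => by
    simp [he, EuclideanSpace.inner_single_right]
  have hev : ∀ᶠ η in 𝓝 η₁, ρ < 2 * Real.pi * ‖η‖ ∧ |η₁ j| / 2 < |inner ℝ η e| ∧
      ‖G η₁‖ / 2 < ‖G η‖ := by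
    have h1 : ContinuousAt (fun η : RSpace d => 2 * Real.pi * ‖η‖) η₁ := by fun_prop
    have h2 : ContinuousAt (fun η : RSpace d => |inner ℝ η e|) η₁ := by fun_prop
    refine (h1.tendsto.eventually_const_lt hρη).and ((h2.tendsto.eventually_const_lt ?_).and
      (hG.continuous.norm.continuousAt.tendsto.eventually_const_lt
        (half_lt_self (norm_pos_iff.2 hη₁))))
    rw [hinner]
    exact half_lt_self (abs_pos.2 hj)
  obtain ⟨δ, hδ, hball⟩ := Metric.eventually_nhds_iff_ball.1 hev
  set S := Metric.ball η₁ δ with hS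
  have hSR : ∀ η ∈ S, ‖η‖ ≤ ‖η₁‖ + δ := fun η hη => by
    have h1 : ‖η - η₁‖ < δ := mem_ball_iff_norm.1 hη
    linarith [norm_le_norm_add_norm_sub' η η₁]
  obtain ⟨T, -, hT⟩ := exists_le_norm_fderiv_evolvedSymbol hα hα1 hs₀ hs₁ hG hGc (S := S) (e := e)
    (by simp [he]) (R := ‖η₁‖ + δ) (ρ := ρ) (by positivity) hρ (half_pos (abs_pos.2 hj))
    (half_pos (norm_pos_iff.2 hη₁)) hSR (fun η hη => (hball η hη).1.le)
    (fun η hη => (hball η hη).2.1.le) (fun η hη => (hball η hη).2.2.le)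
  have hV : 0 < volume.real S :=
    ENNReal.toReal_pos (Metric.measure_ball_pos volume η₁ hδ).ne' measure_ball_lt_top.ne
  refine ⟨((2 * Real.pi) ^ 2)⁻¹ * volume.real S, T, by positivity, fun t ht φ hφ => ?_⟩
  have hUd := contDiff_evolvedSymbol (ω := s₀ ^ (α : ℂ)) hα hG t
  have hUc := hasCompactSupport_evolvedSymbol (α := α) (ω := s₀ ^ (α : ℂ)) hGc t
  rw [(meanSquareDisplacement_fourierInv hUd hUc φ hφ).2, mul_assoc]
  refine mul_le_mul_of_nonneg_left ?_ (by positivity)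
  refine le_trans ?_ (Finset.single_le_sum (f := fun j : Fin d => ∫ η,
    ‖fderiv ℝ (evolvedSymbol α (s₀ ^ (α : ℂ)) G t) η (EuclideanSpace.single j 1)‖ ^ 2)
    (fun i _ => integral_nonneg fun η => by positivity) (Finset.mem_univ j))
  have hint : Integrable fun η =>
      ‖fderiv ℝ (evolvedSymbol α (s₀ ^ (α : ℂ)) G t) η e‖ ^ 2 := by
    refine Continuous.integrable_of_hasCompactSupport
      (((hUd.continuous_fderiv one_ne_zero).clm_apply continuous_const).norm.pow 2) ?_
    exact (hUc.fderiv ℝ).comp_left (g := fun T : RSpace d →L[ℝ] ℂ => ‖T e‖ ^ 2) (by simp)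
  have hconst : Real.exp (2 * s₀.re * ρ ^ (2 / α) * t) =
      Real.exp (s₀.re * (ρ ^ (2 / α) * t)) ^ 2 := by
    rw [← Real.exp_nat_mul]
    push_cast
    ring_nf
  calc volume.real S * Real.exp (2 * s₀.re * ρ ^ (2 / α) * t)
      = ∫ _η in S, Real.exp (2 * s₀.re * ρ ^ (2 / α) * t) := by
        rw [setIntegral_const, smul_eq_mul]
    _ ≤ ∫ η in S, ‖fderiv ℝ (evolvedSymbol α (s₀ ^ (α : ℂ)) G t) η e‖ ^ 2 := by
        refine setIntegral_mono_on (integrableOn_const measure_ball_lt_top.ne)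
          hint.integrableOn measurableSet_ball fun η hη => ?_
        rw [hconst]
        exact pow_le_pow_left₀ (Real.exp_pos _).le (hT t ht η hη) 2
    _ ≤ _ := setIntegral_le_integral hint (ae_of_all _ fun η => by positivity)

/-- The set where g ≠ 0 is open: move along the j-th axis to reach a nonzero coordinate, then shrink
slightly along the ray. -/
theorem exists_ne_zero_norm_lt {g : RSpace d → ℂ} (hg : Continuous g) (hg0 : g ≠ 0) (j : Fin d) :
    ∃ ξ₁ ξ₂ : RSpace d, g ξ₁ ≠ 0 ∧ g ξ₂ ≠ 0 ∧ ξ₁ j ≠ 0 ∧ ‖ξ₂‖ < ‖ξ₁‖ := by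
  obtain ⟨ξ, hξ⟩ := Function.ne_iff.1 hg0
  obtain ⟨ξ₁, h1, h1j⟩ : ∃ ξ₁, g ξ₁ ≠ 0 ∧ ξ₁ j ≠ 0 := by
    by_cases hξj : ξ j = 0
    · have hc : ContinuousAt (fun ε : ℝ => g (ξ + ε • EuclideanSpace.single j 1)) 0 := by fun_prop
      have h := (hc.eventually_ne (y := 0) (by simpa using hξ)).filter_mono
        (nhdsWithin_le_nhds (s := {0}ᶜ))
      obtain ⟨ε, hε, hε0⟩ := (h.and (self_mem_nhdsWithin (a := (0 : ℝ)) (s := {0}ᶜ))).exists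
      exact ⟨_, hε, by simpa [hξj] using hε0⟩
    · exact ⟨ξ, hξ, hξj⟩
  have hξ₁ : 0 < ‖ξ₁‖ := norm_pos_iff.2 fun h => h1j (by simp [h])
  have hc : ContinuousAt (fun s : ℝ => g (s • ξ₁)) 1 := by fun_prop
  have h := (hc.eventually_ne (y := 0) (by simpa using h1)).filter_mono
    (nhdsWithin_le_nhds (s := Set.Iio 1))
  obtain ⟨s, hs, hs0, hs1⟩ := (h.and (Ioo_mem_nhdsLT (zero_lt_one' ℝ))).exists
  refine ⟨ξ₁, s • ξ₁, h1, hs, h1j, ?_⟩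
  rw [norm_smul, Real.norm_of_nonneg hs0.le]
  exact mul_lt_of_lt_one_left hξ₁ hs1

theorem eventually_pow_mul_exp_le {a b c : ℝ} (hab : a < b) (hc : 0 < c) (A : ℝ) (n : ℕ) :
    ∀ᶠ t : ℝ in atTop, A * t ^ n * Real.exp (a * t) ≤ c * Real.exp (b * t) := by
  have h := (isLittleO_pow_exp_pos_mul_atTop (k := n) (sub_pos.2 hab)).def
    (show 0 < c / (|A| + 1) by positivity)
  filter_upwards [h] with t ht
  rw [Real.norm_of_nonneg (Real.exp_pos _).le, Real.norm_eq_abs] at ht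
  have h1 : A * t ^ n ≤ c * Real.exp ((b - a) * t) := by
    calc A * t ^ n ≤ |A| * |t ^ n| := by rw [← abs_mul]; exact le_abs_self _
      _ ≤ (|A| + 1) * (c / (|A| + 1) * Real.exp ((b - a) * t)) := by gcongr; linarith
      _ = _ := by field_simp
  calc A * t ^ n * Real.exp (a * t) ≤ c * Real.exp ((b - a) * t) * Real.exp (a * t) := by gcongr
    _ = _ := by rw [mul_assoc, ← Real.exp_add]; ring_nf

/-- Since β < α, the argument of the exponential lies in (-π, 0), so the principal logarithm returns
it and the factor α cancels. -/
theorem exp_cpow_eq_inv_I_cpow {β : ℝ} (hβ : 0 < β) (hβα : β < α) :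
    Complex.exp (((-(Real.pi * β / (2 * α)) : ℝ) : ℂ) * Complex.I) ^ (α : ℂ) =
      (Complex.I ^ (β : ℂ))⁻¹ := by
  have hα : 0 < α := hβ.trans hβα
  have h1 : 0 < Real.pi * β / (2 * α) := by have := Real.pi_pos; positivity
  have h2 : Real.pi * β / (2 * α) < Real.pi := by
    rw [div_lt_iff₀ (by positivity)]
    nlinarith [Real.pi_pos]
  have him : (((-(Real.pi * β / (2 * α)) : ℝ) : ℂ) * Complex.I).im =
      -(Real.pi * β / (2 * α)) := by simp [-Complex.ofReal_neg, -Complex.ofReal_div]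
  rw [Complex.cpow_def_of_ne_zero (Complex.exp_ne_zero _),
    Complex.log_exp (by rw [him]; linarith) (by rw [him]; linarith [Real.pi_pos]),
    Complex.cpow_def_of_ne_zero Complex.I_ne_zero, Complex.log_I, ← Complex.exp_neg]
  congr 1
  have : (α : ℂ) ≠ 0 := by exact_mod_cast hα.ne'
  push_cast
  field_simp

theorem growthExp_mono {α β L L' t : ℝ} (hα : 0 < α)
    (hc : 0 ≤ Real.cos (Real.pi * β / (2 * α))) (hL : 0 ≤ L) (hLL : L ≤ L') (ht : 0 ≤ t) :
    growthExp α β L t ≤ growthExp α β L' t := by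
  unfold growthExp
  gcongr

theorem weightedNormSq_nonneg (α : ℝ) (g : RSpace d → ℂ) : 0 ≤ weightedNormSq α g :=
  integral_nonneg fun _ => by positivity

theorem exists_forall_mem_tsupport_norm_le {g : RSpace d → ℂ} (hgc : HasCompactSupport g)
    {ξ₀ : RSpace d} (hξ₀ : g ξ₀ ≠ 0) : ∃ ξ ∈ tsupport g, ∀ ζ ∈ tsupport g, ‖ζ‖ ≤ ‖ξ‖ :=
  hgc.isCompact.exists_isMaxOn ⟨ξ₀, subset_tsupport g hξ₀⟩ continuous_norm.continuousOn

/-- Continuity along the ray extends the vanishing to the boundary sphere, where the Lipschitz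
estimate needs it. -/
theorem eq_zero_of_forall_lt_norm {g : RSpace d → ℂ} (hg : Continuous g) {L : ℝ} (hL : 0 < L)
    (h : ∀ ξ, L < ‖ξ‖ → g ξ = 0) (ξ : RSpace d) (hξ : L ≤ ‖ξ‖) : g ξ = 0 := by
  have hc : Tendsto (fun s : ℝ => g (s • ξ)) (𝓝[>] 1) (𝓝 (g ξ)) := by
    have : ContinuousAt (fun s : ℝ => g (s • ξ)) 1 := by fun_prop
    simpa using this.tendsto.mono_left (nhdsWithin_le_nhds (s := Set.Ioi 1))
  refine tendsto_nhds_unique hc (tendsto_const_nhds.congr' ?_)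
  filter_upwards [self_mem_nhdsWithin] with s hs
  have hs1 : (1 : ℝ) < s := hs
  rw [h]
  rw [norm_smul, Real.norm_of_nonneg (by linarith)]
  nlinarith
end

/-! ### Assembling the evolution and the growth estimates. -/

section
open FourierTransform
variable {d : ℕ}

/-- The initial state on the Fourier side, in the frequency variable of `𝓕`. -/
noncomputable def rescaledProfile (g : RSpace d → ℂ) (η : RSpace d) : ℂ :=
  (((2 * Real.pi) ^ ((d : ℝ) / 2) : ℝ) : ℂ) * g ((2 * Real.pi) • η)

theorem rescaledProfile_ne_zero_iff {g : RSpace d → ℂ} {η : RSpace d} :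
    rescaledProfile g η ≠ 0 ↔ g ((2 * Real.pi) • η) ≠ 0 := by
  have h : (((2 * Real.pi) ^ ((d : ℝ) / 2) : ℝ) : ℂ) ≠ 0 :=
    Complex.ofReal_ne_zero.2 (Real.rpow_pos_of_pos (by positivity) _).ne'
  simp only [rescaledProfile, ne_eq, mul_eq_zero, h, false_or]

theorem contDiff_rescaledProfile {g : RSpace d → ℂ} (hg : ContDiff ℝ 1 g) :
    ContDiff ℝ 1 (rescaledProfile g) := by
  unfold rescaledProfile
  fun_prop

theorem hasCompactSupport_rescaledProfile {g : RSpace d → ℂ} (hgc : HasCompactSupport g) :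
    HasCompactSupport (rescaledProfile g) :=
  (hgc.comp_smul (c := 2 * Real.pi) (by positivity)).mul_left

theorem fourier_ae_eq_rescaledProfile {g : RSpace d → ℂ} (hg : ContDiff ℝ 1 g)
    (hgc : HasCompactSupport g) {φ : L2Space d}
    (hφ : (φ : RSpace d → ℂ) =ᵐ[volume] adjointFourier g) :
    ((𝓕 φ : L2Space d) : RSpace d → ℂ) =ᵐ[volume] rescaledProfile g :=
  fourier_ae_eq_of_ae_eq_fourierInv (contDiff_rescaledProfile hg).continuous
    (hasCompactSupport_rescaledProfile hgc)
    (hφ.trans (ae_of_all _ fun x => adjointFourier_eq_fourierInv g x))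

theorem exists_evolution {α β : ℝ} (hβ : 0 < β) (hβα : β < α) (hα : α ≤ 1) (hd : 1 ≤ d)
    {g : RSpace d → ℂ} (hg : ContDiff ℝ 1 g) (hgc : HasCompactSupport g) (hg0 : g ≠ 0)
    {u₀ : L2Space d} (hu₀ : (u₀ : RSpace d → ℂ) =ᵐ[volume] adjointFourier g) :
    ∃ u : ℝ → L2Space d, IsTFSESolution α β u₀ u ∧ (∀ t : ℝ, 0 ≤ t → MemWeightedL2 (u t)) ∧
      (∃ ξ ∈ tsupport g, ∃ K : ℝ, 0 ≤ K ∧ ∀ t : ℝ, 1 ≤ t →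
        meanSquareDisplacement (u t) ≤ K * growthExp α β ‖ξ‖ t) ∧
      ∃ ξ ∈ tsupport g, ∃ ρ c T : ℝ, ‖ξ‖ < ρ ∧ 0 < c ∧ ∀ t : ℝ, T ≤ t →
        c * growthExp α β ρ t ≤ meanSquareDisplacement (u t) := by
  have hα0 : 0 < α := hβ.trans hβα
  have hπ := Real.pi_pos
  have h2π : 0 < 2 * Real.pi := by positivity
  set s₀ : ℂ := Complex.exp (((-(Real.pi * β / (2 * α)) : ℝ) : ℂ) * Complex.I) with hs₀
  have hre : s₀.re = Real.cos (Real.pi * β / (2 * α)) := by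
    rw [hs₀, Complex.exp_ofReal_mul_I_re, Real.cos_neg]
  have hs₁ : ‖s₀‖ = 1 := Complex.norm_exp_ofReal_mul_I _
  have hpos : 0 < s₀.re := by
    rw [hre]
    refine Real.cos_pos_of_mem_Ioo ⟨by have : 0 < Real.pi * β / (2 * α) := (by positivity); linarith, ?_⟩
    rw [div_lt_div_iff₀ (by positivity) two_pos]
    nlinarith
  have hcpow : s₀ ^ (α : ℂ) = (Complex.I ^ (β : ℂ))⁻¹ := exp_cpow_eq_inv_I_cpow hβ hβα
  obtain ⟨ξ₁, ξ₂, h1, h2, h1j, h12⟩ := exists_ne_zero_norm_lt hg.continuous hg0 (⟨0, hd⟩ : Fin d)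
  obtain ⟨ξ, hξ, hmax⟩ := exists_forall_mem_tsupport_norm_le hgc h1
  have hΛ : 0 < ‖ξ‖ := (norm_nonneg _).trans_lt (h12.trans_le (hmax _ (subset_tsupport g h1)))
  have hR : 0 < ‖ξ‖ / (2 * Real.pi) := by positivity
  have hG := contDiff_rescaledProfile hg
  have hGc := hasCompactSupport_rescaledProfile hgc
  have hGR : ∀ η, ‖ξ‖ / (2 * Real.pi) < ‖η‖ → rescaledProfile g η = 0 := fun η hη => by
    by_contra h
    have h3 := hmax _ (subset_tsupport g (rescaledProfile_ne_zero_iff.1 h))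
    rw [norm_smul, Real.norm_of_nonneg h2π.le] at h3
    rw [div_lt_iff₀ h2π] at hη
    linarith
  have hF := fourier_ae_eq_rescaledProfile hg hgc hu₀
  set u := fracSeries α 1 ((Complex.I ^ (β : ℂ))⁻¹ •
    ballMultiplier (freeSymbol d) (‖ξ‖ / (2 * Real.pi))) u₀ with hu
  have hFu : ∀ t, 0 ≤ t → ((𝓕 (u t) : L2Space d) : RSpace d → ℂ) =ᵐ[volume]
      evolvedSymbol α (s₀ ^ (α : ℂ)) (rescaledProfile g) t := fun t ht => by
    rw [hcpow]
    exact fourier_fracSeries hα0 hGR _ hF ht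
  refine ⟨u, isTFSESolution_fracSeries hα0 hα hGR hF, fun t ht =>
    (meanSquareDisplacement_fourierInv (contDiff_evolvedSymbol hα0 hG t)
      (hasCompactSupport_evolvedSymbol hGc t) (u t) (hFu t ht)).1, ?_, ?_⟩
  · obtain ⟨K, hK, hub⟩ := exists_meanSquareDisplacement_le hα0 hα hpos hs₁ hG hGc hR
      (eq_zero_of_forall_lt_norm hG.continuous hR hGR)
    refine ⟨ξ, hξ, K, hK, fun t ht => ?_⟩
    have h3 := hub t ht (u t) (hFu t (by linarith))
    rwa [mul_div_cancel₀ _ h2π.ne', hre] at h3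
  · have hnorm : 2 * Real.pi * ‖(2 * Real.pi)⁻¹ • ξ₁‖ = ‖ξ₁‖ := by
      rw [norm_smul, Real.norm_of_nonneg (by positivity), mul_inv_cancel_left₀ h2π.ne']
    obtain ⟨c, T, hc, hlb⟩ := exists_le_meanSquareDisplacement hα0 hα hpos hs₁ hG hGc
      -- Any rate strictly between the two norms would do; the midpoint is taken.
      (η₁ := (2 * Real.pi)⁻¹ • ξ₁) (j := ⟨0, hd⟩) (ρ := (‖ξ₂‖ + ‖ξ₁‖) / 2)
      (by rwa [rescaledProfile_ne_zero_iff, smul_inv_smul₀ h2π.ne'])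
      (mul_ne_zero (by positivity) h1j) (by linarith [norm_nonneg ξ₂]) (by rw [hnorm]; linarith)
    refine ⟨ξ₂, subset_tsupport g h2, (‖ξ₂‖ + ‖ξ₁‖) / 2, c, max T 0, by linarith, hc,
      fun t ht => ?_⟩
    have h3 := hlb t ((le_max_left _ _).trans ht) (u t) (hFu t ((le_max_right _ _).trans ht))
    rwa [hre] at h3

theorem eventually_pow_mul_growthExp_le {α β L ρ c : ℝ} (hα : 0 < α)
    (hκ : 0 < Real.cos (Real.pi * β / (2 * α))) (hL : 0 ≤ L) (hLρ : L < ρ) (hc : 0 < c) (A : ℝ)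
    (n : ℕ) : ∀ᶠ t in atTop, A * t ^ n * growthExp α β L t ≤ c * growthExp α β ρ t :=
  eventually_pow_mul_exp_le (mul_lt_mul_of_pos_left
    (Real.rpow_lt_rpow hL hLρ (by positivity)) (by positivity)) hc A n
end

theorem mainTheorem3 (d : ℕ) (hd : 1 ≤ d) (α β : ℝ) (hβ : 0 < β) (hβα : β < α) (hα : α ≤ 1)
    (g : RSpace d → ℂ) (hg : ContDiff ℝ 1 g) (hgc : HasCompactSupport g) (hg0 : g ≠ 0)
    (u₀ : L2Space d) (hu₀ : (u₀ : RSpace d → ℂ) =ᵐ[volume] adjointFourier g) :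
    ∃ u : ℝ → L2Space d,
      IsTFSESolution α β u₀ u ∧
      (∀ w : ℝ → L2Space d, IsTFSESolution α β u₀ w → ∀ t : ℝ, 0 ≤ t → w t = u t) ∧
      (∀ t : ℝ, 0 ≤ t → MemWeightedL2 (u t)) ∧
      (∃ a : ℝ, 0 < a ∧ ∀ᶠ t in atTop, Real.exp (a * t) ≤ meanSquareDisplacement (u t)) ∧
      ∃ c C : ℝ, 0 < c ∧ 0 < C ∧ ∀ Lm Lp : ℝ, 0 ≤ Lm →
        tsupport g ⊆ {ξ : RSpace d | Lm ≤ ‖ξ‖ ∧ ‖ξ‖ ≤ Lp} →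
        (∃ r s : ℝ → ℝ, r =O[atTop] (fun t : ℝ => t⁻¹) ∧ s =O[atTop] (fun t : ℝ => t⁻¹) ∧
          ∀ᶠ t in atTop,
            growthExp α β Lm t * (c + r t) ≤ meanSquareDisplacement (u t) ∧
            meanSquareDisplacement (u t) ≤ growthExp α β Lp t * (C + s t)) ∧
        (∃ r s : ℝ → ℝ, r =O[atTop] (fun t : ℝ => t⁻¹) ∧ s =O[atTop] (fun t : ℝ => t⁻¹) ∧
          ∀ᶠ t in atTop,
            4 / α ^ 2 * growthExp α β Lm t * t * (weightedNormSq α g + r t)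
              ≤ meanSquareDisplacement (u t) ∧
            meanSquareDisplacement (u t)
              ≤ 4 / α ^ 2 * growthExp α β Lp t * t * (weightedNormSq α g + s t)) ∧
        (∃ r s : ℝ → ℝ, r =O[atTop] (fun t : ℝ => t⁻¹) ∧ s =O[atTop] (fun t : ℝ => t⁻¹) ∧
          ∀ᶠ t in atTop,
            4 / α ^ 4 * growthExp α β Lm t * t ^ 2 * (weightedNormSq α g + r t)
              ≤ meanSquareDisplacement (u t) ∧
            meanSquareDisplacement (u t)
              ≤ 4 / α ^ 4 * growthExp α β Lp t * t ^ 2 * (weightedNormSq α g + s t)) := by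
  have hα0 : 0 < α := hβ.trans hβα
  have hκ : 0 < Real.cos (Real.pi * β / (2 * α)) := by
    have hπ := Real.pi_pos
    have h1 : 0 < Real.pi * β / (2 * α) := by positivity
    refine Real.cos_pos_of_mem_Ioo ⟨by linarith, ?_⟩
    rw [div_lt_div_iff₀ (by positivity) two_pos]
    nlinarith
  obtain ⟨u, hu, huw, ⟨ζ, hζ, K, hK, hub⟩, ξ, hξ, ρ, c, T, hρ, hc, hlb⟩ :=
    exists_evolution hβ hβα hα hd hg hgc hg0 hu₀
  have hρ0 : 0 < ρ := (norm_nonneg _).trans_lt hρ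
  have hN := weightedNormSq_nonneg α g
  have hO : ∀ b : ℝ, (fun t : ℝ => b * t⁻¹) =O[atTop] fun t : ℝ => t⁻¹ :=
    fun b => (isBigO_refl _ _).const_mul_left b
  have hzero : (fun _ : ℝ => (0 : ℝ)) =O[atTop] fun t : ℝ => t⁻¹ := isBigO_zero _ _
  -- The lower constant can be any positive number, because the true rate exceeds the one claimed; 1
  -- is taken. Adding 1 to K only ensures positivity. Neither depends on Λ₋ or Λ₊.
  refine ⟨u, hu, fun w hw t ht => hu.unique hα0 hα hw ht, huw, ?_, 1, K + 1, one_pos,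
    by positivity, fun Lm Lp hLm hsupp => ?_⟩
  -- Half of the available rate, so that the constant c in the lower bound is absorbed.
  · refine ⟨Real.cos (Real.pi * β / (2 * α)) * ρ ^ (2 / α), by positivity, ?_⟩
    have hgap : Real.cos (Real.pi * β / (2 * α)) * ρ ^ (2 / α) <
        2 * Real.cos (Real.pi * β / (2 * α)) * ρ ^ (2 / α) := by
      have : 0 < Real.cos (Real.pi * β / (2 * α)) * ρ ^ (2 / α) := by positivity
      linarith
    filter_upwards [eventually_pow_mul_exp_le hgap hc 1 0, eventually_ge_atTop T] with t h1 h2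
    rw [pow_zero, mul_one, one_mul] at h1
    exact h1.trans (hlb t h2)
  have hlow : ∀ (A : ℝ) (n : ℕ), ∀ᶠ t in atTop,
      A * t ^ n * growthExp α β Lm t ≤ meanSquareDisplacement (u t) := fun A n => by
    filter_upwards [eventually_pow_mul_growthExp_le hα0 hκ hLm ((hsupp hξ).1.trans_lt hρ) hc A n,
      eventually_ge_atTop T] with t h1 h2
    exact h1.trans (hlb t h2)
  have hup : ∀ t : ℝ, 1 ≤ t → meanSquareDisplacement (u t) ≤ growthExp α β Lp t * K :=
    fun t ht => by
      refine (hub t ht).trans ?_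
      rw [mul_comm]
      exact mul_le_mul_of_nonneg_right (growthExp_mono hα0 hκ.le (norm_nonneg _) (hsupp hζ).2
        (by linarith)) hK
  have hE : ∀ t, 0 < growthExp α β Lp t := fun t => Real.exp_pos _
  -- The coefficients Kα²/4 and Kα⁴/4 make the prefactor times the remainder equal to K and K t;
  -- both are at least K for t ≥ 1.
  refine ⟨⟨fun _ => 0, fun _ => 0, hzero, hzero, ?_⟩,
    ⟨fun _ => 0, fun t => K * α ^ 2 / 4 * t⁻¹, hzero, hO _, ?_⟩,
    ⟨fun _ => 0, fun t => K * α ^ 4 / 4 * t⁻¹, hzero, hO _, ?_⟩⟩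
  · filter_upwards [hlow 1 0, eventually_ge_atTop 1] with t h1 ht
    refine ⟨by simpa using h1, (hup t ht).trans ?_⟩
    exact mul_le_mul_of_nonneg_left (by linarith) (hE t).le
  · filter_upwards [hlow (4 / α ^ 2 * weightedNormSq α g) 1, eventually_ge_atTop 1] with t h1 ht
    refine ⟨le_of_eq_of_le (by ring) h1, (hup t ht).trans ?_⟩
    have ht0 : 0 < t := by linarith
    have h2 : 4 / α ^ 2 * growthExp α β Lp t * t * (weightedNormSq α g + K * α ^ 2 / 4 * t⁻¹) =
        4 / α ^ 2 * growthExp α β Lp t * t * weightedNormSq α g + growthExp α β Lp t * K := by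
      field_simp
    rw [h2]
    have := hE t
    exact le_add_of_nonneg_left (by positivity)
  · filter_upwards [hlow (4 / α ^ 4 * weightedNormSq α g) 2, eventually_ge_atTop 1] with t h1 ht
    refine ⟨le_of_eq_of_le (by ring) h1, (hup t ht).trans ?_⟩
    have ht0 : 0 < t := by linarith
    have h2 : 4 / α ^ 4 * growthExp α β Lp t * t ^ 2 *
        (weightedNormSq α g + K * α ^ 4 / 4 * t⁻¹) =
        4 / α ^ 4 * growthExp α β Lp t * t ^ 2 * weightedNormSq α g +
          growthExp α β Lp t * K * t := by
      field_simp
    rw [h2]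
    have := hE t
    have h3 : growthExp α β Lp t * K ≤ growthExp α β Lp t * K * t :=
      le_mul_of_one_le_right (by positivity) ht
    exact h3.trans (le_add_of_nonneg_left (by positivity))
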